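/- Let $d\ge 2$, let $\Omega\subset\mathbb R^d$ and $\omega\subset\Omega$ be bounded Lipschitz domains, let $\gamma=\partial\omega$ with surface measure $\sigma$, and let $c_\Omega>0$ satisfy $\operatorname{dist}(\gamma,\partial\Omega)>c_\Omega$. Let $k\in\mathbb N$ and let $\psi\in L^\infty(\mathbb R^d)$ be nonnegative, compactly supported in a ball $B_{r_0}(0)$, with $\int y_i^\alpha\psi(x-y)\,dy=x_i^\alpha$ for all $x$, $1\le i\le d$, $0\le\alpha\le k$, and with $\psi(x/r_2)\le\psi(x/r_1)$ for $0<r_2<r_1$. For $r>0$ and $f\in L^\infty(\gamma)$ put $$F^r(x)=\int_\gamma f(y)\,r^{-d}\,\psi\Big(\frac{y-x}{r}\Big)\,d\sigma(y).$$ **Subdivisions.** A subdivision of $\Omega$ is a finite family of non-overlapping compact cells with nonempty interior that covers $\overline\Omega$; $h_T=|T|^{1/d}$. Fix an initial subdivision $\mathcal T_0$, a rule splitting each cell into non-overlapping compact children of volume $|T|/q$ (with an integer $q\ge2$), and a routine $\mathrm{REFINE}(\mathcal T,\mathcal M)$, $\mathcal M\subseteq\mathcal T$, whose output is obtained from $\mathcal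 T$ by successive splittings such that every cell of $\mathcal M$ is split at least once. It is assumed of all subdivisions generated from $\mathcal T_0$ by $\mathrm{REFINE}$ that they are uniformly shape-regular ($\operatorname{diam}T\le c\,\rho_T$ for all cells, where $\rho_T$ is the diameter of the largest ball in $T$); that either all of them are conforming simplicial subdivisions, or (hanging nodes allowed) all of them are locally graded, i.e. $h_T\le\kappa h_{T'}$ whenever $\kappa\operatorname{dist}(T,T')\le h_T$, with a fixed $\kappa$; and that, for a fixed $\Lambda\ge1$, $\#\mathcal T_k-\#\mathcal T_0\le\Lambda\sum_{j<k}\#\mathcal R_j$ whenever $\mathcal T_{j+1}=\mathrm{REFINE}(\mathcal T_j,\mathcal R_j)$ with $\mathcal R_j\subseteq\mathcal T_j$ for all $j$. Write $\mathcal G(\gamma,\mathcal T)=\{T\in\mathcal T:T\cap\gamma\ne\emptyset\}$. It is assumed that $\mathcal G(\gamma,\mathcal T_0)$ is quasi-uniform and that, for the uniform refinements $\mathcal T^{(i)}$ of $\mathcal T_0$ (every cell split $i$ times), $\sum_{T\in\mathcal G(\gamma,\mathcal T^{(i)})}|T|\sim q^{-i/d}\sum_{T\in\mathcal G(\gamma,\mathcal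 T_0)}|T|\sim q^{-i/d}\sigma(\gamma)$ uniformly in $i\ge 0$. **Algorithms.** For $g\in L^2(\Omega)$ let $d(g,T)=h_T\|g\|_{L^2(T)}$ and $\mathcal D(g,\mathcal T)=\big(\sum_{T\in\mathcal T}d(g,T)^2\big)^{1/2}$. - $\mathrm{INTERFACE}(\mathcal T,r)$: while some $T\in\mathcal G(\gamma,\mathcal T)$ has $h_T>r/2$, replace $\mathcal T$ by $\mathrm{REFINE}(\mathcal T,\{T\in\mathcal G(\gamma,\mathcal T):h_T>r/2\})$. - $\mathrm{GREEDY}(\mathcal T,g,\tau)$: while $\mathcal D(g,\mathcal T)>\tau$, choose $T\in\mathcal T$ with maximal $d(g,T)$ and replace $\mathcal T$ by $\mathrm{REFINE}(\mathcal T,\{T\})$. - $\mathrm{DATA}(\mathcal T,g,\tau,\theta)$: while $\mathcal D(g,\mathcal T)>\tau$, choose a smallest set $\mathcal M\subseteq\mathcal T$ with $\big(\sum_{T\in\mathcal M}d(g,T)^2\big)^{1/2}\ge\theta\,\mathcal D(g,\mathcal T)$ and replace $\mathcal T$ by $\mathrm{REFINE}(\mathcal T,\mathcal M)$. **Lemma.**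 For $0<r<c_\Omega$ the routine $\mathrm{INTERFACE}(\mathcal T_0,r)$ terminates; let $\widetilde{\mathcal T}$ be its output. Moreover $F^r\in L^2(\Omega)$ for all $r>0$ and $f\in L^\infty(\gamma)$. 1. There is $K_0>0$, independent of $r$, $\tau$ and $f$, such that for all $f\in L^\infty(\gamma)$, $0<r<c_\Omega$ and $\tau>0$, $\mathrm{GREEDY}(\widetilde{\mathcal T},F^r,\tau)$ terminates, and every possible output $\mathcal T^*$ satisfies $$\#\mathcal T^*-\#\widetilde{\mathcal T}\le K_0\,r^{1-d/2}\,\|f\|_{L^\infty(\gamma)}^d\,\tau^{-d}.$$ 2. Consequently the data-approximation assumption holds for $F^r$, started from $\widetilde{\mathcal T}$, with $s=1/d$ and constant $G_{1/d}\sim r^{1-d/2}\|f\|_{L^\infty(\gamma)}^d$: for each $\theta\in(0,1)$ there is $K_1>0$, independent of $r$, $\tau$ and $f$, such that for all $f\in L^\infty(\gamma)$, $0<r<c_\Omega$ and $\tau>0$, $\mathrm{DATA}(\widetilde{\mathcal T},F^r,\tau,\theta)$ terminates, and every possible output $\mathcal T^*$ satisfies $$\#\mathcal T^*-\#\widetilde{\mathcal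 T}\le K_1\,r^{1-d/2}\,\|f\|_{L^\infty(\gamma)}^d\,\tau^{-d}.$$ -/

import Mathlib

open MeasureTheory Set

/-- The Euclidean space `ℝ^d`. -/
abbrev E (d : ℕ) : Type := EuclideanSpace ℝ (Fin d)

/-- A finite family of cells; a cell is a subset of `ℝ^d`. -/
abbrev Mesh (d : ℕ) : Type := Finset (Set (E d))

noncomputable section

/-! ### Domains and the forcing data -/

/-- Bounded Lipschitz domain: a bounded, connected, nonempty open set which near each boundary point
is, in suitable orthonormal coordinates, the open region above the graph of a Lipschitz function.
Here `e` is the vertical unit direction and `x - ⟪e, x⟫ e` the horizontal part of `x`. -/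
structure IsLipschitzDomain {d : ℕ} (U : Set (E d)) : Prop where
  isOpen : IsOpen U
  isConnected : IsConnected U
  isBounded : Bornology.IsBounded U
  graph : ∀ p ∈ frontier U, ∃ (e : E d) (ρ : ℝ) (L : NNReal) (g : E d → ℝ),
    ‖e‖ = 1 ∧ 0 < ρ ∧ LipschitzWith L g ∧
      ∀ x ∈ Metric.ball p ρ, x ∈ U ↔ g (x - inner ℝ e x • e) < inner ℝ e x

/-- Surface measure of a hypersurface `γ ⊆ ℝ^d`. -/
def surfaceMeasure {d : ℕ} (γ : Set (E d)) : Measure (E d) :=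
  (Measure.euclideanHausdorffMeasure (d - 1)).restrict γ

/-- The requirements on the profile `ψ` of the approximate Dirac distribution,
with moments up to order `k`. -/
structure IsMollifier {d : ℕ} (k : ℕ) (ψ : E d → ℝ) : Prop where
  memLp : MemLp ψ ⊤ volume
  nonneg : ∀ x, 0 ≤ ψ x
  support : ∃ r₀ : ℝ, 0 < r₀ ∧ tsupport ψ ⊆ Metric.ball 0 r₀
  moments : ∀ i : Fin d, ∀ α ≤ k, ∀ x : E d, ∫ y : E d, y i ^ α * ψ (x - y) = x i ^ α
  monotone : ∀ r₁ r₂ : ℝ, 0 < r₂ → r₂ < r₁ → ∀ x, ψ (r₂⁻¹ • x) ≤ ψ (r₁⁻¹ • x)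

/-- The Dirac approximation `δ^r (x) = r^{-d} ψ (x / r)`. -/
def diracApprox {d : ℕ} (ψ : E d → ℝ) (r : ℝ) (x : E d) : ℝ :=
  (r ^ d)⁻¹ * ψ (r⁻¹ • x)

/-- The regularized data `F^r (x) = ∫_γ f(y) δ^r (y - x) dσ(y)`. -/
def regData {d : ℕ} (ψ : E d → ℝ) (γ : Set (E d)) (f : E d → ℝ) (r : ℝ) (x : E d) : ℝ :=
  ∫ y, f y * diracApprox ψ r (y - x) ∂(surfaceMeasure γ)

/-- The norm of `L^∞(γ)`. -/
def normLinfty {d : ℕ} (γ : Set (E d)) (f : E d → ℝ) : ℝ :=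
  (eLpNorm f ⊤ (surfaceMeasure γ)).toReal

/-! ### Cells and subdivisions -/

/-- The size `h_T = |T|^{1/d}` of a cell. -/
def cellSize {d : ℕ} (T : Set (E d)) : ℝ := volume.real T ^ (1 / (d : ℝ))

/-- `T` contains a ball of diameter `2 s`, with `diam T ≤ c * (2 s)`. -/
def IsShapeRegular {d : ℕ} (c : ℝ) (T : Set (E d)) : Prop :=
  ∃ (x : E d) (s : ℝ), 0 < s ∧ Metric.closedBall x s ⊆ T ∧ Metric.diam T ≤ c * (2 * s)

/-- A nondegenerate closed simplex. -/
def IsSimplex {d : ℕ} (T : Set (E d)) : Prop :=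
  ∃ v : Fin (d + 1) → E d, AffineIndependent ℝ v ∧ T = convexHull ℝ (range v)

/-- A finite family of compact cells with nonempty interior that do not overlap and cover the
closure of `Ω`. -/
structure IsSubdivision {d : ℕ} (Ω : Set (E d)) (𝒯 : Mesh d) : Prop where
  compact : ∀ T ∈ 𝒯, IsCompact T
  interior : ∀ T ∈ 𝒯, (interior T).Nonempty
  cover : (⋃ T ∈ 𝒯, T) = closure Ω
  overlap : ∀ T ∈ 𝒯, ∀ T' ∈ 𝒯, T ≠ T' → volume (T ∩ T') = 0

/-- A conforming family of simplices: any two of them meet in a common (possibly empty) face.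
A convex subset of a simplex is a face of it exactly when it is extreme. -/
structure IsConformingSimplicial {d : ℕ} (𝒯 : Mesh d) : Prop where
  simplex : ∀ T ∈ 𝒯, IsSimplex T
  conforming : ∀ T ∈ 𝒯, ∀ T' ∈ 𝒯, IsExtreme ℝ T (T ∩ T')

/-- Local grading with constant `κ`: a cell `T'` which is at distance at most `h_T / κ` from a
cell `T` satisfies `h_T ≤ κ h_{T'}`. -/
def IsLocallyGraded {d : ℕ} (κ : ℝ) (𝒯 : Mesh d) : Prop :=
  ∀ T ∈ 𝒯, ∀ T' ∈ 𝒯, ∀ x ∈ T, ∀ y ∈ T', κ * dist x y ≤ cellSize T →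
    cellSize T ≤ κ * cellSize T'

/-- `C` is a splitting of the cell `T` into non-overlapping compact cells of volume `|T| / q`. -/
structure IsSplitting {d : ℕ} (q : ℕ) (T : Set (E d)) (C : Mesh d) : Prop where
  compact : ∀ K ∈ C, IsCompact K
  cover : (⋃ K ∈ C, K) = T
  overlap : ∀ K ∈ C, ∀ K' ∈ C, K ≠ K' → volume (K ∩ K') = 0
  ratio : ∀ K ∈ C, volume.real K = volume.real T / q

/-! ### Refinement strategies -/

/-- The data of a refinement strategy: the initial subdivision, the rule which splits a cell into
its children, and the routine `REFINE`, which maps a subdivision and a set of marked cells to the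
next subdivision. -/
structure RefinementStrategy (d : ℕ) where
  initial : Mesh d
  children : Set (E d) → Mesh d
  refine : Mesh d → Mesh d → Mesh d

namespace RefinementStrategy

variable {d : ℕ}

/-- The cells obtained from those of the initial subdivision by successive splittings. -/
inductive IsCell (R : RefinementStrategy d) : Set (E d) → Prop
  | initial (T : Set (E d)) : T ∈ R.initial → IsCell R T
  | child (T K : Set (E d)) : IsCell R T → K ∈ R.children T → IsCell R K

open Classical in
/-- `𝒯'` arises from `𝒯` by replacing one cell by its children. -/
def Splits (R : RefinementStrategy d) (𝒯 𝒯' : Mesh d) : Prop :=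
  ∃ T ∈ 𝒯, 𝒯' = 𝒯.erase T ∪ R.children T

/-- `𝒯'` is a refinement of `𝒯`: it arises by finitely many successive splittings of cells. -/
def IsRefinementOf (R : RefinementStrategy d) (𝒯' 𝒯 : Mesh d) : Prop :=
  Relation.ReflTransGen R.Splits 𝒯 𝒯'

/-- The subdivisions which are generated from the initial one by finitely many calls
of `REFINE`. -/
def IsGenerated (R : RefinementStrategy d) (𝒯 : Mesh d) : Prop :=
  Relation.ReflTransGen (fun 𝒮 𝒮' => ∃ M ⊆ 𝒮, 𝒮' = R.refine 𝒮 M) R.initial 𝒯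

open Classical in
/-- The uniform refinement of level `i` of the initial subdivision. -/
def uniform (R : RefinementStrategy d) : ℕ → Mesh d
  | 0 => R.initial
  | i + 1 => (uniform R i).biUnion R.children

/-- The admissible refinement strategies on `Ω`: `q` is the volume ratio between a cell and its
children, `c` the shape-regularity constant, `Λ` the constant in the complexity bound, and
`κ` the grading constant, which is used only for subdivisions with hanging nodes. -/
structure IsAdmissible (R : RefinementStrategy d) (Ω : Set (E d)) (q : ℕ) (c Λ κ : ℝ) :
    Prop where
  two_le : 2 ≤ q
  initial : IsSubdivision Ω R.initial
  splitting : ∀ T, R.IsCell T → IsSplitting q T (R.children T)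
  /-- `REFINE` returns a refinement in which all marked cells have been split. -/
  refines : ∀ 𝒯, R.IsGenerated 𝒯 → ∀ M ⊆ 𝒯,
    R.IsRefinementOf (R.refine 𝒯 M) 𝒯 ∧ Disjoint M (R.refine 𝒯 M)
  shapeRegular : ∀ 𝒯, R.IsGenerated 𝒯 → ∀ T ∈ 𝒯, IsShapeRegular c T
  /-- All generated subdivisions are simplicial and conforming, or hanging nodes are allowed and
  the generated subdivisions are locally graded. -/
  structured : (∀ 𝒯, R.IsGenerated 𝒯 → IsConformingSimplicial 𝒯) ∨
    (∀ 𝒯, R.IsGenerated 𝒯 → IsLocallyGraded κ 𝒯)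
  one_le : 1 ≤ Λ
  complexity : ∀ (𝒯 ℛ : ℕ → Mesh d), 𝒯 0 = R.initial →
    (∀ j, ℛ j ⊆ 𝒯 j ∧ 𝒯 (j + 1) = R.refine (𝒯 j) (ℛ j)) →
    ∀ k, ((𝒯 k).card : ℝ) - ((𝒯 0).card : ℝ) ≤ Λ * ∑ j ∈ Finset.range k, ((ℛ j).card : ℝ)

end RefinementStrategy

open Classical in
/-- The set `𝒢(γ, 𝒯)` of the cells of `𝒯` which intersect `γ`. -/
def touching {d : ℕ} (γ : Set (E d)) (𝒯 : Mesh d) : Mesh d :=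
  𝒯.filter fun T => (T ∩ γ).Nonempty

/-- The total volume of the cells in `𝒢(γ, 𝒯)`. -/
def touchingVolume {d : ℕ} (γ : Set (E d)) (𝒯 : Mesh d) : ℝ :=
  ∑ T ∈ touching γ 𝒯, volume.real T

/-- The initial subdivision resolves `γ`: `𝒢(γ, 𝒯_0)` is quasi-uniform, and
`∑_{T ∈ 𝒢(γ, 𝒯_i)} |T| ∼ q^{-i/d} ∑_{T ∈ 𝒢(γ, 𝒯_0)} |T| ∼ q^{-i/d} |γ|` for the uniform
refinements `𝒯_i` of `𝒯_0`. -/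
def ResolvesInterface {d : ℕ} (R : RefinementStrategy d) (γ : Set (E d)) (q : ℕ) : Prop :=
  ∃ c : ℝ, 0 < c ∧
    (∀ T ∈ touching γ R.initial, ∀ T' ∈ touching γ R.initial, cellSize T ≤ c * cellSize T') ∧
    (∀ i : ℕ,
      touchingVolume γ (R.uniform i)
        ≤ c * ((q : ℝ) ^ (-(i : ℝ) / d) * touchingVolume γ R.initial) ∧
      (q : ℝ) ^ (-(i : ℝ) / d) * touchingVolume γ R.initial
        ≤ c * touchingVolume γ (R.uniform i)) ∧
    touchingVolume γ R.initial ≤ c * (surfaceMeasure γ).real univ ∧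
    (surfaceMeasure γ).real univ ≤ c * touchingVolume γ R.initial

/-! ### Data indicators and algorithms -/

/-- The local data indicator `d(g, T) = h_T ‖g‖_{L²(T)}`. -/
def localIndicator {d : ℕ} (g : E d → ℝ) (T : Set (E d)) : ℝ :=
  cellSize T * (eLpNorm g 2 (volume.restrict T)).toReal

/-- The data indicator `𝒟(g, 𝒯) = (∑_{T ∈ 𝒯} d(g, T)²)^{1/2}`, also for subsets of a
subdivision. -/
def dataIndicator {d : ℕ} (g : E d → ℝ) (𝒯 : Mesh d) : ℝ :=
  √(∑ T ∈ 𝒯, localIndicator g T ^ 2)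

/-- No run of the loop with one-pass relation `step` that starts from `𝒯` is infinite. -/
def Terminates {d : ℕ} (step : Mesh d → Mesh d → Prop) (𝒯 : Mesh d) : Prop :=
  ¬ ∃ u : ℕ → Mesh d, u 0 = 𝒯 ∧ ∀ n, step (u n) (u (n + 1))

namespace RefinementStrategy

variable {d : ℕ}

open Classical in
/-- The cells which `INTERFACE` marks: those which intersect `γ` and have size above `r / 2`. -/
def interfaceMarked (γ : Set (E d)) (r : ℝ) (𝒯 : Mesh d) : Mesh d :=
  (touching γ 𝒯).filter fun T => r / 2 < cellSize T

/-- One pass of the loop of `INTERFACE`. -/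
def InterfaceStep (R : RefinementStrategy d) (γ : Set (E d)) (r : ℝ) (𝒯 𝒯' : Mesh d) : Prop :=
  (∃ T ∈ touching γ 𝒯, r / 2 < cellSize T) ∧ 𝒯' = R.refine 𝒯 (interfaceMarked γ r 𝒯)

/-- `𝒯' = INTERFACE(𝒯, r)`. -/
def IsInterface (R : RefinementStrategy d) (γ : Set (E d)) (𝒯 : Mesh d) (r : ℝ) (𝒯' : Mesh d) :
    Prop :=
  Relation.ReflTransGen (R.InterfaceStep γ r) 𝒯 𝒯' ∧ ∀ T ∈ touching γ 𝒯', cellSize T ≤ r / 2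

/-- One pass of the loop of `GREEDY`: a cell with maximal indicator is refined. -/
def GreedyStep (R : RefinementStrategy d) (g : E d → ℝ) (τ : ℝ) (𝒯 𝒯' : Mesh d) : Prop :=
  τ < dataIndicator g 𝒯 ∧
    ∃ T ∈ 𝒯, (∀ K ∈ 𝒯, localIndicator g K ≤ localIndicator g T) ∧ 𝒯' = R.refine 𝒯 {T}

/-- `𝒯'` is an output of `GREEDY(𝒯, g, τ)`, for some choice among the maximal cells. -/
def IsGreedy (R : RefinementStrategy d) (𝒯 : Mesh d) (g : E d → ℝ) (τ : ℝ) (𝒯' : Mesh d) :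
    Prop :=
  Relation.ReflTransGen (R.GreedyStep g τ) 𝒯 𝒯' ∧ dataIndicator g 𝒯' ≤ τ

/-- `M` is a smallest subset of `𝒯` with `(∑_{T ∈ M} d(g, T)²)^{1/2} ≥ θ 𝒟(g, 𝒯)`. -/
def IsMarked (g : E d → ℝ) (θ : ℝ) (𝒯 M : Mesh d) : Prop :=
  M ⊆ 𝒯 ∧ θ * dataIndicator g 𝒯 ≤ dataIndicator g M ∧
    ∀ M' ⊆ 𝒯, θ * dataIndicator g 𝒯 ≤ dataIndicator g M' → M.card ≤ M'.card

/-- One pass of the loop of `DATA`. -/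
def DataStep (R : RefinementStrategy d) (g : E d → ℝ) (τ θ : ℝ) (𝒯 𝒯' : Mesh d) : Prop :=
  τ < dataIndicator g 𝒯 ∧ ∃ M, IsMarked g θ 𝒯 M ∧ 𝒯' = R.refine 𝒯 M

/-- `𝒯'` is an output of `DATA(𝒯, g, τ, θ)`, for some choice of smallest marked sets. -/
def IsData (R : RefinementStrategy d) (𝒯 : Mesh d) (g : E d → ℝ) (τ θ : ℝ) (𝒯' : Mesh d) :
    Prop :=
  Relation.ReflTransGen (R.DataStep g τ θ) 𝒯 𝒯' ∧ dataIndicator g 𝒯' ≤ τ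

/-- The data-approximation assumption for `g`, started from `𝒯`, with bulk parameter `θ`,
exponent `s` and constant `G`: for each `τ > 0` the routine `DATA(𝒯, g, τ, θ)` terminates, and its
outputs `𝒯'` satisfy `#𝒯' - #𝒯 ≤ G τ^{-1/s}`. -/
def DataAssumption (R : RefinementStrategy d) (𝒯 : Mesh d) (g : E d → ℝ) (θ s G : ℝ) : Prop :=
  ∀ τ : ℝ, 0 < τ →
    Terminates (R.DataStep g τ θ) 𝒯 ∧ (∃ 𝒯', R.IsData 𝒯 g τ θ 𝒯') ∧
      ∀ 𝒯', R.IsData 𝒯 g τ θ 𝒯' → (𝒯'.card : ℝ) - (𝒯.card : ℝ) ≤ G * τ ^ (-(1 / s))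

end RefinementStrategy

end

noncomputable section

/-! ### Nonoverlapping families of cells -/

/-! The data `F^r` are bounded by `A = A₀ ‖f‖ / r`, because the mass `C (r₀ r)^(d-1)` of the surface
measure on a ball meets the factor `r^(-d)`, and they vanish outside a strip of width `r₀ r` around
the interface (`IsMollifier.regData_bounds`). After `INTERFACE`, cells touching the interface have
size at most `r / 2`; by grading, all cells that meet the strip have diameter of order `r`
(`IsAdmissible.exists_diam_le`). Hence cells with nonzero indicator stay in a strip `S` of volume `W
∼ r`, and their squared indicator is at most `A² h_T^(d+2)`.

Choose `H` with `A² H² W = (s τ)²`. Any family of cells whose squared indicators are at most `β = A²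
H^(d+2)` has total squared indicator at most `(s τ)²`. So while the tolerance is exceeded, `GREEDY`
(with `s = 1`) marks a cell with squared indicator at least `β`, and at least half of the cells
marked by `DATA` (with `s² = 1 - θ²`) carry at least a fixed fraction of `β`. Such cells lie in `S`
and have size at least a constant times `H`.

Large marked cells are counted by a potential, the sum over the cells of `∫_T (a - 1/|T|)₊` for a
density `a`. Splitting never increases it, and splitting a cell on which `a ≥ q/|T|` lowers it by at
least `1`, so the number of such cells is at most `∫ a` (`Run.le_integral`). With `a` of order
`H^(-d)` on `S` the count is of order `W H^(-d) ∼ r^(1-d/2) ‖f‖^d τ^(-d)`.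

The complexity assumption counts from the initial subdivision, so the cells marked by `INTERFACE`
enter as well. The same potential, with a dyadic sum of densities, bounds their number by a multiple
of `r^(1-d)`. If the loop makes any pass at all, then `τ ≲ ‖f‖ √r`, and this number is absorbed by
the rate.

For conforming simplices the grading has to be proved. Cells at an interior point are comparable,
since a small sphere around it is connected and neighbours across it share an edge
(`IsConformingSimplicial.diam_le_of_mem`). Hat functions, whose slope is controlled by cell sizes,
carry this over to points at a distance. -/

theorem setIntegral_biUnion_of_overlap {X : Type*} [MeasurableSpace X] {μ : Measure X}
    (C : Finset (Set X)) (hm : ∀ K ∈ C, MeasurableSet K)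
    (hd : ∀ K ∈ C, ∀ K' ∈ C, K ≠ K' → μ (K ∩ K') = 0) {f : X → ℝ}
    (hf : IntegrableOn f (⋃ K ∈ C, K) μ) :
    ∫ x in ⋃ K ∈ C, K, f x ∂μ = ∑ K ∈ C, ∫ x in K, f x ∂μ := by
  have hU : (⋃ K ∈ C, K) = ⋃ K : C, (K : Set X) := by
    rw [iUnion_subtype (fun K => K ∈ C) (fun K => (K : Set X))]
  rw [hU] at hf ⊢
  rw [integral_iUnion_ae (s := fun K : C => (K : Set X))
      (fun K => (hm K K.2).nullMeasurableSet) _ hf, tsum_fintype,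
    Finset.sum_coe_sort C fun K => ∫ x in K, f x ∂μ]
  intro K K' h
  exact hd K K.2 K' K'.2 fun e => h (Subtype.ext e)

/-! ### Invariants of successive splittings -/

namespace RefinementStrategy

variable {d : ℕ}

/-- The properties shared by all refinements of an admissible initial subdivision. -/
structure IsSound (R : RefinementStrategy d) (Ω : Set (E d)) (𝒯 : Mesh d) : Prop where
  isCell : ∀ T ∈ 𝒯, R.IsCell T
  isCompact : ∀ T ∈ 𝒯, IsCompact T
  volume_pos : ∀ T ∈ 𝒯, 0 < volume.real T
  cover : (⋃ T ∈ 𝒯, T) = closure Ω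
  overlap : ∀ T ∈ 𝒯, ∀ T' ∈ 𝒯, T ≠ T' → volume (T ∩ T') = 0

variable {R : RefinementStrategy d} {Ω : Set (E d)} {q : ℕ} {c Λ κ : ℝ} {𝒯 𝒯' : Mesh d}

theorem IsSound.subset (h : R.IsSound Ω 𝒯) {T : Set (E d)} (hT : T ∈ 𝒯) : T ⊆ closure Ω := by
  rw [← h.cover]
  exact subset_biUnion_of_mem (u := fun T : Set (E d) => T) hT

theorem IsAdmissible.isSound_initial (hR : R.IsAdmissible Ω q c Λ κ) :
    R.IsSound Ω R.initial where
  isCell T hT := IsCell.initial T hT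
  isCompact := hR.initial.compact
  volume_pos T hT := by
    refine ENNReal.toReal_pos ?_ (hR.initial.compact T hT).measure_lt_top.ne
    have h := isOpen_interior.measure_pos volume (hR.initial.interior T hT)
    exact (h.trans_le (measure_mono interior_subset)).ne'
  cover := hR.initial.cover
  overlap := hR.initial.overlap

theorem IsAdmissible.q_pos (hR : R.IsAdmissible Ω q c Λ κ) : (0 : ℝ) < q := by
  have := hR.two_le
  positivity

theorem IsAdmissible.child_subset (hR : R.IsAdmissible Ω q c Λ κ) {T K : Set (E d)}
    (hT : R.IsCell T) (hK : K ∈ R.children T) : K ⊆ T := by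
  have h := (hR.splitting T hT).cover
  rw [← h]
  exact subset_biUnion_of_mem (u := fun T : Set (E d) => T) hK

/-- Children are not assumed to have interior points; the volume ratio `1 / q` is what keeps them
nondegenerate. A child inherits null overlaps from its parent. -/
theorem IsSound.splits (hR : R.IsAdmissible Ω q c Λ κ) (h : R.IsSound Ω 𝒯)
    (hs : R.Splits 𝒯 𝒯') : R.IsSound Ω 𝒯' := by
  classical
  obtain ⟨T, hT, rfl⟩ := hs
  have hcell := h.isCell T hT
  have hsp := hR.splitting T hcell
  have hmem : ∀ K, K ∈ 𝒯.erase T ∪ R.children T ↔ (K ≠ T ∧ K ∈ 𝒯) ∨ K ∈ R.children T := by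
    intro K; rw [Finset.mem_union, Finset.mem_erase]
  have hov : ∀ K ∈ R.children T, ∀ K' ∈ 𝒯, K' ≠ T → volume (K ∩ K') = 0 := by
    intro K hK K' hK' hne
    exact measure_mono_null (inter_subset_inter_left _ (hR.child_subset hcell hK))
      (h.overlap T hT K' hK' hne.symm)
  refine ⟨?_, ?_, ?_, ?_, ?_⟩
  · intro K hK
    rcases (hmem K).1 hK with ⟨_, h1⟩ | h1
    exacts [h.isCell K h1, IsCell.child T K hcell h1]
  · intro K hK
    rcases (hmem K).1 hK with ⟨_, h1⟩ | h1
    exacts [h.isCompact K h1, hsp.compact K h1]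
  · intro K hK
    rcases (hmem K).1 hK with ⟨_, h1⟩ | h1
    · exact h.volume_pos K h1
    · rw [hsp.ratio K h1]
      exact div_pos (h.volume_pos T hT) hR.q_pos
  · rw [← h.cover]
    ext x
    simp only [mem_iUnion, exists_prop]
    have hx : x ∈ T ↔ ∃ K ∈ R.children T, x ∈ K := by
      conv_lhs => rw [← hsp.cover]
      simp
    constructor
    · rintro ⟨K, hK, hxK⟩
      rcases (hmem K).1 hK with ⟨_, h1⟩ | h1
      exacts [⟨K, h1, hxK⟩, ⟨T, hT, hx.2 ⟨K, h1, hxK⟩⟩]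
    · rintro ⟨K, hK, hxK⟩
      by_cases e : K = T
      · subst e
        obtain ⟨K', h1, h2⟩ := hx.1 hxK
        exact ⟨K', (hmem K').2 (Or.inr h1), h2⟩
      · exact ⟨K, (hmem K).2 (Or.inl ⟨e, hK⟩), hxK⟩
  · intro K hK K' hK' hne
    rcases (hmem K).1 hK with ⟨h0, h1⟩ | h1 <;> rcases (hmem K').1 hK' with ⟨h0', h1'⟩ | h1'
    · exact h.overlap K h1 K' h1' hne
    · rw [inter_comm]; exact hov K' h1' K h1 h0
    · exact hov K h1 K' h1' h0'
    · exact hsp.overlap K h1 K' h1' hne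

theorem IsSound.isRefinementOf (hR : R.IsAdmissible Ω q c Λ κ) (h : R.IsSound Ω 𝒯)
    (hs : R.IsRefinementOf 𝒯' 𝒯) : R.IsSound Ω 𝒯' := by
  induction hs with
  | refl => exact h
  | tail _ h2 ih => exact ih.splits hR h2

theorem IsGenerated.isSound (hR : R.IsAdmissible Ω q c Λ κ) (h : R.IsGenerated 𝒯) :
    R.IsSound Ω 𝒯 := by
  induction h with
  | refl => exact hR.isSound_initial
  | tail h1 h2 ih =>
    obtain ⟨M, hM, rfl⟩ := h2
    exact ih.isRefinementOf hR (hR.refines _ h1 M hM).1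

theorem IsGenerated.refine (h : R.IsGenerated 𝒯) {M : Mesh d} (hM : M ⊆ 𝒯) :
    R.IsGenerated (R.refine 𝒯 M) :=
  Relation.ReflTransGen.tail h ⟨M, hM, rfl⟩

theorem IsSound.exists_subset (hR : R.IsAdmissible Ω q c Λ κ) (h : R.IsSound Ω 𝒯)
    (hs : R.IsRefinementOf 𝒯' 𝒯) {T : Set (E d)} (hT : T ∈ 𝒯') : ∃ P ∈ 𝒯, T ⊆ P := by
  classical
  induction hs generalizing T with
  | refl => exact ⟨T, hT, Subset.rfl⟩
  | tail h1 h2 ih =>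
    obtain ⟨S, hS, rfl⟩ := h2
    rcases Finset.mem_union.1 hT with h3 | h3
    · exact ih (Finset.mem_of_mem_erase h3)
    · obtain ⟨P, hP, hSP⟩ := ih hS
      exact ⟨P, hP, (hR.child_subset ((h.isRefinementOf hR h1).isCell S hS) h3).trans hSP⟩

/-- The loss of the parent is made up by a child that was not there before: otherwise it would
overlap the parent in a set of positive volume. -/
theorem IsSound.card_le_of_splits (hR : R.IsAdmissible Ω q c Λ κ) (h : R.IsSound Ω 𝒯)
    (hs : R.Splits 𝒯 𝒯') : 𝒯.card ≤ 𝒯'.card := by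
  classical
  have h' := h.splits hR hs
  obtain ⟨T, hT, rfl⟩ := hs
  have hcell := h.isCell T hT
  have hsp := hR.splitting T hcell
  obtain ⟨K, hK⟩ : (R.children T).Nonempty := by
    by_contra hne
    rw [Finset.not_nonempty_iff_eq_empty] at hne
    have h1 := hsp.cover
    rw [hne] at h1
    have h2 := h.volume_pos T hT
    rw [← h1] at h2
    simp at h2
  have hK' : K ∉ 𝒯.erase T := by
    intro hKT
    rw [Finset.mem_erase] at hKT
    have h1 := h.overlap T hT K hKT.2 hKT.1.symm
    rw [inter_eq_right.2 (hR.child_subset hcell hK)] at h1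
    have h2 := h'.volume_pos K (Finset.mem_union_right _ hK)
    rw [measureReal_def, h1] at h2
    simp at h2
  calc 𝒯.card = (insert K (𝒯.erase T)).card := by
        rw [Finset.card_insert_of_notMem hK', Finset.card_erase_of_mem hT]
        have := Finset.card_pos.2 ⟨T, hT⟩
        omega
    _ ≤ _ := Finset.card_le_card (by
        intro S hS
        rcases Finset.mem_insert.1 hS with rfl | h1
        exacts [Finset.mem_union_right _ hK, Finset.mem_union_left _ h1])

theorem IsSound.card_le (hR : R.IsAdmissible Ω q c Λ κ) (h : R.IsSound Ω 𝒯)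
    (hs : R.IsRefinementOf 𝒯' 𝒯) : 𝒯.card ≤ 𝒯'.card := by
  induction hs with
  | refl => exact le_rfl
  | tail h1 h2 ih => exact ih.trans ((h.isRefinementOf hR h1).card_le_of_splits hR h2)

/-! ### Counting marked cells by a potential -/

/-- The potential of a cell with respect to the density `a`. -/
def potential (a : E d → ℝ) (T : Set (E d)) : ℝ :=
  ∫ x in T, max 0 (a x - 1 / volume.real T)

theorem potential_nonneg (a : E d → ℝ) (T : Set (E d)) : 0 ≤ potential a T :=
  integral_nonneg fun _ => le_max_left _ _

theorem integrableOn_max_sub {a : E d → ℝ} {T : Set (E d)} (hT : IsCompact T)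
    (ha : IntegrableOn a T) (b : ℝ) : IntegrableOn (fun x => max 0 (a x - b)) T := by
  have h1 : IntegrableOn (fun x => a x - b) T :=
    ha.sub (integrableOn_const hT.measure_lt_top.ne)
  have h0 : IntegrableOn (fun _ : E d => (0 : ℝ)) T := integrableOn_zero
  exact h0.sup h1

/-- All children have volume `|T| / q`, so they share the threshold `q / |T|` and their integrals
add up to one integral over the parent. -/
theorem sum_potential_children (hR : R.IsAdmissible Ω q c Λ κ) {T : Set (E d)}
    (hT : R.IsCell T) (hTc : IsCompact T) {a : E d → ℝ} (ha : IntegrableOn a T) :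
    ∑ K ∈ R.children T, potential a K = ∫ x in T, max 0 (a x - q / volume.real T) := by
  have hsp := hR.splitting T hT
  have h1 : ∀ K ∈ R.children T,
      potential a K = ∫ x in K, max 0 (a x - q / volume.real T) := by
    intro K hK
    rw [potential, hsp.ratio K hK, one_div_div]
  rw [Finset.sum_congr rfl h1,
    ← setIntegral_biUnion_of_overlap (R.children T) (fun K hK => (hsp.compact K hK).measurableSet)
      hsp.overlap (by rw [hsp.cover]; exact integrableOn_max_sub hTc ha _), hsp.cover]

theorem sum_potential_children_le (hR : R.IsAdmissible Ω q c Λ κ) {T : Set (E d)}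
    (hT : R.IsCell T) (hTc : IsCompact T) {a : E d → ℝ} (ha : IntegrableOn a T) :
    ∑ K ∈ R.children T, potential a K ≤ potential a T := by
  rw [sum_potential_children hR hT hTc ha]
  refine setIntegral_mono (integrableOn_max_sub hTc ha _) (integrableOn_max_sub hTc ha _) ?_
  intro x
  have h2 : (1 : ℝ) ≤ q := by exact_mod_cast (by have := hR.two_le; omega : 1 ≤ q)
  have : 1 / volume.real T ≤ q / volume.real T := by gcongr
  exact max_le_max le_rfl (by linarith)

/-- Both positive parts are active on the whole cell, so the drop is exactly `q - 1`, and `q ≥ 2`.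
-/
theorem sum_potential_children_add_one_le (hR : R.IsAdmissible Ω q c Λ κ) {T : Set (E d)}
    (hT : R.IsCell T) (hTc : IsCompact T) (hv : 0 < volume.real T) {a : E d → ℝ}
    (ha : IntegrableOn a T) (hbig : ∀ x ∈ T, q / volume.real T ≤ a x) :
    ∑ K ∈ R.children T, potential a K + 1 ≤ potential a T := by
  rw [sum_potential_children hR hT hTc ha]
  have h2 : (2 : ℝ) ≤ q := by exact_mod_cast hR.two_le
  have h3 : (1 : ℝ) / volume.real T ≤ q / volume.real T := by gcongr; linarith
  have hTm := hTc.measurableSet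
  have e1 : ∫ x in T, max 0 (a x - q / volume.real T) = ∫ x in T, (a x - q / volume.real T) :=
    setIntegral_congr_fun hTm fun x hx => max_eq_right (by linarith [hbig x hx])
  have e2 : potential a T = ∫ x in T, (a x - 1 / volume.real T) :=
    setIntegral_congr_fun hTm fun x hx => max_eq_right (by linarith [hbig x hx])
  have hc : ∀ b : ℝ, IntegrableOn (fun _ : E d => b) T :=
    fun b => integrableOn_const hTc.measure_lt_top.ne
  rw [e1, e2, integral_sub ha (hc _), integral_sub ha (hc _), setIntegral_const,
    setIntegral_const, smul_eq_mul, smul_eq_mul, mul_div_cancel₀ _ hv.ne',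
    mul_div_cancel₀ _ hv.ne']
  linarith

theorem IsSound.sum_potential_le (h : R.IsSound Ω 𝒯) {a : E d → ℝ}
    (ha : IntegrableOn a (closure Ω)) (h0 : ∀ x, 0 ≤ a x) :
    ∑ T ∈ 𝒯, potential a T ≤ ∫ x in closure Ω, a x := by
  rw [← h.cover, setIntegral_biUnion_of_overlap 𝒯 (fun K hK => (h.isCompact K hK).measurableSet)
    h.overlap (by rwa [h.cover])]
  refine Finset.sum_le_sum fun T hT => ?_
  have haT := ha.mono_set (h.subset hT)
  refine setIntegral_mono (integrableOn_max_sub (h.isCompact T hT) haT _) haT ?_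
  intro x
  have : 0 ≤ 1 / volume.real T := by positivity
  exact max_le (h0 x) (by linarith)

-- Each splitting changes the sum by the defect of the split cell, which is never negative. A cell
-- of the old subdivision that is gone has been split on the way, so its defect has been gained.
open Classical in
theorem IsSound.sum_potential_add_le (hR : R.IsAdmissible Ω q c Λ κ) (h : R.IsSound Ω 𝒯)
    (hs : R.IsRefinementOf 𝒯' 𝒯) {a : E d → ℝ} (ha : IntegrableOn a (closure Ω)) :
    ∑ T ∈ 𝒯', potential a T +
      ∑ T ∈ 𝒯 \ 𝒯', (potential a T - ∑ K ∈ R.children T, potential a K) ≤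
        ∑ T ∈ 𝒯, potential a T := by
  induction hs with
  | refl => simp
  | @tail 𝒮 𝒮' h1 h2 ih =>
    have hS := h.isRefinementOf hR h1
    obtain ⟨S, hSm, rfl⟩ := h2
    have hcell := hS.isCell S hSm
    have hnn : ∀ T, R.IsCell T → IsCompact T → T ⊆ closure Ω →
        0 ≤ potential a T - ∑ K ∈ R.children T, potential a K := fun T hT hTc hTs =>
      sub_nonneg.2 (sum_potential_children_le hR hT hTc (ha.mono_set hTs))
    have e1 : ∑ T ∈ 𝒮.erase S ∪ R.children S, potential a T ≤
        ∑ T ∈ 𝒮.erase S, potential a T + ∑ T ∈ R.children S, potential a T := by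
      rw [← Finset.sum_union_inter]
      exact le_add_of_nonneg_right (Finset.sum_nonneg fun T _ => potential_nonneg a T)
    have e2 := Finset.add_sum_erase 𝒮 (potential a) hSm
    have e3 : ∑ T ∈ 𝒯 \ (𝒮.erase S ∪ R.children S),
        (potential a T - ∑ K ∈ R.children T, potential a K) ≤
        ∑ T ∈ 𝒯 \ 𝒮, (potential a T - ∑ K ∈ R.children T, potential a K) +
          (potential a S - ∑ K ∈ R.children S, potential a K) := by
      have hsub : 𝒯 \ (𝒮.erase S ∪ R.children S) ⊆ insert S (𝒯 \ 𝒮) := by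
        intro T hT
        simp only [Finset.mem_sdiff, Finset.mem_union, Finset.mem_erase, not_or, not_and,
          Finset.mem_insert] at hT ⊢
        by_cases e : T = S
        exacts [Or.inl e, Or.inr ⟨hT.1, hT.2.1 e⟩]
      have hSn : S ∉ 𝒯 \ 𝒮 := fun hh => (Finset.mem_sdiff.1 hh).2 hSm
      refine (Finset.sum_le_sum_of_subset_of_nonneg hsub fun T hT _ => ?_).trans ?_
      · rcases Finset.mem_insert.1 hT with rfl | hT
        · exact hnn _ hcell (hS.isCompact _ hSm) (hS.subset hSm)
        · have := (Finset.mem_sdiff.1 hT).1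
          exact hnn _ (h.isCell _ this) (h.isCompact _ this) (h.subset this)
      · rw [Finset.sum_insert hSn, add_comm]
    linarith

/-- `Run R Q 𝒯₀ 𝒯 m`: some passes of a loop, which starts from `𝒯₀` and refines in each pass a
marked set `M` with `Q 𝒮 M`, lead to `𝒯`, and `m` cells have been marked. -/
inductive Run (R : RefinementStrategy d) (Q : Mesh d → Mesh d → Prop) (𝒯₀ : Mesh d) :
    Mesh d → ℕ → Prop
  | refl : Run R Q 𝒯₀ 𝒯₀ 0
  | tail (𝒯 M : Mesh d) (m : ℕ) : Run R Q 𝒯₀ 𝒯 m → M ⊆ 𝒯 → Q 𝒯 M →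
      Run R Q 𝒯₀ (R.refine 𝒯 M) (m + M.card)

variable {Q : Mesh d → Mesh d → Prop} {𝒯₀ : Mesh d} {m : ℕ}

theorem Run.isGenerated (h : R.Run Q 𝒯₀ 𝒯 m) (h₀ : R.IsGenerated 𝒯₀) : R.IsGenerated 𝒯 := by
  induction h with
  | refl => exact h₀
  | tail 𝒮 M m _ hM _ ih => exact ih.refine hM

theorem Run.isRefinementOf (hR : R.IsAdmissible Ω q c Λ κ) (h : R.Run Q 𝒯₀ 𝒯 m)
    (h₀ : R.IsGenerated 𝒯₀) : R.IsRefinementOf 𝒯 𝒯₀ := by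
  induction h with
  | refl => exact Relation.ReflTransGen.refl
  | tail 𝒮 M m h1 hM _ ih => exact ih.trans (hR.refines _ (h1.isGenerated h₀) M hM).1

theorem Run.mono {Q' : Mesh d → Mesh d → Prop} (hQ : ∀ 𝒮 M, Q 𝒮 M → Q' 𝒮 M)
    (h : R.Run Q 𝒯₀ 𝒯 m) : R.Run Q' 𝒯₀ 𝒯 m := by
  induction h with
  | refl => exact Run.refl
  | tail 𝒮 M m _ hM hq ih => exact Run.tail 𝒮 M m ih hM (hQ _ _ hq)

theorem Run.trans {𝒯₁ : Mesh d} {n : ℕ} (h : R.Run Q 𝒯₀ 𝒯₁ n) (h' : R.Run Q 𝒯₁ 𝒯 m) :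
    R.Run Q 𝒯₀ 𝒯 (n + m) := by
  induction h' with
  | refl => exact h
  | tail 𝒮 M m _ hM hq ih => rw [← add_assoc]; exact Run.tail 𝒮 M _ ih hM hq

open Classical in
/-- If in each pass at least half of the marked cells `T` are large, in the sense that `a ≥ q / |T|`
on `T`, then the number of marked cells is bounded by the integral of `2 a`. -/
theorem Run.le_integral (hR : R.IsAdmissible Ω q c Λ κ) (h₀ : R.IsGenerated 𝒯₀)
    {a : E d → ℝ} (ha : IntegrableOn a (closure Ω)) (hnn : ∀ x, 0 ≤ a x)
    (hQ : ∀ 𝒮 M, R.IsGenerated 𝒮 → R.IsRefinementOf 𝒮 𝒯₀ → M ⊆ 𝒮 → Q 𝒮 M →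
      M.card ≤ 2 * (M.filter fun T => ∀ x ∈ T, q / volume.real T ≤ a x).card)
    (h : R.Run Q 𝒯₀ 𝒯 m) : (m : ℝ) ≤ 2 * ∫ x in closure Ω, a x := by
  -- The count plus twice the potential does not increase: a pass gains `M.card ≤ 2 * B.card`, and
  -- every cell of `B`, being split, lowers the potential by at least one.
  have key : (m : ℝ) + 2 * ∑ T ∈ 𝒯, potential a T ≤ 2 * ∑ T ∈ 𝒯₀, potential a T := by
    induction h with
    | refl => simp
    | tail 𝒮 M m h1 hM hq ih =>
      have hg := h1.isGenerated h₀
      have hs := hg.isSound hR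
      have hr := hR.refines 𝒮 hg M hM
      have e1 := hs.sum_potential_add_le hR hr.1 ha
      have e2 := hQ 𝒮 M hg (h1.isRefinementOf hR h₀) hM hq
      set B := M.filter fun T => ∀ x ∈ T, q / volume.real T ≤ a x with hB
      have hBs : B ⊆ 𝒮 \ R.refine 𝒮 M := by
        intro T hT
        have hTM := (Finset.mem_filter.1 hT).1
        exact Finset.mem_sdiff.2 ⟨hM hTM, Finset.disjoint_left.1 hr.2 hTM⟩
      have e3 : (B.card : ℝ) ≤ ∑ T ∈ 𝒮 \ R.refine 𝒮 M,
          (potential a T - ∑ K ∈ R.children T, potential a K) := by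
        calc (B.card : ℝ) = ∑ T ∈ B, (1 : ℝ) := by simp
          _ ≤ ∑ T ∈ B, (potential a T - ∑ K ∈ R.children T, potential a K) := by
            refine Finset.sum_le_sum fun T hT => ?_
            have hTS := (Finset.mem_sdiff.1 (hBs hT)).1
            have := sum_potential_children_add_one_le hR (hs.isCell T hTS) (hs.isCompact T hTS)
              (hs.volume_pos T hTS) (ha.mono_set (hs.subset hTS)) (Finset.mem_filter.1 hT).2
            linarith
          _ ≤ _ := by
            refine Finset.sum_le_sum_of_subset_of_nonneg hBs fun T hT _ => ?_
            have hTS := (Finset.mem_sdiff.1 hT).1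
            exact sub_nonneg.2 (sum_potential_children_le hR (hs.isCell T hTS)
              (hs.isCompact T hTS) (ha.mono_set (hs.subset hTS)))
      have e4 : (M.card : ℝ) ≤ 2 * B.card := by exact_mod_cast e2
      push_cast
      linarith
  have e1 := (h₀.isSound hR).sum_potential_le ha hnn
  have e2 : 0 ≤ ∑ T ∈ 𝒯, potential a T := Finset.sum_nonneg fun T _ => potential_nonneg a T
  linarith

/-- The subdivisions which arise from the initial one by refining prescribed marked sets. -/
def sequence (R : RefinementStrategy d) (ℛ : ℕ → Mesh d) : ℕ → Mesh d
  | 0 => R.initial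
  | j + 1 => R.refine (sequence R ℛ j) (ℛ j)

theorem sequence_congr {ℛ ℛ' : ℕ → Mesh d} {n : ℕ} (h : ∀ j < n, ℛ j = ℛ' j) :
    R.sequence ℛ n = R.sequence ℛ' n := by
  induction n with
  | zero => rfl
  | succ n ih =>
    rw [sequence, sequence, ih fun j hj => h j (by omega), h n (by omega)]

/-- The complexity assumption speaks of infinite sequences of markings; a finite run is prolonged by
empty marked sets. -/
theorem Run.exists_sequence (h : R.Run Q R.initial 𝒯 m) : ∃ (ℛ : ℕ → Mesh d) (n : ℕ),
    (∀ j, ℛ j ⊆ R.sequence ℛ j) ∧ (∀ j ≥ n, ℛ j = ∅) ∧ R.sequence ℛ n = 𝒯 ∧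
      ∑ j ∈ Finset.range n, (ℛ j).card = m := by
  induction h with
  | refl => exact ⟨fun _ => ∅, 0, fun _ => Finset.empty_subset _, fun _ _ => rfl, rfl, rfl⟩
  | tail 𝒮 M m h1 hM _ ih =>
    obtain ⟨ℛ, n, h2, h3, h4, h5⟩ := ih
    have hlt : ∀ j < n, ℛ j = Function.update ℛ n M j := fun j hj => by
      rw [Function.update_of_ne hj.ne]
    have hgt : ∀ j ≥ n + 1, Function.update ℛ n M j = ∅ := fun j hj => by
      rw [Function.update_of_ne (by omega)]; exact h3 j (by omega)
    have hn : R.sequence (Function.update ℛ n M) n = 𝒮 := by rw [← h4, ← sequence_congr hlt]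
    refine ⟨Function.update ℛ n M, n + 1, ?_, hgt, ?_, ?_⟩
    · intro j
      rcases lt_trichotomy j n with hj | rfl | hj
      · rw [← hlt j hj, ← sequence_congr fun i hi => hlt i (hi.trans hj)]; exact h2 j
      · rw [hn, Function.update_self]; exact hM
      · rw [hgt j hj]; exact Finset.empty_subset _
    · rw [sequence, hn, Function.update_self]
    · rw [Finset.sum_range_succ, Function.update_self,
        ← h5, Finset.sum_congr rfl fun j hj => by rw [← hlt j (Finset.mem_range.1 hj)]]

theorem Run.card_sub_le (hR : R.IsAdmissible Ω q c Λ κ) (h : R.Run Q R.initial 𝒯 m) :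
    (𝒯.card : ℝ) - R.initial.card ≤ Λ * m := by
  obtain ⟨ℛ, n, h2, _, rfl, rfl⟩ := h.exists_sequence
  have := hR.complexity (R.sequence ℛ) ℛ rfl (fun j => ⟨h2 j, rfl⟩) n
  push_cast
  exact this

end RefinementStrategy
end

noncomputable section

/-! ### Faces of simplices -/

variable {d : ℕ}

theorem IsSimplex.exists_basis {T : Set (E d)} (hT : IsSimplex T) :
    ∃ b : AffineBasis (Fin (d + 1)) ℝ (E d), T = convexHull ℝ (range b) := by
  obtain ⟨v, hv, rfl⟩ := hT
  have : affineSpan ℝ (range v) = ⊤ := by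
    rw [hv.affineSpan_eq_top_iff_card_eq_finrank_add_one]
    simp
  exact ⟨⟨v, hv, this⟩, rfl⟩

section Basis

variable (b : AffineBasis (Fin (d + 1)) ℝ (E d))

theorem AffineBasis.coord_mem_Icc_of_mem_convexHull {z : E d} (hz : z ∈ convexHull ℝ (range b))
    (i : Fin (d + 1)) : b.coord i z ∈ Icc (0 : ℝ) 1 := by
  rw [b.convexHull_eq_nonneg_coord] at hz
  refine ⟨hz i, ?_⟩
  rw [← b.sum_coord_apply_eq_one z]
  exact Finset.single_le_sum (f := fun j => b.coord j z) (fun j _ => hz j) (Finset.mem_univ i)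

/-- The barycentric coordinates of a simplex which contains a ball of diameter `2 s` are
Lipschitz continuous with constant `1 / (2 s)`. -/
theorem AffineBasis.abs_coord_sub_coord_le {x : E d} {s : ℝ} (hs : 0 < s)
    (hx : Metric.closedBall x s ⊆ convexHull ℝ (range b)) (i : Fin (d + 1)) (z w : E d) :
    |b.coord i z - b.coord i w| * (2 * s) ≤ dist z w := by
  by_cases h : z = w
  · simp [h]
  have hpos : 0 < ‖z - w‖ := norm_pos_iff.2 (sub_ne_zero.2 h)
  -- The segment from `x - u` to `x + u` is a diameter of the inscribed ball in the direction `z -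
  -- w`; along it an affine function with values in `[0, 1]` varies by at most `1`.
  set u : E d := (s / ‖z - w‖) • (z - w) with hu
  have hun : ‖u‖ = s := by
    rw [hu, norm_smul, Real.norm_of_nonneg (by positivity), div_mul_cancel₀ _ hpos.ne']
  have h1 := b.coord_mem_Icc_of_mem_convexHull (hx (by simp [hun] : x + u ∈ _)) i
  have h2 := b.coord_mem_Icc_of_mem_convexHull (hx (by simp [hun] : x - u ∈ _)) i
  have e0 : ∀ p r : E d, b.coord i p - b.coord i r = (b.coord i).linear (p - r) := fun p r => by
    rw [← vsub_eq_sub p r, (b.coord i).linearMap_vsub]; rfl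
  have e1 : b.coord i (x + u) - b.coord i (x - u) =
      2 * (s / ‖z - w‖) * (b.coord i z - b.coord i w) := by
    rw [e0, e0, show x + u - (x - u) = (2 * (s / ‖z - w‖)) • (z - w) by
      rw [hu, mul_smul, two_smul]; abel, map_smul, smul_eq_mul]
  have e2 : |b.coord i (x + u) - b.coord i (x - u)| ≤ 1 := by
    rw [abs_le]; constructor <;> linarith [h1.1, h1.2, h2.1, h2.2]
  rw [e1, abs_mul, abs_of_pos (by positivity)] at e2
  rw [dist_eq_norm]
  calc |b.coord i z - b.coord i w| * (2 * s)
      = 2 * (s / ‖z - w‖) * |b.coord i z - b.coord i w| * ‖z - w‖ := by field_simp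
    _ ≤ 1 * ‖z - w‖ := by gcongr
    _ = ‖z - w‖ := one_mul _

theorem AffineBasis.eq_of_coord_eq_one {a : E d} (ha : a ∈ convexHull ℝ (range b))
    {i : Fin (d + 1)} (hi : b.coord i a = 1) : a = b i := by
  rw [b.convexHull_eq_nonneg_coord] at ha
  refine b.ext_elem fun j => ?_
  by_cases hj : j = i
  · subst hj; simp [hi]
  · rw [b.coord_apply_ne hj]
    have h1 := b.sum_coord_apply_eq_one a
    rw [← Finset.add_sum_erase _ _ (Finset.mem_univ i), hi] at h1
    have h2 : ∑ k ∈ Finset.univ.erase i, b.coord k a = 0 := by linarith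
    exact (Finset.sum_eq_zero_iff_of_nonneg fun k _ => ha k).1 h2 j (by simp [hj])

/-- A face of a simplex contains the vertices which have positive weight in one of its points. -/
theorem AffineBasis.mem_of_isExtreme {F : Set (E d)}
    (hF : IsExtreme ℝ (convexHull ℝ (range b)) F) {a : E d} (ha : a ∈ F) {i : Fin (d + 1)}
    (hi : 0 < b.coord i a) : b i ∈ F := by
  have haT := hF.subset ha
  have hI := b.coord_mem_Icc_of_mem_convexHull haT i
  rcases eq_or_lt_of_le hI.2 with h1 | h1
  · rwa [← b.eq_of_coord_eq_one haT h1]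
  set t := b.coord i a with ht
  have ht0 : 0 < 1 - t := by linarith
  -- `w` is the point where the ray from the vertex `b i` through `a` leaves the simplex, on the
  -- facet opposite to `b i`. Then `a` is inside the segment from `b i` to `w`, and extremality
  -- applies.
  set w : E d := AffineMap.lineMap (b i) a (1 - t)⁻¹ with hw
  have hcw : ∀ j, b.coord j w = (1 - t)⁻¹ * (b.coord j a - b.coord j (b i)) + b.coord j (b i) := by
    intro j
    rw [hw, AffineMap.apply_lineMap, AffineMap.lineMap_apply]
    simp
  have hwT : w ∈ convexHull ℝ (range b) := by
    rw [b.convexHull_eq_nonneg_coord] at haT ⊢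
    intro j
    rw [hcw]
    by_cases hj : j = i
    · subst hj
      rw [b.coord_apply_eq, ← ht]
      have : (1 - t)⁻¹ * (t - 1) + 1 = 0 := by field_simp; ring
      rw [this]
    · rw [b.coord_apply_ne hj]
      have := haT j
      simp only [sub_zero, add_zero]
      positivity
  refine hF.left_mem_of_mem_openSegment (subset_convexHull ℝ _ (mem_range_self i)) hwT ha ?_
  refine ⟨t, 1 - t, hi, ht0, by ring, ?_⟩
  rw [hw, AffineMap.lineMap_apply_module', smul_add, smul_smul, mul_inv_cancel₀ ht0.ne', one_smul,
    sub_smul, one_smul]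
  abel

theorem AffineBasis.exists_coord_pos {a : E d} (ha : a ∈ convexHull ℝ (range b)) :
    ∃ i, 0 < b.coord i a := by
  rw [b.convexHull_eq_nonneg_coord] at ha
  by_contra! h
  have h1 := b.sum_coord_apply_eq_one a
  rw [Finset.sum_eq_zero fun i _ => le_antisymm (h i) (ha i)] at h1
  exact zero_ne_one h1

/-- If `b i` were the only vertex in the face, every point of the face would have all its weight at
`b i`, so the face would be a single point. -/
theorem AffineBasis.exists_ne_mem_of_isExtreme {F : Set (E d)}
    (hF : IsExtreme ℝ (convexHull ℝ (range b)) F) {a a' : E d} (ha : a ∈ F) (ha' : a' ∈ F)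
    (hne : a ≠ a') : ∃ i j, i ≠ j ∧ b i ∈ F ∧ b j ∈ F := by
  by_contra! h
  obtain ⟨i, hi⟩ := b.exists_coord_pos (hF.subset ha)
  have hiF := b.mem_of_isExtreme hF ha hi
  have key : ∀ p ∈ F, p = b i := by
    intro p hp
    refine b.eq_of_coord_eq_one (hF.subset hp) ?_
    have h1 : ∑ j, b.coord j p = b.coord i p := by
      refine Finset.sum_eq_single i (fun j _ hj => ?_) fun h' => absurd (Finset.mem_univ i) h'
      by_contra h0
      have h1 := (b.coord_mem_Icc_of_mem_convexHull (hF.subset hp) j).1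
      exact h i j hj.symm hiF (b.mem_of_isExtreme hF hp (lt_of_le_of_ne h1 (Ne.symm h0)))
    rw [← h1, b.sum_coord_apply_eq_one p]
  exact hne ((key a ha).trans (key a' ha').symm)

/-- The hat function of `S` on the simplex with vertices `b`: the affine function which is `1` at
the vertices in `S` and `0` at the other vertices. -/
def hatFunction (S : Set (E d)) (z : E d) : ℝ :=
  ∑ i, S.indicator (fun _ => b.coord i z) (b i)

theorem hatFunction_eq_one (z : E d) :
    hatFunction b (convexHull ℝ (range b)) z = 1 := by
  rw [hatFunction, ← b.sum_coord_apply_eq_one z]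
  exact Finset.sum_congr rfl fun i _ =>
    indicator_of_mem (subset_convexHull ℝ _ (mem_range_self i)) _

theorem hatFunction_eq_zero {S : Set (E d)} (h : ∀ i, b i ∉ S) (z : E d) :
    hatFunction b S z = 0 :=
  Finset.sum_eq_zero fun i _ => indicator_of_notMem (h i) _

theorem abs_hatFunction_sub_le {x : E d} {s : ℝ} (hs : 0 < s)
    (hx : Metric.closedBall x s ⊆ convexHull ℝ (range b)) (S : Set (E d)) (z w : E d) :
    |hatFunction b S z - hatFunction b S w| * (2 * s) ≤ (d + 1) * dist z w := by
  have h1 : ∀ i, |S.indicator (fun _ => b.coord i z) (b i) -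
      S.indicator (fun _ => b.coord i w) (b i)| * (2 * s) ≤ dist z w := by
    intro i
    by_cases h : b i ∈ S
    · rw [indicator_of_mem h, indicator_of_mem h]
      exact b.abs_coord_sub_coord_le hs hx i z w
    · rw [indicator_of_notMem h, indicator_of_notMem h]
      simp
  rw [hatFunction, hatFunction, ← Finset.sum_sub_distrib]
  calc _ ≤ (∑ i, |S.indicator (fun _ => b.coord i z) (b i) -
      S.indicator (fun _ => b.coord i w) (b i)|) * (2 * s) := by
        gcongr; exact Finset.abs_sum_le_sum_abs _ _
    _ ≤ ∑ _i : Fin (d + 1), dist z w := by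
        rw [Finset.sum_mul]; exact Finset.sum_le_sum fun i _ => h1 i
    _ = _ := by simp

/-- The hat functions on two simplices which meet in a common face agree on that face. -/
theorem hatFunction_congr (b' : AffineBasis (Fin (d + 1)) ℝ (E d)) {F : Set (E d)}
    (hF : IsExtreme ℝ (convexHull ℝ (range b)) F) (hF' : IsExtreme ℝ (convexHull ℝ (range b')) F)
    {z : E d} (hz : z ∈ F) (S : Set (E d)) : hatFunction b S z = hatFunction b' S z := by
  -- A vertex that carries weight in `z` lies in the common face, is extreme there, hence extreme in
  -- the other simplex, and so is one of its vertices.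
  have key : ∀ i, b.coord i z ≠ 0 → ∃ j, b' j = b i := by
    intro i hi
    have h0 := (b.coord_mem_Icc_of_mem_convexHull (hF.subset hz) i).1
    have hiF := b.mem_of_isExtreme hF hz (lt_of_le_of_ne h0 (Ne.symm hi))
    obtain ⟨j, hj⟩ := b'.exists_coord_pos (hF'.subset hiF)
    have hjF := b'.mem_of_isExtreme hF' hiF hj
    have hij : ∀ k, k ≠ i → b.coord k (b i) = 0 := fun k hk => b.coord_apply_ne hk
    have hvert : b i ∈ (convexHull ℝ (range b')).extremePoints ℝ := by
      have h1 : b i ∈ (convexHull ℝ (range b)).extremePoints ℝ := by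
        rw [mem_extremePoints_iff_left]
        refine ⟨hF.subset hiF, fun x hx y hy hseg => ?_⟩
        refine b.eq_of_coord_eq_one hx ?_
        obtain ⟨t, u, ht, hu, htu, he⟩ := hseg
        have h2 : b.coord i (b i) = t * b.coord i x + u * b.coord i y := by
          rw [← he, Convex.combo_affine_apply htu, smul_eq_mul, smul_eq_mul]
        rw [b.coord_apply_eq] at h2
        have hx1 := (b.coord_mem_Icc_of_mem_convexHull hx i).2
        have hy1 := (b.coord_mem_Icc_of_mem_convexHull hy i).2
        by_contra hne
        have hlt := lt_of_le_of_ne hx1 hne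
        nlinarith
      have h2 : b i ∈ F.extremePoints ℝ := by
        rw [hF.extremePoints_eq]; exact ⟨hiF, h1⟩
      exact hF'.extremePoints_subset_extremePoints h2
    have hr : b i ∈ range b' := extremePoints_convexHull_subset hvert
    exact hr
  choose! f hf using key
  have hinj : ∀ i i', b.coord i z ≠ 0 → b.coord i' z ≠ 0 → f i = f i' → i = i' := by
    intro i i' hi hi' he
    have : b i = b i' := by rw [← hf i hi, ← hf i' hi', he]
    exact b.ind.injective this
  have hcoord : ∀ j, b'.coord j z = ∑ i, b.coord i z * b'.coord j (b i) := by
    intro j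
    have h1 : z = Finset.univ.affineCombination ℝ b (fun i => b.coord i z) :=
      (b.affineCombination_coord_eq_self z).symm
    conv_lhs => rw [h1]
    rw [Finset.map_affineCombination _ _ _ (b.sum_coord_apply_eq_one z),
      Finset.affineCombination_eq_linear_combination _ _ _ (b.sum_coord_apply_eq_one z)]
    simp
  -- Since `b i` is the vertex `b' (f i)` whenever it has weight, its coordinates with respect to
  -- `b'` are zero or one, and the double sum collapses either way.
  have hterm : ∀ i j, S.indicator (fun _ => b.coord i z * b'.coord j (b i)) (b' j) =
      if b.coord i z ≠ 0 ∧ j = f i then S.indicator (fun _ => b.coord i z) (b i) else 0 := by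
    intro i j
    by_cases hi : b.coord i z = 0
    · simp [hi]
    · by_cases hj : j = f i
      · subst hj
        rw [if_pos ⟨hi, rfl⟩, ← hf i hi, b'.coord_apply_eq, mul_one]
      · rw [if_neg (by tauto), ← hf i hi, b'.coord_apply_ne hj, mul_zero]
        simp
  calc hatFunction b S z
      = ∑ i, ∑ j, if b.coord i z ≠ 0 ∧ j = f i then
          S.indicator (fun _ => b.coord i z) (b i) else 0 := by
        refine Finset.sum_congr rfl fun i _ => ?_
        by_cases hi : b.coord i z = 0
        · simp [hi]
        · simp [hi]
    _ = ∑ j, ∑ i, S.indicator (fun _ => b.coord i z * b'.coord j (b i)) (b' j) := by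
        rw [Finset.sum_comm]
        exact Finset.sum_congr rfl fun j _ => Finset.sum_congr rfl fun i _ => (hterm i j).symm
    _ = hatFunction b' S z := by
        refine Finset.sum_congr rfl fun j _ => ?_
        by_cases h : b' j ∈ S
        · simp only [indicator_of_mem h]; exact (hcoord j).symm
        · simp only [indicator_of_notMem h, Finset.sum_const_zero]

end Basis
end

noncomputable section

/-! ### Local grading of conforming simplicial subdivisions -/

-- Grow a set from `a` by one element at a time; each step costs at most one factor `c`, and after
-- `s.card` steps the set is all of `s`.
open Classical in
theorem Finset.le_pow_card_mul_of_connected {α : Type*} (s : Finset α) (f : α → ℝ) {c : ℝ}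
    (hc : 1 ≤ c) (hf : ∀ a, 0 ≤ f a)
    (hconn : ∀ A ⊆ s, A.Nonempty → A ≠ s → ∃ a ∈ A, ∃ b ∈ s \ A, f b ≤ c * f a)
    {a b : α} (ha : a ∈ s) (hb : b ∈ s) : f b ≤ c ^ s.card * f a := by
  have key : ∀ k : ℕ, ∃ A ⊆ s, a ∈ A ∧ (k + 1 ≤ A.card ∨ A = s) ∧ ∀ b ∈ A, f b ≤ c ^ k * f a := by
    intro k
    induction k with
    | zero => exact ⟨{a}, by simpa using ha, by simp, by simp, by simp⟩
    | succ k ih =>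
      obtain ⟨A, hA, haA, hcard, hle⟩ := ih
      have hstep : ∀ b ∈ A, f b ≤ c ^ (k + 1) * f a := fun b hb =>
        (hle b hb).trans (by
          gcongr
          · exact hf a
          · omega)
      by_cases e : A = s
      · exact ⟨A, hA, haA, Or.inr e, hstep⟩
      · obtain ⟨a', ha', b', hb', h1⟩ := hconn A hA ⟨a, haA⟩ e
        rw [Finset.mem_sdiff] at hb'
        refine ⟨insert b' A, Finset.insert_subset hb'.1 hA, Finset.mem_insert_of_mem haA,
          Or.inl ?_, ?_⟩
        · rw [Finset.card_insert_of_notMem hb'.2]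
          have := hcard.resolve_right e
          omega
        · intro p hp
          rcases Finset.mem_insert.1 hp with rfl | hp
          · calc f p ≤ c * f a' := h1
              _ ≤ c * (c ^ k * f a) := by
                have := hle a' ha'
                gcongr
              _ = _ := by ring
          · exact hstep p hp
  obtain ⟨A, hA, _, hcard, hle⟩ := key s.card
  have : A = s := by
    rcases hcard with h | h
    · have := Finset.card_le_card hA; omega
    · exact h
  exact hle b (this ▸ hb)

/-- A function on an interval which is Lipschitz continuous on each set of a finite closed cover is
Lipschitz continuous. -/
theorem abs_sub_le_of_finite_closed_cover {ι : Type*} (s : Finset ι) (C : ι → Set ℝ)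
    (hC : ∀ i ∈ s, IsClosed (C i)) (hcov : ∀ t ∈ Icc (0 : ℝ) 1, ∃ i ∈ s, t ∈ C i)
    {f : ℝ → ℝ} {L : ℝ} (hf : ∀ i ∈ s, ∀ t ∈ C i ∩ Icc 0 1, ∀ t' ∈ C i ∩ Icc 0 1,
      |f t - f t'| ≤ L * |t - t'|) : |f 1 - f 0| ≤ L := by
  have hloc : ∀ t ∈ Icc (0 : ℝ) 1, ∀ᶠ t' in nhds t, t' ∈ Icc (0 : ℝ) 1 →
      |f t' - f t| ≤ L * |t' - t| := by
    intro t ht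
    -- Near `t` only those sets of the cover matter which contain `t`, since the others are closed
    -- and finitely many. So the Lipschitz bound holds between `t` and each nearby point.
    have h1 : ∀ᶠ t' in nhds t, ∀ i ∈ s, t' ∈ C i → t ∈ C i := by
      rw [Filter.eventually_all_finset]
      intro i hi
      by_cases h : t ∈ C i
      · exact Filter.Eventually.of_forall fun _ _ => h
      · filter_upwards [(hC i hi).isOpen_compl.mem_nhds h] with t' ht' h2
        exact absurd h2 ht'
    filter_upwards [h1] with t' h2 ht'
    obtain ⟨i, hi, hti⟩ := hcov t' ht'
    exact hf i hi t' ⟨hti, ht'⟩ t ⟨h2 i hi hti, ht⟩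
  have hcont : ContinuousOn f (Icc 0 1) := by
    intro t ht
    rw [ContinuousWithinAt, tendsto_iff_dist_tendsto_zero]
    have h1 : Filter.Tendsto (fun t' => L * |t' - t|) (nhdsWithin t (Icc 0 1)) (nhds 0) := by
      have : Continuous fun t' : ℝ => L * |t' - t| := by fun_prop
      have h2 := this.tendsto t
      simp only [sub_self, abs_zero, mul_zero] at h2
      exact h2.mono_left nhdsWithin_le_nhds
    refine squeeze_zero' (Filter.Eventually.of_forall fun _ => dist_nonneg) ?_ h1
    filter_upwards [nhdsWithin_le_nhds (hloc t ht), self_mem_nhdsWithin] with t' h2 h3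
    exact h2 h3
  set S : Set ℝ := {t | |f t - f 0| ≤ L * t} with hS
  have hclosed : IsClosed (S ∩ Icc 0 1) := by
    have : S ∩ Icc 0 1 = {t ∈ Icc (0 : ℝ) 1 | |f t - f 0| ≤ L * t} := by
      ext t; simp [hS, and_comm]
    rw [this]
    exact isClosed_Icc.isClosed_le ((hcont.sub continuousOn_const).abs)
      (continuousOn_const.mul continuousOn_id)
  -- Continuous induction: the set of good endpoints is closed, and the local bound extends it to
  -- the right.
  have hsub : Icc (0 : ℝ) 1 ⊆ S := by
    refine hclosed.Icc_subset_of_forall_exists_gt (by simp [hS]) ?_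
    intro t ht y hy
    have h1 := nhdsWithin_le_nhds (s := Ioi t) (hloc t ⟨ht.2.1, ht.2.2.le⟩)
    have h2 : Ioc t (min y 1) ∈ nhdsWithin t (Ioi t) := Ioc_mem_nhdsGT (lt_min hy ht.2.2)
    obtain ⟨t', h3, h4⟩ := (Filter.nonempty_of_mem (Filter.inter_mem h1 h2))
    refine ⟨t', ?_, h4.1, h4.2.trans (min_le_left _ _)⟩
    have h5 := h3 ⟨ht.2.1.trans h4.1.le, h4.2.trans (min_le_right _ _)⟩
    rw [abs_of_pos (sub_pos.2 h4.1)] at h5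
    have h6 : |f t - f 0| ≤ L * t := ht.1
    calc |f t' - f 0| ≤ |f t' - f t| + |f t - f 0| := abs_sub_le _ _ _
      _ ≤ L * (t' - t) + L * t := add_le_add h5 h6
      _ = L * t' := by ring
  simpa [hS] using hsub (right_mem_Icc.2 zero_le_one)

variable {d : ℕ}

theorem IsSimplex.isCompact {T : Set (E d)} (hT : IsSimplex T) : IsCompact T := by
  obtain ⟨v, -, rfl⟩ := hT
  exact (finite_range v).isCompact_convexHull ℝ

theorem IsSimplex.convex {T : Set (E d)} (hT : IsSimplex T) : Convex ℝ T := by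
  obtain ⟨v, -, rfl⟩ := hT
  exact convex_convexHull ℝ _

variable {𝒯 : Mesh d} {c : ℝ} {Ω : Set (E d)}

theorem IsConformingSimplicial.extreme' (h : IsConformingSimplicial 𝒯) {T T' : Set (E d)}
    (hT : T ∈ 𝒯) (hT' : T' ∈ 𝒯) : IsExtreme ℝ T' (T ∩ T') := by
  rw [inter_comm]; exact h.conforming T' hT' T hT

/-- A common face with two points contains an edge. A barycentric coordinate of `T` falls from `1`
to `0` along it, so its length is at least the inscribed diameter of `T`, and it fits into `T'`. -/
theorem IsConformingSimplicial.diam_le_of_two_common_points (h : IsConformingSimplicial 𝒯)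
    (hs : ∀ T ∈ 𝒯, IsShapeRegular c T) {T T' : Set (E d)} (hT : T ∈ 𝒯) (hT' : T' ∈ 𝒯)
    {a a' : E d} (ha : a ∈ T ∩ T') (ha' : a' ∈ T ∩ T') (hne : a ≠ a') :
    Metric.diam T ≤ c * Metric.diam T' := by
  obtain ⟨x, s, hs0, hball, hdiam⟩ := hs T hT
  obtain ⟨b, rfl⟩ := (h.simplex T hT).exists_basis
  obtain ⟨i, j, hij, hi, hj⟩ := b.exists_ne_mem_of_isExtreme (h.conforming _ hT T' hT') ha ha' hne
  have h1 := b.abs_coord_sub_coord_le hs0 hball i (b i) (b j)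
  rw [b.coord_apply_eq, b.coord_apply_ne hij, sub_zero, abs_one, one_mul] at h1
  have h2 := Metric.dist_le_diam_of_mem (h.simplex T' hT').isCompact.isBounded hi.2 hj.2
  have hc : 0 ≤ c := by
    have h3 : 0 ≤ c * (2 * s) := Metric.diam_nonneg.trans hdiam
    exact nonneg_of_mul_nonneg_left h3 (by positivity)
  exact hdiam.trans (by gcongr; exact h1.trans h2)

/-- This is the image of the ball under the homothety with centre `x` and ratio `t`. -/
theorem closedBall_subset_of_convex {T : Set (E d)} (hT : Convex ℝ T) {x z : E d} {s t : ℝ}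
    (hx : x ∈ T) (hz : Metric.closedBall z s ⊆ T) (ht : 0 < t) (ht1 : t ≤ 1) :
    Metric.closedBall (x + t • (z - x)) (t * s) ⊆ T := by
  intro y hy
  rw [mem_closedBall_iff_norm] at hy
  have h1 : z + t⁻¹ • (y - (x + t • (z - x))) ∈ T := by
    apply hz
    rw [mem_closedBall_iff_norm, add_sub_cancel_left, norm_smul, norm_inv,
      Real.norm_of_nonneg ht.le, inv_mul_le_iff₀ ht]
    exact hy
  have h2 := hT hx h1 (sub_nonneg.2 ht1) ht.le (by ring)
  convert h2 using 1
  rw [smul_add, smul_smul, mul_inv_cancel₀ ht.ne', one_smul, sub_smul, one_smul, smul_sub]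
  abel

-- Shrink the inscribed balls towards `x` to a common radius `ε`. They stay in their cells, hence
-- overlap in null sets, and lie within `ε (1 + 2 c)` of `x`; compare volumes.
open Classical in
theorem card_cells_at_point_le (hconv : ∀ T ∈ 𝒯, Convex ℝ T) (hb : ∀ T ∈ 𝒯, Bornology.IsBounded T)
    (hc : 1 ≤ c) (hs : ∀ T ∈ 𝒯, IsShapeRegular c T)
    (hov : ∀ T ∈ 𝒯, ∀ T' ∈ 𝒯, T ≠ T' → volume (T ∩ T') = 0) (x : E d) :
    ((𝒯.filter fun T => x ∈ T).card : ℝ) ≤ (1 + 2 * c) ^ d := by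
  set N := 𝒯.filter fun T => x ∈ T with hN
  have hN' : ∀ T ∈ N, T ∈ 𝒯 ∧ x ∈ T := fun T hT => Finset.mem_filter.1 hT
  choose! z s hs0 hball hdiam using hs
  obtain ⟨ε, hε, hεs⟩ : ∃ ε > 0, ∀ T ∈ N, ε ≤ s T := by
    have h1 : ∀ᶠ ε in nhdsWithin (0 : ℝ) (Ioi 0), ∀ T ∈ N, ε ≤ s T := by
      rw [Filter.eventually_all_finset]
      intro T hT
      filter_upwards [Ioc_mem_nhdsGT (hs0 T (hN' T hT).1)] with ε hε using hε.2
    obtain ⟨ε, h2, h3⟩ := (h1.and self_mem_nhdsWithin).exists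
    exact ⟨ε, h3, h2⟩
  set B : Set (E d) → Set (E d) := fun T =>
    Metric.closedBall (x + (ε / s T) • (z T - x)) ε with hB
  have hBT : ∀ T ∈ N, B T ⊆ T := by
    intro T hT
    have hsT := hs0 T (hN' T hT).1
    have := closedBall_subset_of_convex (hconv T (hN' T hT).1) (hN' T hT).2
      (hball T (hN' T hT).1) (div_pos hε hsT) ((div_le_one hsT).2 (hεs T hT))
    rwa [div_mul_cancel₀ _ hsT.ne'] at this
  have hBx : ∀ T ∈ N, B T ⊆ Metric.closedBall x (ε * (1 + 2 * c)) := by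
    intro T hT
    have hsT := hs0 T (hN' T hT).1
    refine Metric.closedBall_subset_closedBall' ?_
    rw [dist_eq_norm, add_sub_cancel_left, norm_smul, Real.norm_of_nonneg (by positivity)]
    have h1 : ‖z T - x‖ ≤ c * (2 * s T) := by
      rw [← dist_eq_norm]
      refine (Metric.dist_le_diam_of_mem (hb T (hN' T hT).1) ?_ (hN' T hT).2).trans
        (hdiam T (hN' T hT).1)
      exact hball T (hN' T hT).1 (Metric.mem_closedBall_self hsT.le)
    calc ε + ε / s T * ‖z T - x‖ ≤ ε + ε / s T * (c * (2 * s T)) := by gcongr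
      _ = _ := by field_simp
  have hvol : ∑ T ∈ N, volume (B T) ≤ volume (Metric.closedBall x (ε * (1 + 2 * c))) := by
    rw [← measure_biUnion_finset₀]
    · exact measure_mono (iUnion₂_subset hBx)
    · intro T hT T' hT' hne
      exact measure_mono_null (inter_subset_inter (hBT T hT) (hBT T' hT'))
        (hov T (hN' T hT).1 T' (hN' T' hT').1 hne)
    · exact fun T _ => Metric.isClosed_closedBall.measurableSet.nullMeasurableSet
  simp only [hB] at hvol
  simp_rw [Measure.addHaar_closedBall volume _ hε.le] at hvol
  rw [Measure.addHaar_closedBall volume _ (by positivity), Finset.sum_const,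
    finrank_euclideanSpace_fin, nsmul_eq_mul, ← mul_assoc] at hvol
  have h0 : volume (Metric.ball (0 : E d) 1) ≠ 0 :=
    (Metric.measure_ball_pos volume _ one_pos).ne'
  have h1 : volume (Metric.ball (0 : E d) 1) ≠ ⊤ := measure_ball_lt_top.ne
  rw [ENNReal.mul_le_mul_iff_left h0 h1] at hvol
  rw [← ENNReal.ofReal_natCast, ← ENNReal.ofReal_mul (by positivity),
    ENNReal.ofReal_le_ofReal_iff (by positivity), mul_pow, mul_comm (ε ^ d)] at hvol
  exact le_of_mul_le_mul_right hvol (by positivity)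

/-- In a conforming simplicial subdivision, cells which share an interior point of the domain are
of comparable size. -/
theorem IsConformingSimplicial.diam_le_of_mem (hd : 2 ≤ d) (h : IsConformingSimplicial 𝒯)
    (hc : 1 ≤ c) (hs : ∀ T ∈ 𝒯, IsShapeRegular c T) (hΩ : IsOpen Ω)
    (hcov : (⋃ T ∈ 𝒯, T) = closure Ω)
    (hov : ∀ T ∈ 𝒯, ∀ T' ∈ 𝒯, T ≠ T' → volume (T ∩ T') = 0) {x : E d} (hx : x ∈ Ω)
    {T T' : Set (E d)} (hT : T ∈ 𝒯) (hT' : T' ∈ 𝒯) (hxT : x ∈ T) (hxT' : x ∈ T') :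
    Metric.diam T ≤ c ^ ⌈(1 + 2 * c) ^ d⌉₊ * Metric.diam T' := by
  classical
  set N := 𝒯.filter fun T => x ∈ T with hN
  have hN' : ∀ T, T ∈ N ↔ T ∈ 𝒯 ∧ x ∈ T := fun T => Finset.mem_filter
  have hcard := card_cells_at_point_le (fun T hT => (h.simplex T hT).convex)
    (fun T hT => (h.simplex T hT).isCompact.isBounded) hc hs hov x
  -- A radius so small that the ball lies in the domain and avoids the cells away from `x`, while
  -- every cell at `x` reaches the sphere.
  obtain ⟨ε, hε, hεΩ, hεT⟩ : ∃ ε > 0, Metric.closedBall x ε ⊆ Ω ∧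
      ∀ T ∈ 𝒯, (x ∉ T → Disjoint (Metric.closedBall x ε) T) ∧
        (x ∈ T → (T ∩ Metric.sphere x ε).Nonempty) := by
    have h1 : ∀ᶠ ε in nhdsWithin (0 : ℝ) (Ioi 0), Metric.closedBall x ε ⊆ Ω := by
      obtain ⟨ρ, hρ, hρΩ⟩ := Metric.nhds_basis_closedBall.mem_iff.1 (hΩ.mem_nhds hx)
      filter_upwards [Ioc_mem_nhdsGT hρ] with ε hε
      exact (Metric.closedBall_subset_closedBall hε.2).trans hρΩ
    have h2 : ∀ᶠ ε in nhdsWithin (0 : ℝ) (Ioi 0), ∀ T ∈ 𝒯,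
        (x ∉ T → Disjoint (Metric.closedBall x ε) T) ∧
        (x ∈ T → (T ∩ Metric.sphere x ε).Nonempty) := by
      rw [Filter.eventually_all_finset]
      intro T hT
      by_cases hxT : x ∈ T
      · obtain ⟨w, hw, hwx⟩ : ∃ w ∈ T, w ≠ x := by
          obtain ⟨b, rfl⟩ := (h.simplex T hT).exists_basis
          have h0 : ∀ i, b i ∈ convexHull ℝ (range b) :=
            fun i => subset_convexHull ℝ _ (mem_range_self i)
          by_cases e : b 0 = x
          · refine ⟨b (Fin.last d), h0 _, fun e' => ?_⟩
            have := b.ind.injective (e.trans e'.symm)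
            rw [Fin.ext_iff] at this
            simp at this
            omega
          · exact ⟨b 0, h0 _, e⟩
        have hpos : 0 < ‖w - x‖ := norm_pos_iff.2 (sub_ne_zero.2 hwx)
        filter_upwards [Ioc_mem_nhdsGT hpos] with ε hε
        refine ⟨fun hh => absurd hxT hh, fun _ => ⟨x + (ε / ‖w - x‖) • (w - x), ?_, ?_⟩⟩
        · exact (h.simplex T hT).convex.add_smul_sub_mem hxT hw
            ⟨(div_pos hε.1 hpos).le, (div_le_one hpos).2 hε.2⟩
        · rw [mem_sphere_iff_norm, add_sub_cancel_left, norm_smul,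
            Real.norm_of_nonneg (div_pos hε.1 hpos).le, div_mul_cancel₀ _ hpos.ne']
      · have hcl := (h.simplex T hT).isCompact.isClosed
        obtain ⟨ρ, hρ, hρT⟩ := Metric.nhds_basis_closedBall.mem_iff.1
          (hcl.isOpen_compl.mem_nhds hxT)
        filter_upwards [Ioc_mem_nhdsGT hρ] with ε hε
        refine ⟨fun _ => ?_, fun hh => absurd hh hxT⟩
        exact disjoint_left.2 fun y hy => hρT (Metric.closedBall_subset_closedBall hε.2 hy)
    obtain ⟨ε, ⟨h3, h4⟩, h5⟩ := ((h1.and h2).and self_mem_nhdsWithin).exists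
    exact ⟨ε, h5, h3, h4⟩
  -- This needs `d ≥ 2`. The connected sphere is covered by the closed cells at `x`, so two
  -- complementary groups of them meet on it, at a point other than `x`; a pair of cells from the
  -- two groups then shares an edge.
  have hconn : IsPreconnected (Metric.sphere x ε) := by
    refine isPreconnected_sphere ?_ x ε
    rw [← Module.finrank_eq_rank, finrank_euclideanSpace_fin]
    exact_mod_cast hd
  have hmain := N.le_pow_card_mul_of_connected (fun T => Metric.diam T) hc
    (fun T => Metric.diam_nonneg) (a := T') (b := T) ?_ ((hN' _).2 ⟨hT', hxT'⟩)
    ((hN' _).2 ⟨hT, hxT⟩)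
  · refine hmain.trans ?_
    gcongr
    · have : (N.card : ℝ) ≤ ⌈(1 + 2 * c) ^ d⌉₊ := hcard.trans (Nat.le_ceil _)
      exact_mod_cast this
  · intro A hA hAne hAN
    have hclosed : ∀ C ⊆ N, IsClosed (⋃ S ∈ C, S) := fun C hC =>
      C.finite_toSet.isClosed_biUnion fun S hS =>
        (h.simplex S ((hN' S).1 (hC hS)).1).isCompact.isClosed
    have hmeet : ∀ C ⊆ N, C.Nonempty → (Metric.sphere x ε ∩ ⋃ S ∈ C, S).Nonempty := by
      rintro C hC ⟨S, hS⟩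
      obtain ⟨p, hp1, hp2⟩ := (hεT S ((hN' S).1 (hC hS)).1).2 ((hN' S).1 (hC hS)).2
      exact ⟨p, hp2, mem_biUnion hS hp1⟩
    have hcover : Metric.sphere x ε ⊆ (⋃ S ∈ A, S) ∪ ⋃ S ∈ N \ A, S := by
      intro p hp
      have hp' := Metric.sphere_subset_closedBall hp
      have h1 : p ∈ ⋃ T ∈ 𝒯, T := by rw [hcov]; exact subset_closure (hεΩ hp')
      obtain ⟨S, hS, hpS⟩ := mem_iUnion₂.1 h1
      have hxS : x ∈ S := by
        by_contra hxS
        exact disjoint_left.1 ((hεT S hS).1 hxS) hp' hpS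
      have hSN := (hN' S).2 ⟨hS, hxS⟩
      by_cases hSA : S ∈ A
      · exact Or.inl (mem_biUnion hSA hpS)
      · exact Or.inr (mem_biUnion (s := fun S => S ∈ N \ A) (t := fun S => S)
          (Finset.mem_sdiff.2 ⟨hSN, hSA⟩) hpS)
    have hne : (N \ A).Nonempty := by
      rw [Finset.sdiff_nonempty]
      exact fun hh => hAN (Finset.Subset.antisymm hA hh)
    obtain ⟨p, hp, hpA, hpB⟩ := isPreconnected_closed_iff.1 hconn _ _ (hclosed A hA)
      (hclosed _ Finset.sdiff_subset) hcover (hmeet A hA hAne) (hmeet _ Finset.sdiff_subset hne)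
    obtain ⟨S, hS, hpS⟩ := mem_iUnion₂.1 hpA
    obtain ⟨S', hS', hpS'⟩ := mem_iUnion₂.1 hpB
    have hSN := (hN' S).1 (hA hS)
    have hSN' := (hN' S').1 (Finset.sdiff_subset hS')
    refine ⟨S, hS, S', hS', ?_⟩
    refine h.diam_le_of_two_common_points hs hSN'.1 hSN.1 (a := x) (a' := p) ⟨hSN'.2, hSN.2⟩
      ⟨hpS', hpS⟩ ?_
    rintro rfl
    simp at hp
    exact hε.ne hp
end

noncomputable section

/-! ### Grading at a distance by hat functions -/

variable {d : ℕ} {𝒯 : Mesh d} {c : ℝ} {Ω : Set (E d)}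

/-- A cell is met by all cells at points whose distance along a segment in the domain is small in
comparison with the sizes of the neighbouring cells. -/
theorem IsConformingSimplicial.exists_meeting_cell (h : IsConformingSimplicial 𝒯)
    (hs : ∀ T ∈ 𝒯, IsShapeRegular c T) {S : Set (E d)} (hS : S ∈ 𝒯) {D : ℝ} (hD : 0 < D)
    (hc : 0 < c) (hmeet : ∀ T ∈ 𝒯, (T ∩ S).Nonempty → D ≤ Metric.diam T) {p y : E d} (hp : p ∈ S)
    (hseg : segment ℝ p y ⊆ ⋃ T ∈ 𝒯, T) (hdist : (d + 1) * c * dist p y < D) :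
    ∃ T ∈ 𝒯, y ∈ T ∧ (T ∩ S).Nonempty := by
  classical
  have hb : ∀ T ∈ 𝒯, ∃ b : AffineBasis (Fin (d + 1)) ℝ (E d), T = convexHull ℝ (range b) :=
    fun T hT => (h.simplex T hT).exists_basis
  have : Nonempty (AffineBasis (Fin (d + 1)) ℝ (E d)) := ⟨(hb S hS).choose⟩
  choose! b hbT using hb
  set z : ℝ → E d := fun t => p + t • (y - p) with hz
  have hzc : Continuous z := by fun_prop
  have hzcov : ∀ t ∈ Icc (0 : ℝ) 1, ∃ T ∈ 𝒯, z t ∈ T := by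
    intro t ht
    have : z t ∈ segment ℝ p y := by
      rw [segment_eq_image']; exact ⟨t, ht, rfl⟩
    simpa using hseg this
  choose! T hT hzT using hzcov
  -- The hat function of `S` along the segment: `1` at `p` and `0` on cells disjoint from `S`. The
  -- choice of the cell `T t` is immaterial, because hat functions agree on common faces.
  set f : ℝ → ℝ := fun t => hatFunction (b (T t)) S (z t) with hf
  have hcongr : ∀ T₁ ∈ 𝒯, ∀ T₂ ∈ 𝒯, ∀ w ∈ T₁ ∩ T₂,
      hatFunction (b T₁) S w = hatFunction (b T₂) S w := by
    intro T₁ h1 T₂ h2 w hw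
    refine hatFunction_congr (b T₁) (b T₂) (F := T₁ ∩ T₂) ?_ ?_ hw S
    · rw [← hbT T₁ h1]; exact h.conforming T₁ h1 T₂ h2
    · rw [← hbT T₂ h2]; exact h.extreme' h1 h2
  have hvert : ∀ T ∈ 𝒯, ∀ i, b T i ∈ T := by
    intro T hT i
    have : b T i ∈ convexHull ℝ (range (b T)) := subset_convexHull ℝ _ (mem_range_self i)
    rwa [← hbT T hT] at this
  have hzero : ∀ T ∈ 𝒯, ¬ (T ∩ S).Nonempty → ∀ w, hatFunction (b T) S w = 0 := by
    intro T hT hTS w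
    exact hatFunction_eq_zero (b T) (fun i hi => hTS ⟨b T i, hvert T hT i, hi⟩) w
  -- Only cells that meet `S` contribute to the slope, and these have inscribed diameter at least `D
  -- / c`. So `f` cannot reach `0` at `y` within the assumed distance.
  have hL : |f 1 - f 0| ≤ (d + 1) * c * dist p y / D := by
    refine abs_sub_le_of_finite_closed_cover 𝒯 (fun T => z ⁻¹' T)
      (fun T hT => (h.simplex T hT).isCompact.isClosed.preimage hzc)
      (fun t ht => ⟨T t, hT t ht, hzT t ht⟩) ?_
    rintro T' hT' t ⟨htT, ht⟩ t' ⟨htT', ht'⟩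
    have e1 : f t = hatFunction (b T') S (z t) :=
      hcongr _ (hT t ht) _ hT' _ ⟨hzT t ht, htT⟩
    have e2 : f t' = hatFunction (b T') S (z t') :=
      hcongr _ (hT t' ht') _ hT' _ ⟨hzT t' ht', htT'⟩
    rw [e1, e2]
    by_cases hTS : (T' ∩ S).Nonempty
    · obtain ⟨x, s, hs0, hball, hdiam⟩ := hs T' hT'
      have hball' : Metric.closedBall x s ⊆ convexHull ℝ (range (b T')) := by
        rwa [← hbT T' hT']
      have h1 := abs_hatFunction_sub_le (b T') hs0 hball' S (z t) (z t')
      have h2 : dist (z t) (z t') = |t - t'| * dist p y := by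
        rw [dist_eq_norm, dist_comm p y, dist_eq_norm y p]
        simp only [hz]
        rw [add_sub_add_left_eq_sub, ← sub_smul, norm_smul, Real.norm_eq_abs]
      rw [h2] at h1
      have h3 : D ≤ c * (2 * s) := (hmeet T' hT' hTS).trans hdiam
      have h4 : |hatFunction (b T') S (z t) - hatFunction (b T') S (z t')| * D ≤
          (d + 1) * c * dist p y * |t - t'| := by
        calc _ ≤ |hatFunction (b T') S (z t) - hatFunction (b T') S (z t')| * (c * (2 * s)) := by
              gcongr
          _ = c * (|hatFunction (b T') S (z t) - hatFunction (b T') S (z t')| * (2 * s)) := by ring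
          _ ≤ c * ((d + 1) * (|t - t'| * dist p y)) := by gcongr
          _ = _ := by ring
      rw [div_mul_eq_mul_div, le_div_iff₀ hD]
      exact h4
    · rw [hzero T' hT' hTS, hzero T' hT' hTS, sub_zero, abs_zero]
      positivity
  have hz0 : z 0 = p := by simp [hz]
  have hz1 : z 1 = y := by simp [hz]
  have h01 : (0 : ℝ) ∈ Icc (0 : ℝ) 1 := left_mem_Icc.2 zero_le_one
  have h11 : (1 : ℝ) ∈ Icc (0 : ℝ) 1 := right_mem_Icc.2 zero_le_one
  have hf0 : f 0 = 1 := by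
    have e1 : f 0 = hatFunction (b S) S (z 0) :=
      hcongr _ (hT 0 h01) _ hS _ ⟨hzT 0 h01, by rw [hz0]; exact hp⟩
    rw [e1]
    have := hatFunction_eq_one (b S) (z 0)
    rwa [← hbT S hS] at this
  refine ⟨T 1, hT 1 h11, by simpa [hz1] using hzT 1 h11, ?_⟩
  by_contra hne
  have hf1 : f 1 = 0 := hzero _ (hT 1 h11) hne _
  rw [hf0, hf1, le_div_iff₀ hD] at hL
  norm_num at hL
  linarith

/-- Local grading of conforming simplicial subdivisions at interior points of the domain. -/
theorem IsConformingSimplicial.diam_le_of_dist_le (hd : 2 ≤ d) (hc : 1 ≤ c) : ∃ K : ℝ, 0 < K ∧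
    ∀ (Ω : Set (E d)) (𝒯 : Mesh d), IsConformingSimplicial 𝒯 → (∀ T ∈ 𝒯, IsShapeRegular c T) →
    IsOpen Ω → (⋃ T ∈ 𝒯, T) = closure Ω →
    (∀ T ∈ 𝒯, ∀ T' ∈ 𝒯, T ≠ T' → volume (T ∩ T') = 0) →
    ∀ (y x : E d) (δ : ℝ), 0 < δ → Metric.ball y (K * δ) ⊆ Ω → dist x y ≤ δ →
    ∀ T ∈ 𝒯, ∀ T' ∈ 𝒯, x ∈ T → y ∈ T' → Metric.diam T' ≤ δ → Metric.diam T ≤ K * δ := by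
  set C := c ^ ⌈(1 + 2 * c) ^ d⌉₊ with hC
  have hC1 : 1 ≤ C := one_le_pow₀ hc
  set K := C ^ 2 + (d + 1) * c * C + 1 with hK
  have hKC : C ^ 2 < K := by
    have : 0 ≤ (d + 1) * c * C := by positivity
    linarith
  have hK1 : 1 < K := by nlinarith
  -- A cell of diameter at most `C K δ` that meets the segment lies within `(C K + 1) δ` of `y`; the
  -- extra `δ` keeps it inside the open ball.
  refine ⟨C * K + 2, by positivity, ?_⟩
  intro Ω 𝒯 h hs hΩ hcov hov y x δ hδ hball hxy T hT T' hT' hxT hyT' hdT'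
  have hcomp : ∀ w ∈ Ω, ∀ S ∈ 𝒯, ∀ S' ∈ 𝒯, w ∈ S → w ∈ S' → Metric.diam S ≤ C * Metric.diam S' :=
    fun w hw S hS S' hS' h1 h2 => h.diam_le_of_mem hd hc hs hΩ hcov hov hw hS hS' h1 h2
  have hballΩ : ∀ w, dist w y ≤ (C * K + 1) * δ → w ∈ Ω := fun w hw =>
    hball (Metric.mem_ball.2 (hw.trans_lt (by gcongr; linarith)))
  have hsegy : ∀ w ∈ segment ℝ x y, dist w y ≤ δ := by
    intro w hw
    have := (convex_closedBall y δ).segment_subset (Metric.mem_closedBall.2 hxy)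
      (Metric.mem_closedBall_self hδ.le) hw
    exact Metric.mem_closedBall.1 this
  have hsegΩ : segment ℝ x y ⊆ Ω := fun w hw => hballΩ w ((hsegy w hw).trans (by
    have : 0 ≤ C * K * δ := by positivity
    linarith))
  have hsegcov : segment ℝ x y ⊆ ⋃ T ∈ 𝒯, T := by
    rw [hcov]; exact hsegΩ.trans subset_closure
  suffices hmain : Metric.diam T ≤ K * δ by
    refine hmain.trans ?_
    gcongr
    nlinarith
  by_contra! hbig
  classical
  have hclosed : ∀ 𝒮 ⊆ 𝒯, IsClosed (⋃ S ∈ 𝒮, S) := fun 𝒮 h𝒮 =>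
    𝒮.finite_toSet.isClosed_biUnion fun S hS => (h.simplex S (h𝒮 hS)).isCompact.isClosed
  set A := 𝒯.filter fun S => Metric.diam S ≤ K * δ with hA
  set B := 𝒯.filter fun S => K * δ < Metric.diam S with hB
  have hT'A : T' ∈ A := Finset.mem_filter.2 ⟨hT', hdT'.trans (by nlinarith)⟩
  have hTB : T ∈ B := Finset.mem_filter.2 ⟨hT, hbig⟩
  -- Small and large cells both occur on the connected segment, so a small `S'` and a large `S`
  -- share a point `p`. By comparison at `p` the cell `S` is not too large, and all cells meeting it
  -- have diameter at least `K δ / C`.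
  obtain ⟨p, hp, hpA, hpB⟩ := isPreconnected_closed_iff.1 (convex_segment x y).isPreconnected
    (⋃ S ∈ A, S) (⋃ S ∈ B, S) (hclosed A (Finset.filter_subset _ _))
    (hclosed B (Finset.filter_subset _ _))
    (by
      intro w hw
      obtain ⟨S, hS, hwS⟩ := mem_iUnion₂.1 (hsegcov hw)
      rcases le_or_gt (Metric.diam S) (K * δ) with h1 | h1
      · exact Or.inl (mem_biUnion (s := fun S => S ∈ A) (t := fun S => S)
          (Finset.mem_filter.2 ⟨hS, h1⟩) hwS)
      · exact Or.inr (mem_biUnion (s := fun S => S ∈ B) (t := fun S => S)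
          (Finset.mem_filter.2 ⟨hS, h1⟩) hwS))
    ⟨y, right_mem_segment ℝ x y, mem_biUnion (s := fun S => S ∈ A) (t := fun S => S) hT'A hyT'⟩
    ⟨x, left_mem_segment ℝ x y, mem_biUnion (s := fun S => S ∈ B) (t := fun S => S) hTB hxT⟩
  obtain ⟨S', hS', hpS'⟩ := mem_iUnion₂.1 hpA
  obtain ⟨S, hS, hpS⟩ := mem_iUnion₂.1 hpB
  obtain ⟨hS'𝒯, hS'd⟩ := Finset.mem_filter.1 hS'
  obtain ⟨hS𝒯, hSd⟩ := Finset.mem_filter.1 hS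
  have hSd' : Metric.diam S ≤ C * K * δ := by
    rw [mul_assoc]
    exact (hcomp p (hsegΩ hp) S hS𝒯 S' hS'𝒯 hpS hpS').trans (by gcongr)
  have hmeet : ∀ S'' ∈ 𝒯, (S'' ∩ S).Nonempty → K * δ / C ≤ Metric.diam S'' := by
    rintro S'' hS'' ⟨w, hw'', hw⟩
    have hwΩ : w ∈ Ω := by
      refine hballΩ w ?_
      have h1 := Metric.dist_le_diam_of_mem (h.simplex S hS𝒯).isCompact.isBounded hw hpS
      have h2 := dist_triangle w p y
      have h3 := hsegy p hp
      linarith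
    rw [div_le_iff₀' (by positivity)]
    exact hSd.le.trans (hcomp w hwΩ S hS𝒯 S'' hS'' hw hw'')
  have hpy : segment ℝ p y ⊆ ⋃ T ∈ 𝒯, T :=
    ((convex_segment x y).segment_subset hp (right_mem_segment ℝ x y)).trans hsegcov
  have hdist : (d + 1) * c * dist p y < K * δ / C := by
    rw [lt_div_iff₀ (by positivity)]
    calc (d + 1) * c * dist p y * C ≤ (d + 1) * c * δ * C := by gcongr; exact hsegy p hp
      _ = (d + 1) * c * C * δ := by ring
      _ < K * δ := by gcongr; nlinarith
  -- A cell at `y` that meets `S` has diameter at least `K δ / C`, but at most `C δ` by comparison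
  -- with `T'` at `y`. This contradicts `K > C ^ 2`.
  obtain ⟨S'', hS'', hyS'', hne⟩ := h.exists_meeting_cell hs hS𝒯 (by positivity)
    (by linarith) hmeet hpS hpy hdist
  have hyΩ : y ∈ Ω := hsegΩ (right_mem_segment ℝ x y)
  have h1 := hcomp y hyΩ S'' hS'' T' hT' hyS'' hyT'
  have h2 := hmeet S'' hS'' hne
  rw [div_le_iff₀ (by positivity)] at h2
  have h3 : Metric.diam S'' * C ≤ C * δ * C := by
    gcongr
    exact h1.trans (by gcongr)
  nlinarith
end

noncomputable section

/-! ### Lipschitz hypersurfaces -/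

variable {d : ℕ}

/-- The horizontal part of `x` with respect to the vertical direction `e`. -/
def horizontal (e x : E d) : E d := x - inner ℝ e x • e

theorem norm_inner_smul_le {e : E d} (he : ‖e‖ = 1) (x : E d) : ‖inner ℝ e x • e‖ ≤ ‖x‖ := by
  rw [norm_smul, he, mul_one]
  simpa [he] using norm_inner_le_norm (𝕜 := ℝ) e x

theorem dist_horizontal_le {e : E d} (he : ‖e‖ = 1) (x y : E d) :
    dist (horizontal e x) (horizontal e y) ≤ 2 * dist x y := by
  have h : horizontal e x - horizontal e y = (x - y) - inner ℝ e (x - y) • e := by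
    rw [horizontal, horizontal, inner_sub_right, sub_smul]; abel
  rw [dist_eq_norm, h, dist_eq_norm]
  have := norm_inner_smul_le he (x - y)
  linarith [norm_sub_le (x - y) (inner ℝ e (x - y) • e)]

theorem horizontal_add_smul {e : E d} (he : ‖e‖ = 1) (x : E d) (t : ℝ) :
    horizontal e (x + t • e) = horizontal e x := by
  rw [horizontal, horizontal, inner_add_right, inner_smul_right, real_inner_self_eq_norm_sq, he,
    add_smul]
  simp

theorem inner_horizontal {e : E d} (he : ‖e‖ = 1) (x : E d) : inner ℝ e (horizontal e x) = 0 := by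
  rw [horizontal, inner_sub_right, inner_smul_right, real_inner_self_eq_norm_sq, he]
  simp

theorem continuous_horizontal (e : E d) : Continuous (horizontal e) := by
  unfold horizontal; fun_prop

/-- A frontier point is not in the open set `U`, so it is not above the graph. Strictly below the
graph it would have a neighbourhood free of `U`, yet it lies in the closure. -/
theorem IsLipschitzDomain.exists_graph {U : Set (E d)} (hU : IsLipschitzDomain U) {p : E d}
    (hp : p ∈ frontier U) : ∃ (e : E d) (ρ : ℝ) (L : NNReal) (g : E d → ℝ),
      ‖e‖ = 1 ∧ 0 < ρ ∧ LipschitzWith L g ∧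
        ∀ x ∈ frontier U ∩ Metric.ball p ρ, g (horizontal e x) = inner ℝ e x := by
  obtain ⟨e, ρ, L, g, he, hρ, hg, hgraph⟩ := hU.graph p hp
  refine ⟨e, ρ, L, g, he, hρ, hg, ?_⟩
  rintro x ⟨hx, hxp⟩
  rw [hU.isOpen.frontier_eq] at hx
  have h1 : ¬ g (horizontal e x) < inner ℝ e x := fun h => hx.2 ((hgraph x hxp).2 h)
  refine le_antisymm ?_ (not_lt.1 h1)
  by_contra! h2
  have hcont : Continuous fun y => g (horizontal e y) :=
    hg.continuous.comp (continuous_horizontal e)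
  have hopen : IsOpen {y | inner ℝ e y < g (horizontal e y)} :=
    isOpen_lt (by fun_prop) hcont
  obtain ⟨y, ⟨hy1, hy2⟩, hyU⟩ := mem_closure_iff.1 hx.1 _ (hopen.inter Metric.isOpen_ball)
    ⟨h2, hxp⟩
  exact lt_asymm hy1 ((hgraph y hy2).1 hyU)

/-- Neighbourhoods of Lipschitz graphs: the volume is proportional to the width. -/
theorem volume_graph_layer_le {e : E d} (he : ‖e‖ = 1) {g : E d → ℝ} (hg : Continuous g)
    (p : E d) (R : ℝ) {a : ℝ} (ha : 0 < a) :
    volume.real {x ∈ Metric.ball p R | |inner ℝ e x - g (horizontal e x)| ≤ a} ≤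
      3 * a * volume.real (Metric.ball p (R + 1)) := by
  set N := {x ∈ Metric.ball p R | |inner ℝ e x - g (horizontal e x)| ≤ a} with hN
  have hNm : MeasurableSet N := by
    have h1 : Continuous fun x => |inner ℝ e x - g (horizontal e x)| := by
      have := hg.comp (continuous_horizontal e)
      exact ((by fun_prop : Continuous fun x : E d => inner ℝ e x).sub this).abs
    exact Metric.isOpen_ball.measurableSet.inter (isClosed_le h1 continuous_const).measurableSet
  set n := ⌈1 / (3 * a)⌉₊ with hn
  have hn1 : 1 / (3 * a) ≤ n := Nat.le_ceil _
  have hn2 : (n : ℝ) < 1 / (3 * a) + 1 := Nat.ceil_lt_add_one (by positivity)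
  -- Translates of the layer by multiples of `3 a` along `e` are disjoint, as its vertical extent is
  -- `2 a`. About `1 / (3 a)` of them fit into the ball enlarged by `1`.
  set τ : ℕ → Set (E d) := fun k => (fun x => x + (-(3 * a * k)) • e) ⁻¹' N with hτ
  have hvol : ∀ k, volume.real (τ k) = volume.real N := fun k => by
    rw [measureReal_def, hτ, measure_preimage_add_right, measureReal_def]
  have hsub : ∀ k ∈ Finset.range n, τ k ⊆ Metric.ball p (R + 1) := by
    intro k hk x hx
    have h1 := Metric.mem_ball.1 hx.1
    have h2 : (k : ℝ) + 1 ≤ n := by exact_mod_cast Finset.mem_range.1 hk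
    have h3 : dist x (x + (-(3 * a * k)) • e) = 3 * a * k := by
      rw [dist_self_add_right, norm_smul, he, mul_one, norm_neg, Real.norm_of_nonneg (by positivity)]
    have h4 : 3 * a * k < 1 := by
      have : (k : ℝ) < 1 / (3 * a) := by linarith
      rw [lt_div_iff₀ (by positivity)] at this
      linarith
    rw [Metric.mem_ball]
    linarith [dist_triangle x (x + (-(3 * a * k)) • e) p]
  have hdisj : Set.PairwiseDisjoint (Finset.range n : Set ℕ) τ := by
    intro k _ l _ hkl
    refine disjoint_left.2 fun x hx hx' => ?_
    have h1 := hx.2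
    have h2 := hx'.2
    rw [horizontal_add_smul he, inner_add_right, inner_smul_right, real_inner_self_eq_norm_sq, he,
      abs_le] at h1 h2
    have h3 : (1 : ℝ) ≤ |(k : ℝ) - l| := by
      have : (1 : ℤ) ≤ |(k : ℤ) - l| := Int.one_le_abs (by omega)
      exact_mod_cast this
    rcases le_abs.1 h3 with h | h <;> nlinarith
  have hsum : n * volume.real N ≤ volume.real (Metric.ball p (R + 1)) := by
    calc n * volume.real N = ∑ k ∈ Finset.range n, volume.real (τ k) := by simp [hvol]
      _ = volume.real (⋃ k ∈ Finset.range n, τ k) := by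
        rw [measureReal_biUnion_finset hdisj
          (fun k _ => hNm.preimage (by fun_prop)) (fun k hk =>
          ((measure_mono (hsub k hk)).trans_lt measure_ball_lt_top).ne)]
      _ ≤ _ := measureReal_mono (iUnion₂_subset hsub) measure_ball_lt_top.ne
  have h5 : 1 ≤ 3 * a * n := by
    rw [div_le_iff₀ (by positivity)] at hn1
    linarith
  calc volume.real N ≤ 3 * a * n * volume.real N :=
        le_mul_of_one_le_left measureReal_nonneg h5
    _ = 3 * a * (n * volume.real N) := by ring
    _ ≤ _ := by gcongr

variable {ω : Set (E d)}

theorem IsLipschitzDomain.isCompact_frontier (hω : IsLipschitzDomain ω) :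
    IsCompact (frontier ω) :=
  Metric.isCompact_of_isClosed_isBounded isClosed_frontier
    (hω.isBounded.closure.subset frontier_subset_closure)

/-- Finitely many charts cover the frontier. A point within `r` of the part in one chart lies in a
layer of width proportional to `r` around its graph. The graph functions are defined globally, so
`r` need not be small. -/
theorem IsLipschitzDomain.volume_thickening_le (hω : IsLipschitzDomain ω) {B : Set (E d)}
    (hB : Bornology.IsBounded B) : ∃ C : ℝ, 0 < C ∧ ∀ ρ : ℝ, 0 < ρ →
      volume.real (Metric.thickening ρ (frontier ω) ∩ B) ≤ C * ρ := by
  have hchart := fun p (hp : p ∈ frontier ω) => hω.exists_graph hp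
  choose! e ρ L g he hρ hg hgraph using hchart
  obtain ⟨t, htω, ht⟩ := hω.isCompact_frontier.elim_nhds_subcover (fun p => Metric.ball p (ρ p))
    fun p hp => Metric.ball_mem_nhds p (hρ p hp)
  choose R hR using fun p : E d => hB.subset_ball p
  refine ⟨∑ p ∈ t, 3 * (1 + 2 * L p) * volume.real (Metric.ball p (R p + 1)) + 1, ?_, ?_⟩
  · positivity
  intro r hr
  have hsub : Metric.thickening r (frontier ω) ∩ B ⊆ ⋃ p ∈ t, {x ∈ Metric.ball p (R p) |
      |inner ℝ (e p) x - g p (horizontal (e p) x)| ≤ (1 + 2 * L p) * r} := by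
    rintro x ⟨hx, hxB⟩
    obtain ⟨y, hy, hxy⟩ := Metric.mem_thickening_iff.1 hx
    obtain ⟨p, hp, hyp⟩ := mem_iUnion₂.1 (ht hy)
    refine mem_biUnion hp ⟨hR p hxB, ?_⟩
    have hpω := htω p hp
    have h1 : |inner ℝ (e p) (x - y)| ≤ dist x y := by
      have := norm_inner_le_norm (𝕜 := ℝ) (e p) (x - y)
      rwa [he p hpω, one_mul, ← dist_eq_norm] at this
    have h2 := (hg p hpω).dist_le_mul (horizontal (e p) y) (horizontal (e p) x)
    rw [Real.dist_eq] at h2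
    have h3 := dist_horizontal_le (he p hpω) y x
    rw [dist_comm y x] at h3
    have h4 : inner ℝ (e p) x - g p (horizontal (e p) x) = inner ℝ (e p) (x - y) +
        (g p (horizontal (e p) y) - g p (horizontal (e p) x)) := by
      rw [hgraph p hpω y ⟨hy, hyp⟩, inner_sub_right]; ring
    rw [h4]
    calc _ ≤ _ := abs_add_le _ _
      _ ≤ dist x y + L p * (2 * dist x y) := by
        refine add_le_add h1 (h2.trans ?_)
        gcongr
      _ = (1 + 2 * L p) * dist x y := by ring
      _ ≤ _ := by gcongr
  calc _ ≤ volume.real (⋃ p ∈ t, {x ∈ Metric.ball p (R p) |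
      |inner ℝ (e p) x - g p (horizontal (e p) x)| ≤ (1 + 2 * L p) * r}) := by
        refine measureReal_mono hsub ?_
        refine ((measure_biUnion_finset_le t _).trans_lt ?_).ne
        refine ENNReal.sum_lt_top.2 fun p _ => ?_
        exact (measure_mono (sep_subset _ _)).trans_lt measure_ball_lt_top
    _ ≤ ∑ p ∈ t, volume.real {x ∈ Metric.ball p (R p) |
        |inner ℝ (e p) x - g p (horizontal (e p) x)| ≤ (1 + 2 * L p) * r} :=
        measureReal_biUnion_finset_le _ _
    _ ≤ ∑ p ∈ t, 3 * ((1 + 2 * L p) * r) * volume.real (Metric.ball p (R p + 1)) :=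
        Finset.sum_le_sum fun p hp => volume_graph_layer_le (he p (htω p hp))
          (hg p (htω p hp)).continuous p (R p) (by positivity)
    _ = (∑ p ∈ t, 3 * (1 + 2 * L p) * volume.real (Metric.ball p (R p + 1))) * r := by
        rw [Finset.sum_mul]
        exact Finset.sum_congr rfl fun p _ => by ring
    _ ≤ _ := by gcongr; linarith

theorem LipschitzWith.euclideanHausdorffMeasure_image_le {X Y : Type*} [EMetricSpace X]
    [EMetricSpace Y] [MeasurableSpace X] [BorelSpace X] [MeasurableSpace Y] [BorelSpace Y]
    {K : NNReal} {f : X → Y} (hf : LipschitzWith K f) (n : ℕ) (s : Set X) :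
    Measure.euclideanHausdorffMeasure n (f '' s) ≤
      (K : ENNReal) ^ n * Measure.euclideanHausdorffMeasure n s := by
  rw [Measure.euclideanHausdorffMeasure_def, Measure.euclideanHausdorffMeasure_def,
    Measure.smul_apply, Measure.smul_apply, ENNReal.smul_def, ENNReal.smul_def, smul_eq_mul,
    smul_eq_mul, mul_left_comm]
  gcongr
  have := hf.hausdorffMeasure_image_le (d := n) (by positivity) s
  rwa [ENNReal.rpow_natCast] at this

/-- The surface measure of the part of a Lipschitz graph in a ball. -/
theorem hausdorffMeasure_graph_inter_ball_le (n : ℕ) {e : E (n + 1)} (he : ‖e‖ = 1) {L : NNReal}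
    {g : E (n + 1) → ℝ} (hg : LipschitzWith L g) {S : Set (E (n + 1))}
    (hS : ∀ x ∈ S, g (horizontal e x) = inner ℝ e x) (x : E (n + 1)) {t : ℝ} (ht : 0 < t) :
    Measure.euclideanHausdorffMeasure n (S ∩ Metric.ball x t) ≤
      ENNReal.ofReal ((1 + L) ^ n * 2 ^ n * volume.real (Metric.ball (0 : E n) 1) * t ^ n) := by
  have : Fact (Module.finrank ℝ (E (n + 1)) = n + 1) := ⟨finrank_euclideanSpace_fin⟩
  have he0 : e ≠ 0 := by rintro rfl; simp at he
  set φ := (OrthonormalBasis.fromOrthogonalSpanSingleton (𝕜 := ℝ) n he0).repr.symm with hφ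
  have hmem : ∀ y, horizontal e y ∈ (Submodule.span ℝ {e})ᗮ := fun y =>
    Submodule.mem_orthogonal_singleton_iff_inner_right.2 (inner_horizontal he y)
  -- The graph is the image of the orthogonal complement of `e` under a Lipschitz map, and points of
  -- the ball have horizontal parts in a ball of radius `2 t`.
  set Ψ : E n → E (n + 1) := fun z => (φ z : E (n + 1)) + g (φ z) • e with hΨ
  have hφd : ∀ z w, dist (φ z : E (n + 1)) (φ w) = dist z w := fun z w => φ.dist_map z w
  have hΨL : LipschitzWith (1 + L) Ψ := by
    refine LipschitzWith.of_dist_le_mul fun z w => ?_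
    have h1 := hg.dist_le_mul (φ z : E (n + 1)) (φ w)
    rw [hφd] at h1
    calc dist (Ψ z) (Ψ w) ≤ dist (φ z : E (n + 1)) (φ w) +
          dist (g (φ z) • e) (g (φ w) • e) := dist_add_add_le _ _ _ _
      _ = dist z w + dist (g (φ z)) (g (φ w)) := by
        rw [hφd, dist_eq_norm (g (φ z) • e), ← sub_smul, norm_smul, he, mul_one, ← dist_eq_norm]
      _ ≤ dist z w + L * dist z w := by gcongr
      _ = _ := by push_cast; ring
  set z₀ : E n := φ.symm ⟨horizontal e x, hmem x⟩ with hz₀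
  have hsub : S ∩ Metric.ball x t ⊆ Ψ '' Metric.closedBall z₀ (2 * t) := by
    rintro y ⟨hyS, hy⟩
    refine ⟨φ.symm ⟨horizontal e y, hmem y⟩, ?_, ?_⟩
    · rw [Metric.mem_closedBall, hz₀, φ.symm.dist_map, Subtype.dist_eq]
      refine (dist_horizontal_le he y x).trans ?_
      have := Metric.mem_ball.1 hy
      gcongr
    · simp only [hΨ, φ.apply_symm_apply]
      rw [hS y hyS, horizontal, sub_add_cancel]
  refine (measure_mono hsub).trans ((hΨL.euclideanHausdorffMeasure_image_le n _).trans ?_)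
  rw [EuclideanSpace.euclideanHausdorffMeasure_eq_volume,
    Measure.addHaar_closedBall volume _ (by positivity), finrank_euclideanSpace_fin]
  have h0 : volume (Metric.ball (0 : E n) 1) =
      ENNReal.ofReal (volume.real (Metric.ball (0 : E n) 1)) :=
    (ENNReal.ofReal_toReal measure_ball_lt_top.ne).symm
  have h1 : ((1 + L : NNReal) : ENNReal) ^ n = ENNReal.ofReal ((1 + L) ^ n) := by
    rw [ENNReal.ofReal_pow (by positivity)]
    congr 1
    rw [← ENNReal.ofReal_coe_nnreal]
    push_cast
    rfl
  rw [h0, h1, ← ENNReal.ofReal_mul (by positivity), ← ENNReal.ofReal_mul (by positivity)]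
  apply ENNReal.ofReal_le_ofReal
  rw [mul_pow]
  apply le_of_eq
  ring

theorem IsLipschitzDomain.surfaceMeasure_ball_le (hd : 2 ≤ d) (hω : IsLipschitzDomain ω) :
    ∃ C : ℝ, 0 < C ∧ ∀ (x : E d) (t : ℝ), 0 < t →
      surfaceMeasure (frontier ω) (Metric.ball x t) ≤ ENNReal.ofReal (C * t ^ (d - 1)) := by
  obtain ⟨n, rfl⟩ : ∃ n, d = n + 1 := ⟨d - 1, by omega⟩
  have hchart := fun p (hp : p ∈ frontier ω) => hω.exists_graph hp
  choose! e ρ L g he hρ hg hgraph using hchart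
  obtain ⟨t, htω, ht⟩ := hω.isCompact_frontier.elim_nhds_subcover (fun p => Metric.ball p (ρ p))
    fun p hp => Metric.ball_mem_nhds p (hρ p hp)
  refine ⟨∑ p ∈ t, (1 + L p) ^ n * 2 ^ n * volume.real (Metric.ball (0 : E n) 1) + 1, ?_, ?_⟩
  · positivity
  intro x r hr
  rw [surfaceMeasure, Nat.add_sub_cancel, Measure.restrict_apply Metric.isOpen_ball.measurableSet]
  have hsub : Metric.ball x r ∩ frontier ω ⊆
      ⋃ p ∈ t, (frontier ω ∩ Metric.ball p (ρ p)) ∩ Metric.ball x r := by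
    rintro y ⟨hyx, hy⟩
    obtain ⟨p, hp, hyp⟩ := mem_iUnion₂.1 (ht hy)
    exact mem_biUnion hp ⟨⟨hy, hyp⟩, hyx⟩
  calc _ ≤ _ := measure_mono hsub
    _ ≤ ∑ p ∈ t, Measure.euclideanHausdorffMeasure n
        ((frontier ω ∩ Metric.ball p (ρ p)) ∩ Metric.ball x r) := measure_biUnion_finset_le _ _
    _ ≤ ∑ p ∈ t, ENNReal.ofReal ((1 + L p) ^ n * 2 ^ n *
        volume.real (Metric.ball (0 : E n) 1) * r ^ n) :=
        Finset.sum_le_sum fun p hp => hausdorffMeasure_graph_inter_ball_le n (he p (htω p hp))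
          (hg p (htω p hp)) (hgraph p (htω p hp)) x hr
    _ = ENNReal.ofReal (∑ p ∈ t, (1 + L p) ^ n * 2 ^ n *
        volume.real (Metric.ball (0 : E n) 1) * r ^ n) :=
        (ENNReal.ofReal_sum_of_nonneg fun p _ => by positivity).symm
    _ ≤ _ := by
        apply ENNReal.ofReal_le_ofReal
        rw [← Finset.sum_mul]
        gcongr
        linarith

theorem IsLipschitzDomain.isFiniteMeasure_surfaceMeasure (hd : 2 ≤ d) (hω : IsLipschitzDomain ω) :
    IsFiniteMeasure (surfaceMeasure (frontier ω)) := by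
  obtain ⟨C, -, hC⟩ := hω.surfaceMeasure_ball_le hd
  obtain ⟨R, hR⟩ := hω.isCompact_frontier.isBounded.subset_ball 0
  refine ⟨?_⟩
  have h1 : surfaceMeasure (frontier ω) univ ≤
      surfaceMeasure (frontier ω) (Metric.ball 0 (max R 1)) := by
    rw [surfaceMeasure, Measure.restrict_apply MeasurableSet.univ,
      Measure.restrict_apply Metric.isOpen_ball.measurableSet, univ_inter]
    exact measure_mono fun x hx => ⟨Metric.ball_subset_ball (le_max_left _ _) (hR hx), hx⟩
  exact h1.trans_lt ((hC 0 _ (by positivity)).trans_lt ENNReal.ofReal_lt_top)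
end

noncomputable section

/-! ### The regularized data -/

variable {d : ℕ} {ω : Set (E d)} {k : ℕ} {ψ : E d → ℝ}

/-- The profile `ψ` is controlled only up to null sets of `ℝ^d`, while the surface measure is
singular. For fixed `y` the preimage of a null set is null in `x`, and integrating over `y` last
keeps it null. -/
theorem quasiMeasurePreserving_smul_sub (σ : Measure (E d)) [SFinite σ] {r : ℝ} (hr : r ≠ 0) :
    Measure.QuasiMeasurePreserving (fun p : E d × E d => r • (p.2 - p.1))
      ((volume : Measure (E d)).prod σ) volume := by
  have hm : Measurable fun p : E d × E d => r • (p.2 - p.1) := by fun_prop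
  refine ⟨hm, ?_⟩
  refine Measure.AbsolutelyContinuous.mk fun N hN hN0 => ?_
  rw [Measure.map_apply hm hN, ← Measure.prod_swap, Measure.map_apply measurable_swap (hm hN),
    Measure.measure_prod_null (measurable_swap (hm hN))]
  refine Filter.Eventually.of_forall fun y => ?_
  have h1 : volume ((fun x : E d => r • x) ⁻¹' N) = 0 := by
    rw [Measure.addHaar_preimage_smul volume hr, hN0, mul_zero]
  exact (quasiMeasurePreserving_sub_left (volume : Measure (E d)) y).preimage_null h1

theorem ae_abs_le_normLinfty {γ : Set (E d)} {f : E d → ℝ} (hf : MemLp f ⊤ (surfaceMeasure γ)) :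
    ∀ᵐ y ∂surfaceMeasure γ, |f y| ≤ normLinfty γ f := by
  have h : ∀ᵐ y ∂surfaceMeasure γ, ‖f y‖ₑ ≤ eLpNorm f ⊤ (surfaceMeasure γ) := by
    rw [eLpNorm_exponent_top]; exact enorm_ae_le_eLpNormEssSup f _
  filter_upwards [h] with y hy
  have := ENNReal.toReal_mono hf.eLpNorm_lt_top.ne hy
  rwa [toReal_enorm] at this

theorem normLinfty_nonneg (γ : Set (E d)) (f : E d → ℝ) : 0 ≤ normLinfty γ f :=
  ENNReal.toReal_nonneg

/-- The regularized data are measurable, of size `‖f‖ / r`, and supported in a neighbourhood of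
the interface of width proportional to `r`. -/
theorem IsMollifier.regData_bounds (hd : 2 ≤ d) (hω : IsLipschitzDomain ω)
    (hψ : IsMollifier k ψ) : ∃ A₀ r₀ : ℝ, 0 < A₀ ∧ 0 < r₀ ∧
      ∀ f : E d → ℝ, MemLp f ⊤ (surfaceMeasure (frontier ω)) → ∀ r : ℝ, 0 < r →
        AEStronglyMeasurable (regData ψ (frontier ω) f r) volume ∧
        (∀ᵐ x, |regData ψ (frontier ω) f r x| ≤ A₀ * normLinfty (frontier ω) f / r) ∧
        ∀ x, x ∉ Metric.thickening (r₀ * r) (frontier ω) → regData ψ (frontier ω) f r x = 0 := by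
  have := hω.isFiniteMeasure_surfaceMeasure hd
  obtain ⟨C, hC, hball⟩ := hω.surfaceMeasure_ball_le hd
  obtain ⟨r₀, hr₀, hsupp⟩ := hψ.support
  set M := (eLpNorm ψ ⊤ volume).toReal with hM
  have hM0 : 0 ≤ M := ENNReal.toReal_nonneg
  have hψM : ∀ᵐ z, |ψ z| ≤ M := by
    have h : ∀ᵐ z, ‖ψ z‖ₑ ≤ eLpNorm ψ ⊤ volume := by
      rw [eLpNorm_exponent_top]; exact enorm_ae_le_eLpNormEssSup ψ _
    filter_upwards [h] with y hy
    have := ENNReal.toReal_mono hψ.memLp.eLpNorm_lt_top.ne hy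
    rwa [toReal_enorm] at this
  have hzero : ∀ r : ℝ, 0 < r → ∀ x y : E d, y ∉ Metric.ball x (r₀ * r) →
      diracApprox ψ r (y - x) = 0 := by
    intro r hr x y hy
    have h1 : r⁻¹ • (y - x) ∉ tsupport ψ := by
      intro h
      have h2 := mem_ball_zero_iff.1 (hsupp h)
      rw [norm_smul, norm_inv, Real.norm_of_nonneg hr.le, inv_mul_lt_iff₀ hr, ← dist_eq_norm,
        mul_comm] at h2
      exact hy h2
    rw [diracApprox, image_eq_zero_of_notMem_tsupport h1, mul_zero]
  -- `M + 1` instead of `M` makes the constant positive without an argument that `ψ` is not zero.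
  refine ⟨(M + 1) * C * r₀ ^ (d - 1), r₀, by positivity, hr₀, ?_⟩
  intro f hf r hr
  have hq := quasiMeasurePreserving_smul_sub (surfaceMeasure (frontier ω)) (inv_ne_zero hr.ne')
  refine ⟨?_, ?_, ?_⟩
  · have h1 : AEStronglyMeasurable (fun p : E d × E d => f p.2 * diracApprox ψ r (p.2 - p.1))
        ((volume : Measure (E d)).prod (surfaceMeasure (frontier ω))) := by
      refine hf.1.comp_snd.mul ?_
      exact (hψ.memLp.1.comp_quasiMeasurePreserving hq).const_mul _
    exact h1.integral_prod_right'
  · filter_upwards [Measure.ae_ae_of_ae_prod (hq.ae hψM)] with x hx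
    have hF := normLinfty_nonneg (frontier ω) f
    set F := normLinfty (frontier ω) f with hFdef
    set b : E d → ℝ := (Metric.ball x (r₀ * r)).indicator fun _ => F * ((r ^ d)⁻¹ * M) with hb
    have hbm : MeasurableSet (Metric.ball x (r₀ * r)) := Metric.isOpen_ball.measurableSet
    have hbi : Integrable b (surfaceMeasure (frontier ω)) :=
      (integrable_const _).indicator hbm
    have hle : ∀ᵐ y ∂surfaceMeasure (frontier ω), ‖f y * diracApprox ψ r (y - x)‖ ≤ b y := by
      filter_upwards [hx, ae_abs_le_normLinfty hf] with y hy hfy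
      by_cases hyx : y ∈ Metric.ball x (r₀ * r)
      · rw [hb, indicator_of_mem hyx, norm_mul, Real.norm_eq_abs, diracApprox, norm_mul,
          Real.norm_of_nonneg (by positivity), Real.norm_eq_abs]
        gcongr
      · rw [hb, indicator_of_notMem hyx, hzero r hr x y hyx]
        simp
    have h1 := norm_integral_le_of_norm_le hbi hle
    rw [integral_indicator hbm, setIntegral_const, smul_eq_mul] at h1
    have h2 : (surfaceMeasure (frontier ω)).real (Metric.ball x (r₀ * r)) ≤
        C * (r₀ * r) ^ (d - 1) :=
      ENNReal.toReal_le_of_le_ofReal (by positivity) (hball x _ (by positivity))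
    have h3 : r ^ d = r ^ (d - 1) * r := by
      rw [← pow_succ]; congr 1; omega
    calc |regData ψ (frontier ω) f r x| ≤ _ := h1
      _ ≤ C * (r₀ * r) ^ (d - 1) * (F * ((r ^ d)⁻¹ * M)) := by gcongr
      _ = M * C * r₀ ^ (d - 1) * F / r := by
        rw [h3, mul_pow]
        field_simp
      _ ≤ (M + 1) * C * r₀ ^ (d - 1) * F / r := by
        gcongr
        linarith
  · intro x hx
    refine setIntegral_eq_zero_of_forall_eq_zero fun y hy => ?_
    rw [hzero r hr x y, mul_zero]
    intro hyx
    exact hx (Metric.mem_thickening_iff.2 ⟨y, hy, by rw [dist_comm]; exact hyx⟩)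

theorem cellSize_nonneg (T : Set (E d)) : 0 ≤ cellSize T := by unfold cellSize; positivity

theorem cellSize_pow (hd : 2 ≤ d) (T : Set (E d)) : cellSize T ^ d = volume.real T := by
  rw [cellSize, ← Real.rpow_natCast, ← Real.rpow_mul measureReal_nonneg, one_div,
    inv_mul_cancel₀ (by positivity), Real.rpow_one]

theorem localIndicator_nonneg (g : E d → ℝ) (T : Set (E d)) : 0 ≤ localIndicator g T :=
  mul_nonneg (cellSize_nonneg T) ENNReal.toReal_nonneg

theorem localIndicator_sq_le (hd : 2 ≤ d) {g : E d → ℝ} {A : ℝ} (hA : 0 ≤ A)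
    (hg : ∀ᵐ x, |g x| ≤ A) {T : Set (E d)} (hT : IsCompact T) :
    localIndicator g T ^ 2 ≤ A ^ 2 * cellSize T ^ (d + 2) := by
  have h1 : eLpNorm g 2 (volume.restrict T) ≤
      volume T ^ (2 : ENNReal).toReal⁻¹ * ENNReal.ofReal A := by
    have := eLpNorm_le_of_ae_bound (p := 2) (μ := volume.restrict T) (f := g) (C := A)
      (ae_restrict_of_ae hg)
    rwa [Measure.restrict_apply_univ] at this
  have h2 : (eLpNorm g 2 (volume.restrict T)).toReal ≤ √(volume.real T) * A := by
    have h3 : volume T ^ (2 : ENNReal).toReal⁻¹ * ENNReal.ofReal A ≠ ⊤ :=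
      ENNReal.mul_ne_top (ENNReal.rpow_ne_top_of_nonneg (by positivity) hT.measure_lt_top.ne)
        ENNReal.ofReal_ne_top
    have h4 := ENNReal.toReal_mono h3 h1
    rw [ENNReal.toReal_mul, ← ENNReal.toReal_rpow, ENNReal.toReal_ofReal hA] at h4
    have h5 : (2 : ENNReal).toReal⁻¹ = 1 / 2 := by norm_num
    rw [h5] at h4
    rw [Real.sqrt_eq_rpow]
    exact h4
  calc localIndicator g T ^ 2 ≤ (cellSize T * (√(volume.real T) * A)) ^ 2 := by
        rw [localIndicator]
        have := cellSize_nonneg T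
        gcongr
    _ = A ^ 2 * cellSize T ^ (d + 2) := by
        rw [mul_pow, mul_pow, Real.sq_sqrt measureReal_nonneg, ← cellSize_pow hd T]
        ring

theorem localIndicator_eq_zero {g : E d → ℝ} {T : Set (E d)} (hT : MeasurableSet T)
    (hg : ∀ x ∈ T, g x = 0) : localIndicator g T = 0 := by
  have : eLpNorm g 2 (volume.restrict T) = 0 := by
    rw [← eLpNorm_zero (p := 2) (μ := volume.restrict T) (α := E d) (ε := ℝ)]
    exact eLpNorm_congr_ae ((ae_restrict_iff' hT).2 (Filter.Eventually.of_forall hg))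
  rw [localIndicator, this, ENNReal.toReal_zero, mul_zero]

theorem dataIndicator_sq (g : E d → ℝ) (𝒯 : Mesh d) :
    dataIndicator g 𝒯 ^ 2 = ∑ T ∈ 𝒯, localIndicator g T ^ 2 :=
  Real.sq_sqrt (Finset.sum_nonneg fun _ _ => sq_nonneg _)

theorem dataIndicator_nonneg (g : E d → ℝ) (𝒯 : Mesh d) : 0 ≤ dataIndicator g 𝒯 :=
  Real.sqrt_nonneg _
end

noncomputable section

/-! ### Sizes of cells near the interface -/

variable {d : ℕ}

/-- The size of the unit ball. -/
def unitSize (d : ℕ) : ℝ := cellSize (Metric.ball (0 : E d) 1)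

theorem unitSize_pos (d : ℕ) : 0 < unitSize d :=
  Real.rpow_pos_of_pos (ENNReal.toReal_pos (Metric.measure_ball_pos volume _ one_pos).ne'
    measure_ball_lt_top.ne) _

theorem volume_real_closedBall (hd : 2 ≤ d) (x : E d) {s : ℝ} (hs : 0 ≤ s) :
    volume.real (Metric.closedBall x s) = (unitSize d * s) ^ d := by
  rw [measureReal_def, Measure.addHaar_closedBall volume _ hs, finrank_euclideanSpace_fin,
    ENNReal.toReal_mul, ENNReal.toReal_ofReal (by positivity), mul_pow, unitSize, cellSize_pow hd,
    measureReal_def, mul_comm]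

theorem cellSize_mono {T P : Set (E d)} (hP : volume P ≠ ⊤) (h : T ⊆ P) :
    cellSize T ≤ cellSize P :=
  Real.rpow_le_rpow measureReal_nonneg (measureReal_mono h hP) (by positivity)

theorem cellSize_pos {T : Set (E d)} (h : 0 < volume.real T) : 0 < cellSize T :=
  Real.rpow_pos_of_pos h _

theorem IsShapeRegular.diam_le (hd : 2 ≤ d) {c : ℝ} {T : Set (E d)} (h : IsShapeRegular c T)
    (hT : IsCompact T) : Metric.diam T ≤ 2 * |c| / unitSize d * cellSize T := by
  obtain ⟨x, s, hs, hball, hdiam⟩ := h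
  have hu := unitSize_pos d
  have h1 : (unitSize d * s) ^ d ≤ cellSize T ^ d := by
    rw [← volume_real_closedBall hd x hs.le, cellSize_pow hd]
    exact measureReal_mono hball hT.measure_lt_top.ne
  have h2 : unitSize d * s ≤ cellSize T :=
    (pow_le_pow_iff_left₀ (by positivity) (cellSize_nonneg T) (by omega)).1 h1
  calc Metric.diam T ≤ c * (2 * s) := hdiam
    _ ≤ |c| * (2 * s) := by gcongr; exact le_abs_self c
    _ = 2 * |c| / unitSize d * (unitSize d * s) := by field_simp
    _ ≤ _ := by gcongr

theorem cellSize_le_diam (hd : 2 ≤ d) {T : Set (E d)} (hT : IsCompact T) (hne : T.Nonempty) :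
    cellSize T ≤ unitSize d * Metric.diam T := by
  obtain ⟨x, hx⟩ := hne
  have hu := unitSize_pos d
  have hsub : T ⊆ Metric.closedBall x (Metric.diam T) := fun y hy =>
    Metric.mem_closedBall.2 (Metric.dist_le_diam_of_mem hT.isBounded hy hx)
  have hD : 0 ≤ Metric.diam T := Metric.diam_nonneg
  refine (pow_le_pow_iff_left₀ (cellSize_nonneg T) (by positivity)
    (by omega : d ≠ 0)).1 ?_
  rw [← volume_real_closedBall hd x hD, cellSize_pow hd]
  exact measureReal_mono hsub (isCompact_closedBall _ _).measure_lt_top.ne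

variable {Ω ω : Set (E d)} {cΩ : ℝ}

/-- The point `y` lies in `Ω`, since otherwise it would be on both frontiers. A ball that meets `Ω`
but not its frontier is inside, by connectedness. -/
theorem ball_subset_of_dist_frontier (hΩ : IsOpen Ω) (hωΩ : ω ⊆ Ω) (hcΩ : 0 < cΩ)
    (hdist : ∀ x ∈ frontier ω, ∀ y ∈ frontier Ω, cΩ < dist x y) {y : E d}
    (hy : y ∈ frontier ω) : Metric.ball y cΩ ⊆ Ω := by
  have hyΩ : y ∈ Ω := by
    by_contra h
    have h1 : y ∈ frontier Ω := by
      rw [hΩ.frontier_eq]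
      exact ⟨closure_mono hωΩ (frontier_subset_closure hy), h⟩
    have := hdist y hy y h1
    rw [dist_self] at this
    exact lt_asymm this hcΩ
  by_contra h
  rw [not_subset] at h
  obtain ⟨z, hz, hzΩ⟩ := h
  have hconn : IsPreconnected (Metric.ball y cΩ) := (convex_ball y cΩ).isPreconnected
  obtain ⟨w, hw, hwΩ⟩ : (Metric.ball y cΩ ∩ frontier Ω).Nonempty := by
    by_contra hne
    rw [not_nonempty_iff_eq_empty] at hne
    obtain ⟨w, hw, hw1, hw2⟩ := hconn Ω (closure Ω)ᶜ hΩ isClosed_closure.isOpen_compl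
      (fun w hw => by
        by_cases h1 : w ∈ Ω
        · exact Or.inl h1
        · refine Or.inr fun h2 => ?_
          have : w ∈ Metric.ball y cΩ ∩ frontier Ω := ⟨hw, by rw [hΩ.frontier_eq]; exact ⟨h2, h1⟩⟩
          rwa [hne] at this)
      ⟨y, Metric.mem_ball_self hcΩ, hyΩ⟩
      ⟨z, hz, fun h2 => by
        have : z ∈ Metric.ball y cΩ ∩ frontier Ω := ⟨hz, by rw [hΩ.frontier_eq]; exact ⟨h2, hzΩ⟩⟩
        rwa [hne] at this⟩
    exact hw2 (subset_closure hw1)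
  have h1 := hdist y hy w hwΩ
  rw [dist_comm] at h1
  exact lt_asymm h1 (Metric.mem_ball.1 hw)

theorem IsShapeRegular.mono {c c' : ℝ} (h : c ≤ c') {T : Set (E d)} (hT : IsShapeRegular c T) :
    IsShapeRegular c' T := by
  obtain ⟨x, s, hs, hb, hdiam⟩ := hT
  exact ⟨x, s, hs, hb, hdiam.trans (by gcongr)⟩

namespace RefinementStrategy

variable {R : RefinementStrategy d} {q : ℕ} {c Λ κ : ℝ}

/-- If the cells which touch the interface have size at most `r / 2`, then the cells in a
neighbourhood of the interface of width proportional to `r` have diameter at most `C r`. -/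
theorem IsAdmissible.exists_diam_le (hd : 2 ≤ d) (hΩ : IsLipschitzDomain Ω) (hωΩ : ω ⊆ Ω)
    (hcΩ : 0 < cΩ) (hdist : ∀ x ∈ frontier ω, ∀ y ∈ frontier Ω, cΩ < dist x y)
    (hR : R.IsAdmissible Ω q c Λ κ) {r₀ : ℝ} (hr₀ : 0 < r₀) : ∃ C : ℝ, 0 < C ∧
      ∀ r : ℝ, 0 < r → ∀ 𝒯, R.IsGenerated 𝒯 →
        (∀ T ∈ touching (frontier ω) 𝒯, cellSize T ≤ r / 2) →
        ∀ T ∈ 𝒯, ∀ x ∈ T, x ∈ Metric.thickening (r₀ * r) (frontier ω) →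
          Metric.diam T ≤ C * r := by
  set D := 2 * |c| / unitSize d with hD
  have hD0 : 0 ≤ D := div_nonneg (by positivity) (unitSize_pos d).le
  have hdiam : ∀ 𝒯, R.IsGenerated 𝒯 → ∀ T ∈ 𝒯, Metric.diam T ≤ D * cellSize T :=
    fun 𝒯 h𝒯 T hT => (hR.shapeRegular 𝒯 h𝒯 T hT).diam_le hd ((h𝒯.isSound hR).isCompact T hT)
  have hcell : ∀ 𝒯, R.IsGenerated 𝒯 → ∀ y ∈ frontier ω, ∃ T ∈ 𝒯, y ∈ T := by
    intro 𝒯 h𝒯 y hy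
    have h1 : y ∈ closure Ω := closure_mono hωΩ (frontier_subset_closure hy)
    rw [← (h𝒯.isSound hR).cover] at h1
    simpa using h1
  have htouch : ∀ (𝒯 : Mesh d), ∀ y ∈ frontier ω, ∀ T ∈ 𝒯, y ∈ T → T ∈ touching (frontier ω) 𝒯 :=
    fun 𝒯 y hy T hT hyT => by classical exact Finset.mem_filter.2 ⟨hT, ⟨y, hyT, hy⟩⟩
  rcases hR.structured with hconf | hgrad
  · obtain ⟨K, hK, hKmain⟩ :=
      IsConformingSimplicial.diam_le_of_dist_le (c := max c 1) hd (le_max_right _ _)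
    -- With `δ = m r` both the distance from `x` to `y` and the diameter of the touching cell at `y`
    -- are at most `δ`.
    set m := r₀ + D with hm
    have hm0 : 0 < m := by positivity
    have hdΩ : 0 ≤ Metric.diam (closure Ω) := Metric.diam_nonneg
    refine ⟨K * m + Metric.diam (closure Ω) * (K * m) / cΩ, by positivity, ?_⟩
    intro r hr 𝒯 h𝒯 hsmall T hT x hxT hx
    obtain ⟨y, hy, hxy⟩ := Metric.mem_thickening_iff.1 hx
    obtain ⟨T', hT', hyT'⟩ := hcell 𝒯 h𝒯 y hy
    have hs := h𝒯.isSound hR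
    -- If the ball of radius `K m r` may leave the domain, then `r` is bounded from below, and the
    -- diameter of the domain serves as the bound.
    rcases le_or_gt (K * (m * r)) cΩ with h1 | h1
    · have h2 : Metric.diam T ≤ K * (m * r) := by
        refine hKmain Ω 𝒯 (hconf 𝒯 h𝒯)
          (fun S hS => (hR.shapeRegular 𝒯 h𝒯 S hS).mono (le_max_left _ _)) hΩ.isOpen hs.cover
          hs.overlap y x (m * r) (by positivity)
          ((Metric.ball_subset_ball h1).trans
            (ball_subset_of_dist_frontier hΩ.isOpen hωΩ hcΩ hdist hy)) ?_ T hT T' hT' hxT hyT' ?_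
        · exact hxy.le.trans (by gcongr; linarith)
        · calc Metric.diam T' ≤ D * cellSize T' := hdiam 𝒯 h𝒯 T' hT'
            _ ≤ D * (r / 2) := by gcongr; exact hsmall T' (htouch 𝒯 y hy T' hT' hyT')
            _ ≤ D * r := by gcongr; linarith
            _ ≤ m * r := by gcongr; linarith
      have h3 : 0 ≤ Metric.diam (closure Ω) * (K * m) / cΩ * r := by positivity
      linarith
    · have h2 : Metric.diam T ≤ Metric.diam (closure Ω) :=
        Metric.diam_mono (hs.subset hT) hΩ.isBounded.closure
      have h3 : Metric.diam (closure Ω) ≤ Metric.diam (closure Ω) * (K * m) / cΩ * r := by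
        have h4 : 1 ≤ K * m * r / cΩ := by
          rw [one_le_div hcΩ]; linarith
        calc _ ≤ Metric.diam (closure Ω) * (K * m * r / cΩ) := le_mul_of_one_le_right hdΩ h4
          _ = _ := by ring
      have h5 : 0 ≤ K * m * r := by positivity
      linarith
  · refine ⟨D * (|κ| * (r₀ + 1)) + 1, by positivity, ?_⟩
    intro r hr 𝒯 h𝒯 hsmall T hT x hxT hx
    obtain ⟨y, hy, hxy⟩ := Metric.mem_thickening_iff.1 hx
    obtain ⟨T', hT', hyT'⟩ := hcell 𝒯 h𝒯 y hy
    have h1 : cellSize T ≤ |κ| * (r₀ + 1) * r := by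
      rcases le_or_gt (κ * dist x y) (cellSize T) with h | h
      · calc cellSize T ≤ κ * cellSize T' := hgrad 𝒯 h𝒯 T hT T' hT' x hxT y hyT' h
          _ ≤ |κ| * (r / 2) := by
            refine mul_le_mul (le_abs_self κ) (hsmall T' (htouch 𝒯 y hy T' hT' hyT'))
              (cellSize_nonneg _) (abs_nonneg _)
          _ ≤ |κ| * ((r₀ + 1) * r) := by gcongr; nlinarith
          _ = _ := by ring
      · calc cellSize T ≤ κ * dist x y := h.le
          _ ≤ |κ| * (r₀ * r) := by
            refine mul_le_mul (le_abs_self κ) hxy.le dist_nonneg (abs_nonneg _)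
          _ ≤ |κ| * ((r₀ + 1) * r) := by gcongr; linarith
          _ = _ := by ring
    calc Metric.diam T ≤ D * cellSize T := hdiam 𝒯 h𝒯 T hT
      _ ≤ D * (|κ| * (r₀ + 1) * r) := by gcongr
      _ ≤ _ := by nlinarith

/-- The number of cells which are marked by `INTERFACE`. -/
theorem IsAdmissible.exists_interface_marked_le (hd : 2 ≤ d) (hΩ : IsLipschitzDomain Ω)
    (hω : IsLipschitzDomain ω) (hR : R.IsAdmissible Ω q c Λ κ) : ∃ C : ℝ, 0 < C ∧
      ∀ r : ℝ, 0 < r → ∀ 𝒯 m, R.Run (fun 𝒮 M => M = interfaceMarked (frontier ω) r 𝒮)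
        R.initial 𝒯 m → (m : ℝ) ≤ C / r ^ (d - 1) := by
  classical
  obtain ⟨C₂, hC₂, hthick⟩ := hω.volume_thickening_le hΩ.isBounded.closure
  set D := 2 * |c| / unitSize d + 1 with hD
  have hD0 : 0 < D := add_pos_of_nonneg_of_pos (div_nonneg (by positivity) (unitSize_pos d).le)
    one_pos
  have hq := hR.q_pos
  have hΩc : IsCompact (closure Ω) := hΩ.isBounded.isCompact_closure
  refine ⟨2 * (q * 2 ^ d * (C₂ * D) * 2), by positivity, ?_⟩
  intro r hr 𝒯 m hrun
  -- `N` exceeds the dyadic level of every possible cell, because cells lie in the closure of the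
  -- domain.
  obtain ⟨N, hN⟩ := pow_unbounded_of_one_lt (cellSize (closure Ω) / (r / 2)) (one_lt_two (α := ℝ))
  -- One density for each dyadic size: a touching cell of size about `2 ^ k * r` lies in the `k`-th
  -- strip, where the density is at least `q / |T|`.
  set a : E d → ℝ := fun x => ∑ k ∈ Finset.range N,
    (Metric.thickening (D * (2 ^ k * r)) (frontier ω)).indicator
      (fun _ => q * 2 ^ d / (2 ^ k * r) ^ d) x with ha
  have hmeas : ∀ k : ℕ, MeasurableSet (Metric.thickening (D * (2 ^ k * r)) (frontier ω)) :=
    fun k => Metric.isOpen_thickening.measurableSet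
  have hterm : ∀ k : ℕ, IntegrableOn
      ((Metric.thickening (D * (2 ^ k * r)) (frontier ω)).indicator
        (fun _ => q * 2 ^ d / (2 ^ k * r) ^ d)) (closure Ω) := fun k =>
    (integrableOn_const hΩc.measure_lt_top.ne).indicator (hmeas k)
  have hai : IntegrableOn a (closure Ω) := integrable_finsetSum _ fun k _ => hterm k
  have hterm0 : ∀ (k : ℕ) x, 0 ≤ (Metric.thickening (D * (2 ^ k * r)) (frontier ω)).indicator
      (fun _ => q * 2 ^ d / (2 ^ k * r) ^ d) x := fun k x =>
    indicator_nonneg (fun _ _ => by positivity) x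
  have hcount := hrun.le_integral hR Relation.ReflTransGen.refl hai
    (fun x => Finset.sum_nonneg fun k _ => hterm0 k x) ?_
  · refine hcount.trans ?_
    have h1 : ∫ x in closure Ω, a x ≤
        ∑ k ∈ Finset.range N, q * 2 ^ d * (C₂ * D) / r ^ (d - 1) * (1 / 2) ^ k := by
      rw [ha, integral_finsetSum _ fun k _ => hterm k]
      refine Finset.sum_le_sum fun k _ => ?_
      rw [integral_indicator (hmeas k), Measure.restrict_restrict (hmeas k), setIntegral_const,
        smul_eq_mul]
      have h2 := hthick (D * (2 ^ k * r)) (by positivity)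
      -- Here `d ≥ 2` enters: strip volume times density decays at least like `2 ^ (-k)`, so the sum
      -- over the levels is bounded.
      have h3 : ((2 : ℝ) ^ k) ^ 2 ≤ (2 ^ k) ^ d :=
        pow_le_pow_right₀ (one_le_pow₀ one_le_two) hd
      have h4 : r ^ d = r ^ (d - 1) * r := by rw [← pow_succ]; congr 1; omega
      calc _ ≤ C₂ * (D * (2 ^ k * r)) * (q * 2 ^ d / (2 ^ k * r) ^ d) := by gcongr
        _ = q * 2 ^ d * (C₂ * D) / r ^ (d - 1) * (2 ^ k / (2 ^ k) ^ d) := by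
          rw [mul_pow, h4]; field_simp
        _ ≤ q * 2 ^ d * (C₂ * D) / r ^ (d - 1) * (2 ^ k / (2 ^ k) ^ 2) := by gcongr
        _ = q * 2 ^ d * (C₂ * D) / r ^ (d - 1) * (1 / 2) ^ k := by
          rw [one_div, inv_pow]; field_simp
    rw [← Finset.mul_sum] at h1
    have h5 : ∑ k ∈ Finset.range N, (1 / 2 : ℝ) ^ k ≤ 2 := by
      exact sum_geometric_two_le N
    calc 2 * ∫ x in closure Ω, a x ≤ 2 * (q * 2 ^ d * (C₂ * D) / r ^ (d - 1) * 2) := by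
          gcongr
          exact h1.trans (by gcongr)
      _ = _ := by ring
  · rintro 𝒮 M h𝒮 - hM rfl
    have hs := h𝒮.isSound hR
    have : (interfaceMarked (frontier ω) r 𝒮).filter
        (fun T => ∀ x ∈ T, q / volume.real T ≤ a x) = interfaceMarked (frontier ω) r 𝒮 := by
      refine Finset.filter_true_of_mem fun T hT x hx => ?_
      obtain ⟨hTt, hTr⟩ := Finset.mem_filter.1 hT
      obtain ⟨hTS, y, hyT, hy⟩ := Finset.mem_filter.1 hTt
      have hr2 : 0 < r / 2 := by positivity
      obtain ⟨k, hk1, hk2⟩ := exists_nat_pow_near ((one_le_div hr2).2 hTr.le) one_lt_two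
      rw [le_div_iff₀ hr2] at hk1
      rw [div_lt_iff₀ hr2, pow_succ] at hk2
      have hkN : k ∈ Finset.range N := by
        have h1 : (2 : ℝ) ^ k ≤ cellSize (closure Ω) / (r / 2) := by
          rw [le_div_iff₀ hr2]
          exact hk1.trans (cellSize_mono hΩc.measure_lt_top.ne (hs.subset hTS))
        rw [Finset.mem_range]
        exact (pow_lt_pow_iff_right₀ one_lt_two).1 (h1.trans_lt hN)
      have hxth : x ∈ Metric.thickening (D * (2 ^ k * r)) (frontier ω) := by
        refine Metric.mem_thickening_iff.2 ⟨y, hy, ?_⟩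
        have h1 := Metric.dist_le_diam_of_mem (hs.isCompact T hTS).isBounded hx hyT
        have h2 := (hR.shapeRegular 𝒮 h𝒮 T hTS).diam_le hd (hs.isCompact T hTS)
        have h3 := cellSize_pos (hs.volume_pos T hTS)
        calc dist x y ≤ 2 * |c| / unitSize d * cellSize T := h1.trans h2
          _ < D * cellSize T := by rw [hD]; linarith
          _ ≤ D * (2 ^ k * r) := by gcongr; linarith
      calc q / volume.real T ≤ q * 2 ^ d / (2 ^ k * r) ^ d := by
            rw [← cellSize_pow hd]
            calc (q : ℝ) / cellSize T ^ d ≤ q / (2 ^ k * (r / 2)) ^ d := by gcongr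
              _ = _ := by
                rw [← mul_div_assoc, div_pow, div_div_eq_mul_div]
        _ = (Metric.thickening (D * (2 ^ k * r)) (frontier ω)).indicator
            (fun _ => q * 2 ^ d / (2 ^ k * r) ^ d) x := (indicator_of_mem hxth (fun _ => (q : ℝ) * 2 ^ d / (2 ^ k * r) ^ d)).symm
        _ ≤ a x := Finset.single_le_sum (f := fun k : ℕ =>
            (Metric.thickening (D * (2 ^ k * r)) (frontier ω)).indicator
              (fun _ => (q : ℝ) * 2 ^ d / (2 ^ k * r) ^ d) x) (fun k _ => hterm0 k x) hkN
    rw [this]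
    omega

end RefinementStrategy
end

noncomputable section

/-! ### Marking strategies -/

variable {d : ℕ}

/-- The cells marked by `GREEDY` carry a large indicator, if a set of cells with small indicators
does not exceed the tolerance. -/
theorem le_sq_of_maximal {g : E d → ℝ} {τ β : ℝ} {𝒯 : Mesh d} {T : Set (E d)} (hτ : 0 < τ)
    (hD : τ < dataIndicator g 𝒯) (hmax : ∀ K ∈ 𝒯, localIndicator g K ≤ localIndicator g T)
    (hsmall : ∀ 𝒰 ⊆ 𝒯, (∀ K ∈ 𝒰, localIndicator g K ^ 2 ≤ β) →
      ∑ K ∈ 𝒰, localIndicator g K ^ 2 ≤ τ ^ 2) : β ≤ localIndicator g T ^ 2 := by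
  by_contra! h
  have h1 := hsmall 𝒯 Finset.Subset.rfl fun K hK =>
    (pow_le_pow_left₀ (localIndicator_nonneg g K) (hmax K hK) 2).trans h.le
  rw [← dataIndicator_sq] at h1
  exact (pow_lt_pow_left₀ hD hτ.le two_ne_zero).not_ge h1

open Classical in
/-- At least half of the cells marked by `DATA` carry a large indicator, if a set of cells with
small indicators does not exceed the tolerance. -/
theorem RefinementStrategy.IsMarked.card_le {g : E d → ℝ} {τ β θ : ℝ} {𝒯 M : Mesh d} (hτ : 0 < τ) (hβ : 0 < β)
    (hθ : 0 < θ) (hθ1 : θ < 1) (hD : τ < dataIndicator g 𝒯)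
    (hM : RefinementStrategy.IsMarked g θ 𝒯 M)
    (hsmall : ∀ 𝒰 ⊆ 𝒯, (∀ K ∈ 𝒰, localIndicator g K ^ 2 ≤ β) →
      ∑ K ∈ 𝒰, localIndicator g K ^ 2 ≤ (1 - θ ^ 2) * τ ^ 2) :
    M.card ≤ 2 * (M.filter fun T => min (θ ^ 2) (1 / 2) * β ≤ localIndicator g T ^ 2).card := by
  obtain ⟨hMT, hMθ, hMmin⟩ := hM
  set e : Set (E d) → ℝ := fun T => localIndicator g T ^ 2 with he
  have he0 : ∀ T, 0 ≤ e T := fun T => sq_nonneg _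
  have hiff : ∀ 𝒮 : Mesh d, θ * dataIndicator g 𝒯 ≤ dataIndicator g 𝒮 ↔
      θ ^ 2 * ∑ T ∈ 𝒯, e T ≤ ∑ T ∈ 𝒮, e T := by
    intro 𝒮
    rw [← dataIndicator_sq, ← dataIndicator_sq, ← mul_pow,
      pow_le_pow_iff_left₀ (mul_nonneg hθ.le (dataIndicator_nonneg g 𝒯))
        (dataIndicator_nonneg g 𝒮) two_ne_zero]
  rw [hiff] at hMθ
  have hE : τ ^ 2 < ∑ T ∈ 𝒯, e T := by
    rw [← dataIndicator_sq]; exact pow_lt_pow_left₀ hD hτ.le two_ne_zero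
  have hθ2 : θ ^ 2 < 1 := by nlinarith
  -- The cells outside `B` carry at most `(1 - θ ^ 2) * τ ^ 2`, so `B` alone satisfies the bulk
  -- criterion and a smallest set is no larger than `B`.
  set B := 𝒯.filter fun T => β ≤ e T with hB
  have hBsum : θ ^ 2 * ∑ T ∈ 𝒯, e T < ∑ T ∈ B, e T := by
    have h1 := Finset.sum_filter_add_sum_filter_not 𝒯 (fun T => β ≤ e T) e
    have h2 := hsmall (𝒯.filter fun T => ¬ β ≤ e T) (Finset.filter_subset _ _)
      fun K hK => (not_le.1 (Finset.mem_filter.1 hK).2).le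
    have h3 : (1 - θ ^ 2) * τ ^ 2 < (1 - θ ^ 2) * ∑ T ∈ 𝒯, e T := by
      gcongr
    linarith
  have hMB : M.card ≤ B.card :=
    hMmin B (Finset.filter_subset _ _) ((hiff B).2 hBsum.le)
  set P := M.filter fun T => min (θ ^ 2) (1 / 2) * β ≤ e T with hP
  set S := M.filter fun T => ¬ min (θ ^ 2) (1 / 2) * β ≤ e T with hS
  have hPS : P.card + S.card = M.card := Finset.card_filter_add_card_filter_not _
  have hSmem : ∀ T ∈ S, T ∈ M ∧ e T < θ ^ 2 * β ∧ e T < β / 2 := by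
    intro T hT
    obtain ⟨h1, h2⟩ := Finset.mem_filter.1 hT
    rw [not_le] at h2
    refine ⟨h1, h2.trans_le ?_, h2.trans_le ?_⟩
    · gcongr; exact min_le_left _ _
    · nlinarith [min_le_right (θ ^ 2) (1 / 2 : ℝ)]
  -- Two weak marked cells together carry less than `β`, so they could be exchanged for one unmarked
  -- cell of `B`, against minimality.
  have hS1 : S.card ≤ 1 := by
    by_contra! h
    obtain ⟨T₁, hT₁, T₂, hT₂, hne⟩ := Finset.one_lt_card.1 h
    obtain ⟨h1M, -, h1⟩ := hSmem T₁ hT₁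
    obtain ⟨h2M, -, h2⟩ := hSmem T₂ hT₂
    obtain ⟨K, hKB, hKM⟩ : ∃ K ∈ B, K ∉ M := by
      by_contra! h3
      have h4 : B = M := Finset.eq_of_subset_of_card_le h3 hMB
      have h5 := (Finset.mem_filter.1 (h4 ▸ h1M)).2
      linarith
    obtain ⟨hK𝒯, hKβ⟩ := Finset.mem_filter.1 hKB
    have hT₂' : T₂ ∈ M.erase T₁ := Finset.mem_erase.2 ⟨hne.symm, h2M⟩
    have hK' : K ∉ (M.erase T₁).erase T₂ := fun h3 =>
      hKM (Finset.mem_of_mem_erase (Finset.mem_of_mem_erase h3))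
    have e1 := Finset.add_sum_erase M e h1M
    have e2 := Finset.add_sum_erase (M.erase T₁) e hT₂'
    have e3 : ∑ T ∈ insert K ((M.erase T₁).erase T₂), e T =
        e K + ∑ T ∈ (M.erase T₁).erase T₂, e T := Finset.sum_insert hK'
    have h6 := hMmin (insert K ((M.erase T₁).erase T₂))
      (Finset.insert_subset hK𝒯
        (((Finset.erase_subset _ _).trans (Finset.erase_subset _ _)).trans hMT))
      ((hiff _).2 (by linarith))
    rw [Finset.card_insert_of_notMem hK', Finset.card_erase_of_mem hT₂',
      Finset.card_erase_of_mem h1M] at h6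
    have h7 := Finset.one_lt_card.2 ⟨T₁, h1M, T₂, h2M, hne⟩
    omega
  -- With at most one weak cell, failure means that the only marked cell is weak. Its squared
  -- indicator is then below `θ ^ 2 * β`, hence below `θ ^ 2` times that of any cell of `B`, which
  -- violates the bulk criterion.
  by_contra! h
  have hM1 : M.card = 1 ∧ P.card = 0 := by omega
  obtain ⟨T, rfl⟩ := Finset.card_eq_one.1 hM1.1
  have hTS : T ∈ S := by
    have : S.card = 1 := by omega
    obtain ⟨T', hT'⟩ := Finset.card_eq_one.1 this
    have h1 : T' ∈ S := by simp [hT']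
    have h2 := Finset.mem_singleton.1 (hSmem T' h1).1
    exact h2 ▸ h1
  obtain ⟨-, h1, -⟩ := hSmem T hTS
  rw [Finset.sum_singleton] at hMθ
  have hBne : B.Nonempty := by
    rw [← Finset.card_pos]; omega
  obtain ⟨K, hK⟩ := hBne
  obtain ⟨hK𝒯, hKβ⟩ := Finset.mem_filter.1 hK
  have h2 : e K ≤ ∑ T ∈ 𝒯, e T := Finset.single_le_sum (fun T _ => he0 T) hK𝒯
  have h3 : θ ^ 2 * β ≤ θ ^ 2 * ∑ T ∈ 𝒯, e T := by gcongr; linarith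
  linarith

theorem exists_isMarked (g : E d → ℝ) {θ : ℝ} (hθ1 : θ ≤ 1) (𝒯 : Mesh d) :
    ∃ M, RefinementStrategy.IsMarked g θ 𝒯 M := by
  classical
  obtain ⟨M, hM, hmin⟩ := Finset.exists_min_image
    (𝒯.powerset.filter fun M => θ * dataIndicator g 𝒯 ≤ dataIndicator g M) Finset.card
    ⟨𝒯, by
      rw [Finset.mem_filter]
      exact ⟨Finset.mem_powerset_self 𝒯, mul_le_of_le_one_left (dataIndicator_nonneg g 𝒯) hθ1⟩⟩
  rw [Finset.mem_filter, Finset.mem_powerset] at hM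
  exact ⟨M, hM.1, hM.2, fun M' h1 h2 =>
    hmin M' (Finset.mem_filter.2 ⟨Finset.mem_powerset.2 h1, h2⟩)⟩

theorem RefinementStrategy.IsMarked.nonempty {g : E d → ℝ} {θ τ : ℝ} {𝒯 M : Mesh d} (hτ : 0 < τ) (hθ : 0 < θ)
    (hD : τ < dataIndicator g 𝒯) (hM : RefinementStrategy.IsMarked g θ 𝒯 M) : M.Nonempty := by
  by_contra h
  rw [Finset.not_nonempty_iff_eq_empty] at h
  have h1 := hM.2.1
  have h2 : 0 < θ * dataIndicator g 𝒯 := mul_pos hθ (hτ.trans hD)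
  have h3 : dataIndicator g ∅ = 0 := by simp [dataIndicator]
  rw [h, h3] at h1
  linarith

theorem exists_maximal_localIndicator (g : E d → ℝ) {τ : ℝ} (hτ : 0 < τ) {𝒯 : Mesh d}
    (hD : τ < dataIndicator g 𝒯) :
    ∃ T ∈ 𝒯, ∀ K ∈ 𝒯, localIndicator g K ≤ localIndicator g T := by
  refine Finset.exists_max_image 𝒯 _ ?_
  by_contra h
  rw [Finset.not_nonempty_iff_eq_empty] at h
  rw [h] at hD
  simp [dataIndicator] at hD
  linarith

/-! ### Runs of loops -/

/-- If every reachable subdivision allowed a further pass, iterating a choice of passes would give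
an infinite run. -/
theorem Terminates.exists_output {step : Mesh d → Mesh d → Prop} {𝒯 : Mesh d}
    (h : Terminates step 𝒯) :
    ∃ 𝒯', Relation.ReflTransGen step 𝒯 𝒯' ∧ ¬ ∃ 𝒯'', step 𝒯' 𝒯'' := by
  by_contra! hne
  choose! F hF using hne
  have hreach : ∀ n : ℕ, Relation.ReflTransGen step 𝒯 (F^[n] 𝒯) := by
    intro n
    induction n with
    | zero => exact Relation.ReflTransGen.refl
    | succ n ih =>
      rw [Function.iterate_succ_apply']
      exact ih.tail (hF _ ih)
  refine h ⟨fun n => F^[n] 𝒯, rfl, fun n => ?_⟩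
  simp only [Function.iterate_succ_apply']
  exact hF _ (hreach n)

namespace RefinementStrategy

variable {R : RefinementStrategy d} {Q step : Mesh d → Mesh d → Prop} {𝒯₀ : Mesh d}

theorem exists_run_of_reflTransGen
    (hstep : ∀ 𝒮 𝒮', step 𝒮 𝒮' → ∃ M ⊆ 𝒮, Q 𝒮 M ∧ 𝒮' = R.refine 𝒮 M) {𝒯 : Mesh d}
    (h : Relation.ReflTransGen step 𝒯₀ 𝒯) : ∃ m, R.Run Q 𝒯₀ 𝒯 m := by
  induction h with
  | refl => exact ⟨0, Run.refl⟩
  | tail _ h2 ih =>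
    obtain ⟨m, hm⟩ := ih
    obtain ⟨M, hM, hQ, rfl⟩ := hstep _ _ h2
    exact ⟨_, Run.tail _ M m hm hM hQ⟩

/-- Every pass marks at least one cell, so a bound on the number of marked cells bounds the number
of passes. -/
theorem terminates_of_run_le
    (hstep : ∀ 𝒮 𝒮', step 𝒮 𝒮' → ∃ M ⊆ 𝒮, Q 𝒮 M ∧ 𝒮' = R.refine 𝒮 M)
    (hne : ∀ 𝒮 M, Q 𝒮 M → M.Nonempty) {B : ℝ}
    (hB : ∀ 𝒯 m, R.Run Q 𝒯₀ 𝒯 m → (m : ℝ) ≤ B) : Terminates step 𝒯₀ := by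
  rintro ⟨u, hu0, hu⟩
  have h1 : ∀ n : ℕ, ∃ m, n ≤ m ∧ R.Run Q 𝒯₀ (u n) m := by
    intro n
    induction n with
    | zero => exact ⟨0, le_rfl, hu0 ▸ Run.refl⟩
    | succ n ih =>
      obtain ⟨m, hm, hrun⟩ := ih
      obtain ⟨M, hM, hQ, he⟩ := hstep _ _ (hu n)
      rw [he]
      have := (hne _ _ hQ).card_pos
      exact ⟨m + M.card, by omega, Run.tail _ M m hrun hM hQ⟩
  obtain ⟨m, hm, hrun⟩ := h1 (⌊B⌋₊ + 1)
  have h2 : B < (⌊B⌋₊ + 1 : ℕ) := by push_cast; exact Nat.lt_floor_add_one B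
  have h3 : ((⌊B⌋₊ + 1 : ℕ) : ℝ) ≤ m := by exact_mod_cast hm
  linarith [hB _ m hrun]

end RefinementStrategy
end

noncomputable section

/-! ### Complexity of the loops -/

variable {d : ℕ}

namespace RefinementStrategy

variable {R : RefinementStrategy d} {Ω ω : Set (E d)} {q : ℕ} {c Λ κ cΩ : ℝ} {𝒯 𝒯₀ : Mesh d}

theorem IsSound.sum_volume_le (h : R.IsSound Ω 𝒯) (hΩ : IsCompact (closure Ω)) {S : Set (E d)}
    {𝒰 : Mesh d} (h𝒰 : 𝒰 ⊆ 𝒯) (hS : ∀ T ∈ 𝒰, T ⊆ S) :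
    ∑ T ∈ 𝒰, volume.real T ≤ volume.real (S ∩ closure Ω) := by
  have hsub : (⋃ T ∈ 𝒰, T) ⊆ S ∩ closure Ω :=
    iUnion₂_subset fun T hT => subset_inter (hS T hT) (h.subset (h𝒰 hT))
  have hfin : volume (S ∩ closure Ω) ≠ ⊤ :=
    ((measure_mono inter_subset_right).trans_lt hΩ.measure_lt_top).ne
  have h1 := setIntegral_biUnion_of_overlap (μ := volume) 𝒰
    (fun K hK => (h.isCompact K (h𝒰 hK)).measurableSet)
    (fun K hK K' hK' => h.overlap K (h𝒰 hK) K' (h𝒰 hK')) (f := fun _ => (1 : ℝ))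
    (integrableOn_const ((measure_mono hsub).trans_lt hfin.lt_top).ne)
  simp only [setIntegral_const, smul_eq_mul, mul_one] at h1
  rw [← h1]
  exact measureReal_mono hsub hfin

theorem IsSound.sum_localIndicator_sq_le (h : R.IsSound Ω 𝒯) (hΩ : IsCompact (closure Ω))
    {S : Set (E d)} {g : E d → ℝ} {b W : ℝ} (hb : 0 ≤ b) (hW : volume.real (S ∩ closure Ω) ≤ W)
    {𝒰 : Mesh d} (h𝒰 : 𝒰 ⊆ 𝒯) (hS : ∀ T ∈ 𝒰, localIndicator g T ≠ 0 → T ⊆ S)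
    (hle : ∀ T ∈ 𝒰, localIndicator g T ^ 2 ≤ b * volume.real T) :
    ∑ T ∈ 𝒰, localIndicator g T ^ 2 ≤ b * W := by
  classical
  have h1 : ∑ T ∈ 𝒰.filter (fun T => localIndicator g T ≠ 0), localIndicator g T ^ 2 =
      ∑ T ∈ 𝒰, localIndicator g T ^ 2 := by
    refine Finset.sum_filter_of_ne fun T _ hT h0 => hT ?_
    rw [h0]; ring
  rw [← h1]
  calc _ ≤ ∑ T ∈ 𝒰.filter (fun T => localIndicator g T ≠ 0), b * volume.real T :=
        Finset.sum_le_sum fun T hT => hle T (Finset.mem_filter.1 hT).1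
    _ = b * ∑ T ∈ 𝒰.filter (fun T => localIndicator g T ≠ 0), volume.real T := by
        rw [Finset.mul_sum]
    _ ≤ b * W := by
        gcongr
        refine (h.sum_volume_le hΩ ((Finset.filter_subset _ _).trans h𝒰) ?_).trans hW
        intro T hT
        exact hS T (Finset.mem_filter.1 hT).1 (Finset.mem_filter.1 hT).2

open Classical in
/-- The number of cells marked by a loop whose marked cells carry large indicators. -/
theorem Run.le_of_large_indicators (hd : 2 ≤ d) (hR : R.IsAdmissible Ω q c Λ κ)
    (hΩ : IsCompact (closure Ω)) (h₀ : R.IsGenerated 𝒯₀) {g : E d → ℝ} {A W s θ τ : ℝ}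
    (hA : 0 < A) (hW : 0 < W) (hs : 0 < s) (hθ : 0 < θ) (hθ1 : θ ≤ 1) (hτ : 0 < τ) {S : Set (E d)}
    (hS : MeasurableSet S) (hSW : volume.real (S ∩ closure Ω) ≤ W)
    (hg : ∀ T, IsCompact T → localIndicator g T ^ 2 ≤ A ^ 2 * cellSize T ^ (d + 2))
    (hgS : ∀ 𝒮, R.IsGenerated 𝒮 → R.IsRefinementOf 𝒮 𝒯₀ → ∀ T ∈ 𝒮, localIndicator g T ≠ 0 → T ⊆ S)
    {Q : Mesh d → Mesh d → Prop}
    (hQ : ∀ 𝒮 M, M ⊆ 𝒮 → Q 𝒮 M → ∀ β : ℝ, 0 < β →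
      (∀ 𝒰 ⊆ 𝒮, (∀ K ∈ 𝒰, localIndicator g K ^ 2 ≤ β) →
        ∑ K ∈ 𝒰, localIndicator g K ^ 2 ≤ (s * τ) ^ 2) →
      M.card ≤ 2 * (M.filter fun T => θ * β ≤ localIndicator g T ^ 2).card)
    {m : ℕ} (h : R.Run Q 𝒯₀ 𝒯 m) :
    (m : ℝ) ≤ 2 * (W * (q / (θ * (s * τ / (A * √W))) ^ d)) := by
  -- The cell size that balances the tolerance: cells of size `H` filling a volume `W` carry at most
  -- `A² H² W = (s τ)²`.
  set H := s * τ / (A * √W) with hH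
  have hW' := Real.sqrt_pos.2 hW
  have hH0 : 0 < H := by positivity
  have hq := hR.q_pos
  have hHW : A ^ 2 * H ^ 2 * W = (s * τ) ^ 2 := by
    conv_lhs => rw [← Real.sq_sqrt hW.le]
    rw [hH]; field_simp
  set a : E d → ℝ := S.indicator fun _ => q / (θ * H) ^ d with ha
  have hai : IntegrableOn a (closure Ω) :=
    (integrableOn_const hΩ.measure_lt_top.ne).indicator hS
  have hint : ∫ x in closure Ω, a x ≤ W * (q / (θ * H) ^ d) := by
    rw [ha, integral_indicator hS, Measure.restrict_restrict hS, setIntegral_const, smul_eq_mul]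
    gcongr
  refine (h.le_integral hR h₀ hai (fun x => indicator_nonneg (fun _ _ => by positivity) x)
    ?_).trans (by gcongr)
  intro 𝒮 M h𝒮 h𝒮₀ hM hQM
  have hsound := h𝒮.isSound hR
  -- The threshold is the largest squared indicator which a cell of size `H` can have. Below it the
  -- indicator is at most `A² H² |T|`: by the size of small cells, and by the threshold itself for
  -- cells larger than `H`.
  refine (hQ 𝒮 M hM hQM (A ^ 2 * H ^ (d + 2)) (by positivity) ?_).trans ?_
  · intro 𝒰 h𝒰 hsmall
    rw [← hHW]
    refine hsound.sum_localIndicator_sq_le hΩ (by positivity) hSW h𝒰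
      (fun T hT => hgS 𝒮 h𝒮 h𝒮₀ T (h𝒰 hT)) fun T hT => ?_
    rw [← cellSize_pow hd T]
    have hT0 := cellSize_nonneg T
    rcases le_total (cellSize T) H with h1 | h1
    · calc _ ≤ A ^ 2 * cellSize T ^ (d + 2) := hg T (hsound.isCompact T (h𝒰 hT))
        _ = A ^ 2 * cellSize T ^ 2 * cellSize T ^ d := by ring
        _ ≤ A ^ 2 * H ^ 2 * cellSize T ^ d := by gcongr
    · calc _ ≤ A ^ 2 * H ^ (d + 2) := hsmall T hT
        _ = A ^ 2 * H ^ 2 * H ^ d := by ring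
        _ ≤ A ^ 2 * H ^ 2 * cellSize T ^ d := by gcongr
  · gcongr 2 * ?_
    refine Finset.card_le_card fun T hT => ?_
    obtain ⟨hTM, hTβ⟩ := Finset.mem_filter.1 hT
    refine Finset.mem_filter.2 ⟨hTM, fun x hx => ?_⟩
    have hT𝒮 := hM hTM
    have hne : localIndicator g T ≠ 0 := by
      intro h0
      rw [h0] at hTβ
      have : 0 < θ * (A ^ 2 * H ^ (d + 2)) := by positivity
      norm_num at hTβ
      linarith
    rw [ha, indicator_of_mem (hgS 𝒮 h𝒮 h𝒮₀ T hT𝒮 hne hx), ← cellSize_pow hd T]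
    -- As `θ ≤ 1`, its power `θ ^ (d + 2)` is at most `θ`, so a cell with at least the fraction `θ`
    -- of the threshold has size at least `θ H`.
    have h1 : (θ * H) ^ (d + 2) ≤ cellSize T ^ (d + 2) := by
      have h2 : A ^ 2 * (θ * H ^ (d + 2)) ≤ A ^ 2 * cellSize T ^ (d + 2) := by
        calc _ = θ * (A ^ 2 * H ^ (d + 2)) := by ring
          _ ≤ _ := hTβ.trans (hg T (hsound.isCompact T hT𝒮))
      have h3 := le_of_mul_le_mul_left h2 (by positivity)
      rw [mul_pow]
      refine le_trans ?_ h3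
      gcongr
      exact pow_le_of_le_one hθ.le hθ1 (by omega)
    have h4 : θ * H ≤ cellSize T :=
      (pow_le_pow_iff_left₀ (by positivity) (cellSize_nonneg T) (by omega)).1 h1
    gcongr

theorem Run.exists_pass_of_pos {Q : Mesh d → Mesh d → Prop} {m : ℕ} (hR : R.IsAdmissible Ω q c Λ κ)
    (h₀ : R.IsGenerated 𝒯₀) (h : R.Run Q 𝒯₀ 𝒯 m) : (𝒯 = 𝒯₀ ∧ m = 0) ∨
      ∃ 𝒮 M, R.IsGenerated 𝒮 ∧ R.IsRefinementOf 𝒮 𝒯₀ ∧ Q 𝒮 M := by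
  cases h with
  | refl => exact Or.inl ⟨rfl, rfl⟩
  | tail 𝒮 M m h1 hM hq => exact Or.inr ⟨𝒮, M, h1.isGenerated h₀, h1.isRefinementOf hR h₀, hq⟩

theorem interfaceStep_run {γ : Set (E d)} {r : ℝ} (𝒮 𝒮' : Mesh d)
    (h : R.InterfaceStep γ r 𝒮 𝒮') :
    ∃ M ⊆ 𝒮, (M = interfaceMarked γ r 𝒮 ∧ M.Nonempty) ∧ 𝒮' = R.refine 𝒮 M := by
  classical
  obtain ⟨⟨T, hT, hTr⟩, rfl⟩ := h
  exact ⟨_, (Finset.filter_subset _ _).trans (Finset.filter_subset _ _),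
    ⟨rfl, T, Finset.mem_filter.2 ⟨hT, hTr⟩⟩, rfl⟩

/-- With the rate as `r` times a `d`-th power, both the count of the loop and that of `INTERFACE`
compare directly. -/
theorem complexity_rate (F : ℝ) {r τ : ℝ} (hr : 0 < r) (hτ : 0 < τ) :
    r ^ (1 - (d : ℝ) / 2) * F ^ d * τ ^ (-(d : ℝ)) = r * (F / (τ * √r)) ^ d := by
  have h1 : r ^ ((d : ℝ) / 2) = √r ^ d := by
    rw [Real.sqrt_eq_rpow, ← Real.rpow_natCast, ← Real.rpow_mul hr.le]
    congr 1; ring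
  have hu := Real.sqrt_pos.2 hr
  rw [Real.rpow_sub hr, Real.rpow_one, h1, Real.rpow_neg hτ.le, Real.rpow_natCast, div_pow, mul_pow]
  field_simp

open Classical in
/-- The complexity of a loop which starts from the output of `INTERFACE` and marks cells which carry
large indicators of the regularized data. -/
theorem IsAdmissible.exists_run_le (hd : 2 ≤ d) (hΩ : IsLipschitzDomain Ω)
    (hω : IsLipschitzDomain ω) (hωΩ : ω ⊆ Ω) (hcΩ : 0 < cΩ)
    (hdist : ∀ x ∈ frontier ω, ∀ y ∈ frontier Ω, cΩ < dist x y)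
    {k : ℕ} {ψ : E d → ℝ} (hψ : IsMollifier k ψ) (hR : R.IsAdmissible Ω q c Λ κ)
    {s θ : ℝ} (hs : 0 < s) (hθ : 0 < θ) (hθ1 : θ ≤ 1) : ∃ K : ℝ, 0 < K ∧
      ∀ f : E d → ℝ, MemLp f ⊤ (surfaceMeasure (frontier ω)) → ∀ r : ℝ, 0 < r →
      ∀ 𝒯₀, R.IsInterface (frontier ω) R.initial r 𝒯₀ → ∀ τ : ℝ, 0 < τ →
      ∀ Q : Mesh d → Mesh d → Prop,
        (∀ 𝒮 M, Q 𝒮 M → τ < dataIndicator (regData ψ (frontier ω) f r) 𝒮) →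
        (∀ 𝒮 M, M ⊆ 𝒮 → Q 𝒮 M → ∀ β : ℝ, 0 < β →
          (∀ 𝒰 ⊆ 𝒮, (∀ K ∈ 𝒰, localIndicator (regData ψ (frontier ω) f r) K ^ 2 ≤ β) →
            ∑ K ∈ 𝒰, localIndicator (regData ψ (frontier ω) f r) K ^ 2 ≤ (s * τ) ^ 2) →
          M.card ≤ 2 * (M.filter fun T =>
            θ * β ≤ localIndicator (regData ψ (frontier ω) f r) T ^ 2).card) →
        ∀ 𝒯 m, R.Run Q 𝒯₀ 𝒯 m →
          (m : ℝ) ≤ K * r ^ (1 - (d : ℝ) / 2) * normLinfty (frontier ω) f ^ d * τ ^ (-(d : ℝ)) ∧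
          (𝒯.card : ℝ) - 𝒯₀.card ≤
            K * r ^ (1 - (d : ℝ) / 2) * normLinfty (frontier ω) f ^ d * τ ^ (-(d : ℝ)) := by
  obtain ⟨A₀, r₀, hA₀, hr₀, hreg⟩ := hψ.regData_bounds hd hω
  obtain ⟨Cg, hCg, hgrade⟩ := hR.exists_diam_le hd hΩ hωΩ hcΩ hdist hr₀
  obtain ⟨CI, hCI, hinter⟩ := hR.exists_interface_marked_le hd hΩ hω
  obtain ⟨Ct, hCt, hthick⟩ := hω.volume_thickening_le hΩ.isBounded.closure
  have hΩc : IsCompact (closure Ω) := hΩ.isBounded.isCompact_closure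
  have hu := unitSize_pos d
  have hΛ := hR.one_le
  have hq := hR.q_pos
  set w := r₀ + Cg with hw
  set C₁ := Ct * w with hC₁
  have hC₁0 : 0 < C₁ := by positivity
  set H₁ := unitSize d * Cg with hH₁
  have hH₁0 : 0 < H₁ := by positivity
  -- `K₁` accounts for the cells marked by the loop, `K₂` for those marked by `INTERFACE`.
  set K₁ := 2 * (C₁ * q) * (A₀ * √C₁ / (θ * s)) ^ d with hK₁
  set K₂ := CI * (A₀ * √C₁ * H₁) ^ d with hK₂
  have hC₁s : 0 < √C₁ := Real.sqrt_pos.2 hC₁0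
  refine ⟨Λ * (K₁ + K₂), by positivity, ?_⟩
  intro f hf r hr 𝒯₀ h𝒯₀ τ hτ Q hQτ hQM 𝒯 m hrun
  set g := regData ψ (frontier ω) f r with hg
  obtain ⟨-, hgA, hg0⟩ := hreg f hf r hr
  have hF := normLinfty_nonneg (frontier ω) f
  set F := normLinfty (frontier ω) f with hFdef
  have hrate := complexity_rate (d := d) F hr hτ
  have hgoal : Λ * (K₁ + K₂) * r ^ (1 - (d : ℝ) / 2) * F ^ d * τ ^ (-(d : ℝ)) =
      Λ * (K₁ + K₂) * (r * (F / (τ * √r)) ^ d) := by rw [← hrate]; ring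
  rw [hgoal]
  have hrs : 0 < √r := Real.sqrt_pos.2 hr
  obtain ⟨I, hI⟩ := exists_run_of_reflTransGen (interfaceStep_run (R := R)) h𝒯₀.1
  have hIle := hinter r hr 𝒯₀ I (hI.mono fun _ _ h => h.1)
  have h𝒯₀g : R.IsGenerated 𝒯₀ := hI.isGenerated Relation.ReflTransGen.refl
  have hs₀ := h𝒯₀g.isSound hR
  -- The grading is used only for the starting subdivision; a later cell lies in one of its cells,
  -- which meets the support strip and so is small and close to the interface.
  have hstrip : ∀ 𝒮, R.IsGenerated 𝒮 → R.IsRefinementOf 𝒮 𝒯₀ → ∀ T ∈ 𝒮, localIndicator g T ≠ 0 →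
      T ⊆ Metric.thickening (w * r) (frontier ω) ∧ cellSize T ≤ H₁ * r := by
    intro 𝒮 h𝒮 h𝒮₀ T hT hne
    obtain ⟨x, hxT, hx⟩ : ∃ x ∈ T, x ∈ Metric.thickening (r₀ * r) (frontier ω) := by
      by_contra! hno
      exact hne (localIndicator_eq_zero ((h𝒮.isSound hR).isCompact T hT).measurableSet
        fun x hx => hg0 x (hno x hx))
    obtain ⟨P, hP, hTP⟩ := hs₀.exists_subset hR h𝒮₀ hT
    have hPc := hs₀.isCompact P hP
    have hPd := hgrade r hr 𝒯₀ h𝒯₀g h𝒯₀.2 P hP x (hTP hxT) hx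
    constructor
    · intro z hz
      obtain ⟨y, hy, hxy⟩ := Metric.mem_thickening_iff.1 hx
      refine Metric.mem_thickening_iff.2 ⟨y, hy, ?_⟩
      have h1 := Metric.dist_le_diam_of_mem hPc.isBounded (hTP hz) (hTP hxT)
      calc dist z y ≤ dist z x + dist x y := dist_triangle _ _ _
        _ < Cg * r + r₀ * r := add_lt_add_of_le_of_lt (h1.trans hPd) hxy
        _ = w * r := by rw [hw]; ring
    · calc cellSize T ≤ cellSize P := cellSize_mono hPc.measure_lt_top.ne hTP
        _ ≤ unitSize d * Metric.diam P := cellSize_le_diam hd hPc ⟨x, hTP hxT⟩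
        _ ≤ unitSize d * (Cg * r) := by gcongr
        _ = H₁ * r := by rw [hH₁]; ring
  set A := A₀ * F / r with hAdef
  have hA0 : 0 ≤ A := by positivity
  have hgle : ∀ T, IsCompact T → localIndicator g T ^ 2 ≤ A ^ 2 * cellSize T ^ (d + 2) :=
    fun T hT => localIndicator_sq_le hd hA0 hgA hT
  set S := Metric.thickening (w * r) (frontier ω) with hS
  have hSm : MeasurableSet S := Metric.isOpen_thickening.measurableSet
  have hSW : volume.real (S ∩ closure Ω) ≤ C₁ * r := by
    rw [hC₁, mul_assoc]; exact hthick _ (by positivity)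
  -- Without a pass there is nothing to count. Otherwise some refinement has indicator above `τ`,
  -- which forces `τ` below a multiple of `F * √r`, and in particular `F > 0`.
  rcases hrun.exists_pass_of_pos hR h𝒯₀g with ⟨rfl, rfl⟩ | ⟨𝒮, M, h𝒮, h𝒮₀, hQSM⟩
  · rw [Nat.cast_zero, sub_self]
    have : 0 ≤ Λ * (K₁ + K₂) * (r * (F / (τ * √r)) ^ d) := by positivity
    exact ⟨this, this⟩
  have hτD := hQτ 𝒮 M hQSM
  have hD : dataIndicator g 𝒮 ^ 2 ≤ A ^ 2 * (H₁ * r) ^ 2 * (C₁ * r) := by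
    rw [dataIndicator_sq]
    have hsound := h𝒮.isSound hR
    refine hsound.sum_localIndicator_sq_le hΩc (by positivity) hSW Finset.Subset.rfl
      (fun T hT hne => (hstrip 𝒮 h𝒮 h𝒮₀ T hT hne).1) fun T hT => ?_
    by_cases hne : localIndicator g T = 0
    · rw [hne]
      have : 0 ≤ A ^ 2 * (H₁ * r) ^ 2 * volume.real T := by positivity
      simpa using this
    · have hT0 := cellSize_nonneg T
      rw [← cellSize_pow hd T]
      calc _ ≤ A ^ 2 * cellSize T ^ (d + 2) := hgle T (hsound.isCompact T hT)
        _ = A ^ 2 * cellSize T ^ 2 * cellSize T ^ d := by ring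
        _ ≤ A ^ 2 * (H₁ * r) ^ 2 * cellSize T ^ d := by
          gcongr; exact (hstrip 𝒮 h𝒮 h𝒮₀ T hT hne).2
  have hrr : √r ^ 2 = r := Real.sq_sqrt hr.le
  have hτlt : τ < A₀ * √C₁ * H₁ * (F * √r) := by
    refine lt_of_pow_lt_pow_left₀ 2 (by positivity)
      ((pow_lt_pow_left₀ hτD hτ.le two_ne_zero).trans_le (hD.trans_eq ?_))
    have h1 : (A₀ * √C₁ * H₁ * (F * √r)) ^ 2 = A₀ ^ 2 * √C₁ ^ 2 * H₁ ^ 2 * (F ^ 2 * √r ^ 2) := by ring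
    rw [h1, hrr, Real.sq_sqrt hC₁0.le, hAdef]
    field_simp
  have hFpos : 0 < F := by
    refine lt_of_le_of_ne hF fun h => ?_
    rw [← h] at hτlt
    simp at hτlt
    exact lt_asymm hτ hτlt
  have hApos : 0 < A := by positivity
  have hm : (m : ℝ) ≤ K₁ * (r * (F / (τ * √r)) ^ d) := by
    refine (hrun.le_of_large_indicators hd hR hΩc h𝒯₀g hApos (by positivity : 0 < C₁ * r) hs hθ hθ1
      hτ hSm hSW hgle (fun 𝒮 h1 h2 T hT hne => (hstrip 𝒮 h1 h2 T hT hne).1) hQM).trans_eq ?_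
    have h1 : θ * (s * τ / (A * √(C₁ * r))) = (A₀ * √C₁ / (θ * s) * (F / (τ * √r)))⁻¹ := by
      rw [Real.sqrt_mul hC₁0.le, hAdef]
      have : r = √r * √r := by rw [← sq, hrr]
      conv_lhs => rw [this]
      rw [Real.sqrt_mul_self hrs.le]
      field_simp
    rw [h1, hK₁, inv_pow, div_inv_eq_mul, mul_pow]
    ring
  -- The count of order `r^(1-d)` is multiplied by the `d`-th power of a multiple of `F √r / τ` that
  -- is at least `1`, which turns it into the required rate.
  have hIr : (I : ℝ) ≤ K₂ * (r * (F / (τ * √r)) ^ d) := by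
    have h1 : 1 ≤ (A₀ * √C₁ * H₁ * (F * √r) / τ) ^ d :=
      one_le_pow₀ ((one_le_div hτ).2 hτlt.le)
    have hrd : r ^ d = r ^ (d - 1) * r := by rw [← pow_succ]; congr 1; omega
    calc (I : ℝ) ≤ CI / r ^ (d - 1) := hIle
      _ ≤ CI / r ^ (d - 1) * (A₀ * √C₁ * H₁ * (F * √r) / τ) ^ d :=
        le_mul_of_one_le_right (by positivity) h1
      _ = CI * r / r ^ d * (A₀ * √C₁ * H₁ * (F * √r) / τ) ^ d := by
        rw [hrd]; field_simp
      _ = CI * (A₀ * √C₁ * H₁) ^ d * (r * (F * √r / τ / r) ^ d) := by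
        rw [mul_div_assoc (A₀ * √C₁ * H₁), mul_pow, div_pow (F * √r / τ)]; ring
      _ = K₂ * (r * (F / (τ * √r)) ^ d) := by
        rw [hK₂]
        congr 3
        nth_rewrite 2 [← hrr]
        field_simp
  constructor
  · calc (m : ℝ) ≤ K₁ * (r * (F / (τ * √r)) ^ d) := hm
      _ ≤ Λ * (K₁ + K₂) * (r * (F / (τ * √r)) ^ d) := by
        gcongr
        have : 0 ≤ K₁ + K₂ := by positivity
        have : 0 ≤ K₂ := by positivity
        nlinarith
  · have hfull : R.Run (fun _ _ => True) R.initial 𝒯 (I + m) :=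
      (hI.mono fun _ _ _ => trivial).trans (hrun.mono fun _ _ _ => trivial)
    have h1 := hfull.card_sub_le hR
    have h2 : (R.initial.card : ℝ) ≤ 𝒯₀.card := by
      exact_mod_cast hR.isSound_initial.card_le hR
        (hI.isRefinementOf hR Relation.ReflTransGen.refl)
    push_cast at h1
    calc (𝒯.card : ℝ) - 𝒯₀.card ≤ Λ * (I + m) := by linarith
      _ ≤ Λ * (K₂ * (r * (F / (τ * √r)) ^ d) + K₁ * (r * (F / (τ * √r)) ^ d)) := by gcongr
      _ = _ := by ring

end RefinementStrategy
end

noncomputable section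

/-! ### The loops as runs, and the final assembly -/

variable {d : ℕ}

namespace RefinementStrategy

variable {R : RefinementStrategy d}

theorem greedyStep_run {g : E d → ℝ} {τ : ℝ} (𝒮 𝒮' : Mesh d) (h : R.GreedyStep g τ 𝒮 𝒮') :
    ∃ M ⊆ 𝒮, (τ < dataIndicator g 𝒮 ∧ ∃ T ∈ 𝒮,
      (∀ K ∈ 𝒮, localIndicator g K ≤ localIndicator g T) ∧ M = {T}) ∧ 𝒮' = R.refine 𝒮 M := by
  obtain ⟨hD, T, hT, hmax, rfl⟩ := h
  exact ⟨{T}, by simpa using hT, ⟨hD, T, hT, hmax, rfl⟩, rfl⟩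

theorem dataStep_run {g : E d → ℝ} {τ θ : ℝ} (𝒮 𝒮' : Mesh d) (h : R.DataStep g τ θ 𝒮 𝒮') :
    ∃ M ⊆ 𝒮, (τ < dataIndicator g 𝒮 ∧ IsMarked g θ 𝒮 M) ∧ 𝒮' = R.refine 𝒮 M := by
  obtain ⟨hD, M, hM, rfl⟩ := h
  exact ⟨M, hM.1, ⟨hD, hM⟩, rfl⟩

/-- A pass is deterministic, so of two outputs one is reached from the other; as no further pass is
possible, they agree. -/
theorem existsUnique_isInterface {γ : Set (E d)} {r : ℝ} {𝒯 : Mesh d}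
    (h : Terminates (R.InterfaceStep γ r) 𝒯) : ∃! 𝒯', R.IsInterface γ 𝒯 r 𝒯' := by
  have hterm : ∀ 𝒮, (∀ T ∈ touching γ 𝒮, cellSize T ≤ r / 2) → ∀ 𝒮', ¬ R.InterfaceStep γ r 𝒮 𝒮' := by
    rintro 𝒮 h1 𝒮' ⟨⟨T, hT, hTr⟩, -⟩
    exact (h1 T hT).not_gt hTr
  obtain ⟨𝒯', h1, h2⟩ := h.exists_output
  have h3 : ∀ T ∈ touching γ 𝒯', cellSize T ≤ r / 2 := by
    intro T hT
    by_contra! h4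
    exact h2 ⟨_, ⟨T, hT, h4⟩, rfl⟩
  refine ⟨𝒯', ⟨h1, h3⟩, ?_⟩
  rintro 𝒯'' ⟨h4, h5⟩
  have huniq : Relator.RightUnique (R.InterfaceStep γ r) := by
    rintro 𝒮 𝒮₁ 𝒮₂ ⟨-, rfl⟩ ⟨-, rfl⟩
    rfl
  rcases Relation.ReflTransGen.total_of_right_unique huniq h1 h4 with h6 | h6
  · rcases Relation.ReflTransGen.cases_head h6 with h7 | ⟨_, h7, _⟩
    exacts [h7.symm, absurd h7 (hterm _ h3 _)]
  · rcases Relation.ReflTransGen.cases_head h6 with h7 | ⟨_, h7, _⟩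
    exacts [h7, absurd h7 (hterm _ h5 _)]

end RefinementStrategy

end

theorem lemmal (d : ℕ) (hd : 2 ≤ d)
    (Ω ω : Set (E d)) (hΩ : IsLipschitzDomain Ω) (hω : IsLipschitzDomain ω) (hωΩ : ω ⊆ Ω)
    (cΩ : ℝ) (hcΩ : 0 < cΩ)
    (hdist : ∀ x ∈ frontier ω, ∀ y ∈ frontier Ω, cΩ < dist x y)
    (k : ℕ) (ψ : E d → ℝ) (hψ : IsMollifier k ψ)
    (R : RefinementStrategy d) (q : ℕ) (c Λ κ : ℝ) (hR : R.IsAdmissible Ω q c Λ κ)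
    (hgrid : ResolvesInterface R (frontier ω) q) :
    -- `INTERFACE(𝒯_0, r)` terminates with a unique output
    (∀ r : ℝ, 0 < r → r < cΩ →
      Terminates (R.InterfaceStep (frontier ω) r) R.initial ∧
        ∃! 𝒯, R.IsInterface (frontier ω) R.initial r 𝒯) ∧
    -- the data `F^r` are square integrable
    (∀ f : E d → ℝ, MemLp f ⊤ (surfaceMeasure (frontier ω)) → ∀ r : ℝ, 0 < r →
      MemLp (regData ψ (frontier ω) f r) 2 (volume.restrict Ω)) ∧
    -- the bound for `GREEDY`
    (∃ K₀ : ℝ, 0 < K₀ ∧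
      ∀ f : E d → ℝ, MemLp f ⊤ (surfaceMeasure (frontier ω)) →
      ∀ r : ℝ, 0 < r → r < cΩ →
      ∀ 𝒯, R.IsInterface (frontier ω) R.initial r 𝒯 →
      ∀ τ : ℝ, 0 < τ →
        Terminates (R.GreedyStep (regData ψ (frontier ω) f r) τ) 𝒯 ∧
        (∃ 𝒯', R.IsGreedy 𝒯 (regData ψ (frontier ω) f r) τ 𝒯') ∧
        ∀ 𝒯', R.IsGreedy 𝒯 (regData ψ (frontier ω) f r) τ 𝒯' →
          (𝒯'.card : ℝ) - (𝒯.card : ℝ) ≤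
            K₀ * r ^ (1 - (d : ℝ) / 2) * normLinfty (frontier ω) f ^ d * τ ^ (-(d : ℝ))) ∧
    -- the data-approximation assumption with `s = 1 / d`
    (∀ θ : ℝ, 0 < θ → θ < 1 → ∃ K₁ : ℝ, 0 < K₁ ∧
      ∀ f : E d → ℝ, MemLp f ⊤ (surfaceMeasure (frontier ω)) →
      ∀ r : ℝ, 0 < r → r < cΩ →
      ∀ 𝒯, R.IsInterface (frontier ω) R.initial r 𝒯 →
        R.DataAssumption 𝒯 (regData ψ (frontier ω) f r) θ (1 / (d : ℝ))
          (K₁ * r ^ (1 - (d : ℝ) / 2) * normLinfty (frontier ω) f ^ d)) := by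
  have hinterface : ∀ r : ℝ, 0 < r → Terminates (R.InterfaceStep (frontier ω) r) R.initial := by
    intro r hr
    obtain ⟨C, -, hC⟩ := hR.exists_interface_marked_le hd hΩ hω
    exact RefinementStrategy.terminates_of_run_le RefinementStrategy.interfaceStep_run
      (fun _ _ h => h.2) fun 𝒯 m h => hC r hr 𝒯 m (h.mono fun _ _ h1 => h1.1)
  refine ⟨fun r hr _ => ⟨hinterface r hr,
    RefinementStrategy.existsUnique_isInterface (hinterface r hr)⟩, ?_, ?_, ?_⟩
  · intro f hf r hr
    obtain ⟨A₀, r₀, -, -, hreg⟩ := hψ.regData_bounds hd hω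
    obtain ⟨h1, h2, -⟩ := hreg f hf r hr
    have : IsFiniteMeasure (volume.restrict Ω) :=
      ⟨by rw [Measure.restrict_apply_univ]; exact hΩ.isBounded.measure_lt_top⟩
    exact MemLp.of_bound h1.restrict _ (ae_restrict_of_ae h2)
  -- For `GREEDY` both parameters are `1`: the single marked cell reaches the full threshold.
  · obtain ⟨K, hK, hmain⟩ := hR.exists_run_le hd hΩ hω hωΩ hcΩ hdist hψ one_pos one_pos le_rfl
    refine ⟨K, hK, fun f hf r hr _ 𝒯 h𝒯 τ hτ => ?_⟩
    have hrun := hmain f hf r hr 𝒯 h𝒯 τ hτ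
      (fun 𝒮 M => τ < dataIndicator (regData ψ (frontier ω) f r) 𝒮 ∧ ∃ T ∈ 𝒮,
        (∀ K ∈ 𝒮, localIndicator (regData ψ (frontier ω) f r) K ≤
          localIndicator (regData ψ (frontier ω) f r) T) ∧ M = {T}) (fun _ _ h => h.1) ?_
    · have hterm := RefinementStrategy.terminates_of_run_le RefinementStrategy.greedyStep_run
        (by rintro _ _ ⟨-, T, -, -, rfl⟩; exact Finset.singleton_nonempty T)
        fun 𝒯' m h => (hrun 𝒯' m h).1
      refine ⟨hterm, ?_, fun 𝒯' h𝒯' => ?_⟩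
      · obtain ⟨𝒯', h1, h2⟩ := hterm.exists_output
        refine ⟨𝒯', h1, not_lt.1 fun hD => h2 ?_⟩
        obtain ⟨T, hT, hmax⟩ := exists_maximal_localIndicator _ hτ hD
        exact ⟨_, hD, T, hT, hmax, rfl⟩
      · obtain ⟨m, hm⟩ := RefinementStrategy.exists_run_of_reflTransGen
          RefinementStrategy.greedyStep_run h𝒯'.1
        exact (hrun 𝒯' m hm).2
    · rintro 𝒮 M - ⟨hD, T, hT, hmax, rfl⟩ β hβ hsmall
      rw [one_mul] at hsmall
      have h1 := le_sq_of_maximal hτ hD hmax hsmall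
      rw [Finset.filter_true_of_mem fun K hK => by
        rw [Finset.mem_singleton.1 hK, one_mul]; exact h1]
      omega
  · intro θ hθ hθ1
    have hθ2 : 0 < 1 - θ ^ 2 := by nlinarith
    -- The slack `1 - θ ^ 2` of the bulk criterion reduces the tolerance, and strong marked cells
    -- reach the fraction `min (θ ^ 2) (1 / 2)` of the threshold.
    obtain ⟨K, hK, hmain⟩ := hR.exists_run_le hd hΩ hω hωΩ hcΩ hdist hψ (Real.sqrt_pos.2 hθ2)
      (lt_min (by positivity) (by norm_num) : 0 < min (θ ^ 2) (1 / 2))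
      ((min_le_right _ _).trans (by norm_num))
    refine ⟨K, hK, fun f hf r hr _ 𝒯 h𝒯 τ hτ => ?_⟩
    have hrun := hmain f hf r hr 𝒯 h𝒯 τ hτ
      (fun 𝒮 M => τ < dataIndicator (regData ψ (frontier ω) f r) 𝒮 ∧
        RefinementStrategy.IsMarked (regData ψ (frontier ω) f r) θ 𝒮 M) (fun _ _ h => h.1) ?_
    · have hterm := RefinementStrategy.terminates_of_run_le RefinementStrategy.dataStep_run
        (fun _ _ h => h.2.nonempty hτ hθ h.1) fun 𝒯' m h => (hrun 𝒯' m h).1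
      refine ⟨hterm, ?_, fun 𝒯' h𝒯' => ?_⟩
      · obtain ⟨𝒯', h1, h2⟩ := hterm.exists_output
        refine ⟨𝒯', h1, not_lt.1 fun hD => h2 ?_⟩
        obtain ⟨M, hM⟩ := exists_isMarked (regData ψ (frontier ω) f r) hθ1.le 𝒯'
        exact ⟨_, hD, M, hM, rfl⟩
      · obtain ⟨m, hm⟩ := RefinementStrategy.exists_run_of_reflTransGen
          RefinementStrategy.dataStep_run h𝒯'.1
        rw [one_div_one_div]
        exact (hrun 𝒯' m hm).2
    · rintro 𝒮 M - ⟨hD, hM⟩ β hβ hsmall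
      rw [mul_pow, Real.sq_sqrt hθ2.le] at hsmall
      exact hM.card_le hτ hβ hθ hθ1 hD hsmall
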